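/- Let $g\ge 2$ and let $X$ be the complex hyperelliptic curve of genus $g$ with equation $y^2=f(x)$, where $f\in\mathbb C[x]$ is monic with distinct roots and $\deg f\in\{2g+1,2g+2\}$. That is, $X$ is the compact Riemann surface obtained by gluing the affine curves $C_0=\{y^2=f(x)\}$ and $C_0'=\{w^2=z^{2g+2}f(1/z)\}$ along $(z,w)=(1/x,\,y/x^{g+1})$. Let $\iota$ be the hyperelliptic involution $(x,y)\mapsto(x,-y)$, $(z,w)\mapsto(z,-w)$, and let $X$ carry the canonical metric $$ds^2=\sum_{i=1}^{g}\omega_i\otimes\overline{\omega_i}=\frac{\sigma_g(|x|^2)}{|y|^2}\,dx\otimes d\bar x,\qquad \omega_i=\frac{x^{i-1}dx}{y},\quad \sigma_g(t)=1+t+\dots+t^{g-1}$$ (the pull-back of the standard flat metric of the Jacobian under the Abel–Jacobi map defined by $\omega_1,\dots,\omega_g$), with area measure $d\nu$, Gaussian curvature $K$ and Laplace–Beltrami operator $\Delta$; if $ds^2=\rho\,d\zeta\otimes d\bar\zeta$ then $\Delta=\frac4\rho\partial_\zeta\partial_{\bar\zeta}$ and $K=-\frac12\Delta\log\rho$. Put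 $d(t)=\bigl(\sigma_g(|t|^2)(1+|t|^2)^2\bigr)^{1/(2g+2)}$. For $P\in C_0$ define $F_P(Q)=|x(Q)-x(P)|/d(x(Q))$ for $Q\in C_0$ and $F_P(Q)=|1-z(Q)x(P)|/d(z(Q))$ for $Q\in C_0'$; for $P\in X\setminus C_0$ (a point at infinity) define $F_P(Q)=1/d(x(Q))$ for $Q\in C_0$ and $F_P(Q)=|z(Q)|/d(z(Q))$ for $Q\in C_0'$. Let $F_W=\prod_{i}F_{P_i}$, where $P_1,\dots,P_{2g+2}$ are the Weierstrass points of $X$, i.e. the fixed points of $\iota$. Let $P\in X$. Then $F_P>0$ on $X\setminus\{P,\iota(P)\}$, and $u_P=\log F_P$ is smooth on $X\setminus\{P,\iota(P)\}$, satisfies $u_P\circ\iota=u_P$ there, and $u_{\iota(P)}=u_P$. Moreover, for every $\varphi\in C^\infty(X,\mathbb C)$ the limit $$(\Delta u_P)(\varphi)=\lim_{\epsilon\to0^+}\int_{X\setminus(D_\epsilon(P)\cup D_\epsilon(\iota(P)))}u_P\,\Delta\varphi\,d\nu$$ exists, where $D_\epsilon(P)$ and $D_\epsilon(\iota(P))$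 are the closed discs of radius $\epsilon$ around $P$ and $\iota(P)$ in arbitrary holomorphic local coordinates at these points (the limit does not depend on the coordinates). It defines a continuous linear functional on $C^\infty(X,\mathbb C)$ with its Fréchet topology, and $$\Delta u_P=\frac{1}{g+1}K-\frac{4}{g+1}F_W+2\pi(\delta_P+\delta_{\iota(P)}),$$ that is, for every $\varphi\in C^\infty(X,\mathbb C)$, $$(\Delta u_P)(\varphi)=\int_X\Bigl(\frac{K}{g+1}-\frac{4F_W}{g+1}\Bigr)\varphi\,d\nu+2\pi\bigl(\varphi(P)+\varphi(\iota(P))\bigr).$$ -/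

import Mathlib

open scoped Manifold ContDiff Topology
open MeasureTheory

noncomputable section

/-! ### Smooth affine curves `y² = p(x)` and their holomorphic charts -/

/-- The affine plane curve `{(x, y) ∈ ℂ² : y² = p(x)}`, with the subspace topology. -/
abbrev AffineCurve (p : Polynomial ℂ) : Type := {q : ℂ × ℂ // q.2 ^ 2 = p.eval q.1}

/-- A polynomial with non-zero derivative at `a` is a homeomorphism from an open neighbourhood of
`a`, on which the derivative does not vanish, onto an open set. -/
def polyLocalHomeo (p : Polynomial ℂ) (a : ℂ) (h : p.derivative.eval a ≠ 0) :
    OpenPartialHomeomorph ℂ ℂ :=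
  (((p.hasStrictDerivAt a).hasStrictFDerivAt_equiv h).toOpenPartialHomeomorph
    (fun t => p.eval t)).restrOpen {t | p.derivative.eval t ≠ 0}
    (isOpen_ne_fun p.derivative.continuous continuous_const)

theorem polyLocalHomeo_apply (p : Polynomial ℂ) (a : ℂ) (h : p.derivative.eval a ≠ 0) (t : ℂ) :
    polyLocalHomeo p a h t = p.eval t := rfl

theorem mem_polyLocalHomeo_source (p : Polynomial ℂ) (a : ℂ) (h : p.derivative.eval a ≠ 0) :
    a ∈ (polyLocalHomeo p a h).source :=
  ⟨((p.hasStrictDerivAt a).hasStrictFDerivAt_equiv h).mem_toOpenPartialHomeomorph_source, h⟩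

theorem derivative_ne_zero_of_mem_source (p : Polynomial ℂ) (a : ℂ) (h : p.derivative.eval a ≠ 0)
    {t : ℂ} (ht : t ∈ (polyLocalHomeo p a h).source) : p.derivative.eval t ≠ 0 := ht.2

theorem contDiff_eval_poly (p : Polynomial ℂ) : ContDiff ℂ ω (fun t => p.eval t) := by
  simpa using! p.contDiff_aeval (𝕜 := ℂ) ω

theorem polyLocalHomeo_contDiffAt_symm (p : Polynomial ℂ) (a : ℂ) (h : p.derivative.eval a ≠ 0)
    {t : ℂ} (ht : t ∈ (polyLocalHomeo p a h).target) :
    ContDiffAt ℂ ω (polyLocalHomeo p a h).symm t :=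
  (polyLocalHomeo p a h).contDiffAt_symm_deriv
    (derivative_ne_zero_of_mem_source p a h ((polyLocalHomeo p a h).map_target ht)) ht
    (p.hasDerivAt _) (contDiff_eval_poly p).contDiffAt

/-- A local inverse of `y ↦ y²` near `b ≠ 0`. -/
def sqLocalHomeo (b : ℂ) (hb : b ≠ 0) : OpenPartialHomeomorph ℂ ℂ :=
  polyLocalHomeo (Polynomial.X ^ 2) b (by simpa using hb)

theorem sqLocalHomeo_apply (b : ℂ) (hb : b ≠ 0) (t : ℂ) : sqLocalHomeo b hb t = t ^ 2 := by
  simp [sqLocalHomeo, polyLocalHomeo_apply]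

namespace AffineCurve

variable {p : Polynomial ℂ}

open Classical in
/-- The chart `(x, y) ↦ x` near a point `q` of `y² = p(x)` with `y(q) ≠ 0`. Its inverse is
`x ↦ (x, s(p(x)))`, where `s` is the branch of the square root with `s(p(x(q))) = y(q)`. -/
def chartX (q : AffineCurve p) (hq : q.1.2 ≠ 0) : OpenPartialHomeomorph (AffineCurve p) ℂ where
  toFun r := r.1.1
  invFun t :=
    if h : p.eval t ∈ (sqLocalHomeo q.1.2 hq).target then
      ⟨(t, (sqLocalHomeo q.1.2 hq).symm (p.eval t)), by
        rw [← sqLocalHomeo_apply q.1.2 hq]; exact (sqLocalHomeo q.1.2 hq).right_inv h⟩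
    else q
  source := {r | r.1.2 ∈ (sqLocalHomeo q.1.2 hq).source}
  target := {t | p.eval t ∈ (sqLocalHomeo q.1.2 hq).target}
  map_source' r hr := by
    have := (sqLocalHomeo q.1.2 hq).map_source hr
    rwa [sqLocalHomeo_apply, r.2] at this
  map_target' t ht := by
    have ht' : p.eval t ∈ (sqLocalHomeo q.1.2 hq).target := ht
    simp only [ht', dif_pos, Set.mem_ofPred_eq]
    exact (sqLocalHomeo q.1.2 hq).map_target ht'
  left_inv' r hr := by
    have h := (sqLocalHomeo q.1.2 hq).map_source hr
    rw [sqLocalHomeo_apply, r.2] at h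
    have h2 := (sqLocalHomeo q.1.2 hq).left_inv hr
    rw [sqLocalHomeo_apply, r.2] at h2
    simp only [h, dif_pos]
    exact Subtype.ext (Prod.ext rfl h2)
  right_inv' t ht := by
    have ht' : p.eval t ∈ (sqLocalHomeo q.1.2 hq).target := ht
    simp only [ht', dif_pos]
  open_source := (sqLocalHomeo q.1.2 hq).open_source.preimage (by fun_prop)
  open_target := (sqLocalHomeo q.1.2 hq).open_target.preimage p.continuous
  continuousOn_toFun := by fun_prop
  continuousOn_invFun := by
    have hind : Topology.IsInducing (Subtype.val : AffineCurve p → ℂ × ℂ) := ⟨rfl⟩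
    rw [hind.continuousOn_iff]
    have : ContinuousOn (fun t => (t, (sqLocalHomeo q.1.2 hq).symm (p.eval t)))
        {t | p.eval t ∈ (sqLocalHomeo q.1.2 hq).target} :=
      continuousOn_id.prodMk
        ((sqLocalHomeo q.1.2 hq).continuousOn_symm.comp p.continuous.continuousOn fun _ h => h)
    refine this.congr fun t ht => ?_
    have ht' : p.eval t ∈ (sqLocalHomeo q.1.2 hq).target := ht
    simp only [Function.comp, ht', dif_pos]

open Classical in
/-- The chart `(x, y) ↦ y` near a point `q` of `y² = p(x)` with `p'(x(q)) ≠ 0`. Its inverse is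
`y ↦ (s(y²), y)`, where `s` is the local inverse of `p` with `s(p(x(q))) = x(q)`. -/
def chartY (q : AffineCurve p) (hq : p.derivative.eval q.1.1 ≠ 0) :
    OpenPartialHomeomorph (AffineCurve p) ℂ where
  toFun r := r.1.2
  invFun t :=
    if h : t ^ 2 ∈ (polyLocalHomeo p q.1.1 hq).target then
      ⟨((polyLocalHomeo p q.1.1 hq).symm (t ^ 2), t), by
        rw [← polyLocalHomeo_apply p q.1.1 hq]
        exact ((polyLocalHomeo p q.1.1 hq).right_inv h).symm⟩
    else q
  source := {r | r.1.1 ∈ (polyLocalHomeo p q.1.1 hq).source}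
  target := {t | t ^ 2 ∈ (polyLocalHomeo p q.1.1 hq).target}
  map_source' r hr := by
    have := (polyLocalHomeo p q.1.1 hq).map_source hr
    rwa [polyLocalHomeo_apply, ← r.2] at this
  map_target' t ht := by
    have ht' : t ^ 2 ∈ (polyLocalHomeo p q.1.1 hq).target := ht
    simp only [ht', dif_pos, Set.mem_ofPred_eq]
    exact (polyLocalHomeo p q.1.1 hq).map_target ht'
  left_inv' r hr := by
    have h := (polyLocalHomeo p q.1.1 hq).map_source hr
    rw [polyLocalHomeo_apply, ← r.2] at h
    have h2 := (polyLocalHomeo p q.1.1 hq).left_inv hr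
    rw [polyLocalHomeo_apply, ← r.2] at h2
    simp only [h, dif_pos]
    exact Subtype.ext (Prod.ext h2 rfl)
  right_inv' t ht := by
    have ht' : t ^ 2 ∈ (polyLocalHomeo p q.1.1 hq).target := ht
    simp only [ht', dif_pos]
  open_source := (polyLocalHomeo p q.1.1 hq).open_source.preimage (by fun_prop)
  open_target := (polyLocalHomeo p q.1.1 hq).open_target.preimage (by fun_prop)
  continuousOn_toFun := by fun_prop
  continuousOn_invFun := by
    have hind : Topology.IsInducing (Subtype.val : AffineCurve p → ℂ × ℂ) := ⟨rfl⟩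
    rw [hind.continuousOn_iff]
    have : ContinuousOn (fun t => ((polyLocalHomeo p q.1.1 hq).symm (t ^ 2), t))
        {t | t ^ 2 ∈ (polyLocalHomeo p q.1.1 hq).target} :=
      ((polyLocalHomeo p q.1.1 hq).continuousOn_symm.comp
        (continuous_pow 2 : Continuous fun t : ℂ => t ^ 2).continuousOn fun _ h => h).prodMk
        continuousOn_id
    refine this.congr fun t ht => ?_
    have ht' : t ^ 2 ∈ (polyLocalHomeo p q.1.1 hq).target := ht
    simp only [Function.comp, ht', dif_pos]

theorem chartX_symm_apply (q : AffineCurve p) (hq : q.1.2 ≠ 0) {t : ℂ}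
    (ht : p.eval t ∈ (sqLocalHomeo q.1.2 hq).target) :
    ((chartX q hq).symm t).1 = (t, (sqLocalHomeo q.1.2 hq).symm (p.eval t)) :=
  congrArg Subtype.val (dif_pos ht)

theorem chartY_symm_apply (q : AffineCurve p) (hq : p.derivative.eval q.1.1 ≠ 0) {t : ℂ}
    (ht : t ^ 2 ∈ (polyLocalHomeo p q.1.1 hq).target) :
    ((chartY q hq).symm t).1 = ((polyLocalHomeo p q.1.1 hq).symm (t ^ 2), t) :=
  congrArg Subtype.val (dif_pos ht)

open Classical in
/-- The chart at a smooth point `q` of `y² = p(x)`: the coordinate `x` if `y(q) ≠ 0`, and the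
coordinate `y` if `y(q) = 0`. -/
def chart (q : AffineCurve p) (hq : q.1.2 = 0 → p.derivative.eval q.1.1 ≠ 0) :
    OpenPartialHomeomorph (AffineCurve p) ℂ :=
  if h : q.1.2 = 0 then chartY q (hq h) else chartX q h

theorem mem_chart_source (q : AffineCurve p) (hq : q.1.2 = 0 → p.derivative.eval q.1.1 ≠ 0) :
    q ∈ (chart q hq).source := by
  unfold chart
  split_ifs with h
  · exact mem_polyLocalHomeo_source p q.1.1 (hq h)
  · exact mem_polyLocalHomeo_source (Polynomial.X ^ 2) q.1.2 _

theorem chart_eq_or (q : AffineCurve p) (hq : q.1.2 = 0 → p.derivative.eval q.1.1 ≠ 0) :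
    (∀ r, chart q hq r = r.1.1) ∨ (∀ r, chart q hq r = r.1.2) := by
  unfold chart
  split_ifs with h
  · exact Or.inr fun r => rfl
  · exact Or.inl fun r => rfl

theorem contDiffOn_chart_symm (q : AffineCurve p)
    (hq : q.1.2 = 0 → p.derivative.eval q.1.1 ≠ 0) :
    ContDiffOn ℂ ω (fun t => ((chart q hq).symm t).1) (chart q hq).target := by
  unfold chart
  split_ifs with h
  · have : ContDiffOn ℂ ω (fun t => ((polyLocalHomeo p q.1.1 (hq h)).symm (t ^ 2), t))
        {t | t ^ 2 ∈ (polyLocalHomeo p q.1.1 (hq h)).target} := by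
      intro t ht
      refine ContDiffAt.contDiffWithinAt (ContDiffAt.prodMk ?_ contDiffAt_id)
      exact (polyLocalHomeo_contDiffAt_symm p q.1.1 (hq h) ht).comp t (by fun_prop)
    refine this.congr fun t ht => ?_
    have ht' : t ^ 2 ∈ (polyLocalHomeo p q.1.1 (hq h)).target := ht
    rw [chartY_symm_apply q (hq h) ht']
  · have : ContDiffOn ℂ ω (fun t => (t, (sqLocalHomeo q.1.2 h).symm (p.eval t)))
        {t | p.eval t ∈ (sqLocalHomeo q.1.2 h).target} := by
      intro t ht
      refine ContDiffAt.contDiffWithinAt (ContDiffAt.prodMk contDiffAt_id ?_)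
      exact (polyLocalHomeo_contDiffAt_symm (Polynomial.X ^ 2) q.1.2 _ ht).comp t
        (contDiff_eval_poly p).contDiffAt
    refine this.congr fun t ht => ?_
    have ht' : p.eval t ∈ (sqLocalHomeo q.1.2 h).target := ht
    rw [chartX_symm_apply q h ht']

end AffineCurve

/-! ### The hyperelliptic curve -/

/-- An equation `y² = f(x)` of a hyperelliptic curve of genus `g`: `f` is a monic complex polynomial
without multiple roots, of degree `2g + 1` or `2g + 2`. -/
structure HyperellipticEquation (g : ℕ) where
  f : Polynomial ℂ
  monic : f.Monic
  squarefree : Squarefree f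
  natDegree_eq : f.natDegree = 2 * g + 1 ∨ f.natDegree = 2 * g + 2

namespace HyperellipticEquation

variable {g : ℕ} (H : HyperellipticEquation g)

/-- The polynomial `z^(2g+2) f(1/z)`. -/
def fInf : Polynomial ℂ := H.f.reflect (2 * g + 2)

theorem eval_fInf_mul {x z : ℂ} (h : z * x = 1) :
    H.fInf.eval z = H.f.eval x * z ^ (2 * g + 2) := by
  have hx : x ≠ 0 := right_ne_zero_of_mul_eq_one h
  have hz : z = x⁻¹ := eq_inv_of_mul_eq_one_left h
  let _ : Invertible x := invertibleOfNonzero hx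
  have hd : H.f.natDegree ≤ 2 * g + 2 := by have := H.natDegree_eq; omega
  have := Polynomial.eval₂_reflect_mul_pow (RingHom.id ℂ) x (2 * g + 2) H.f hd
  rw [invOf_eq_inv, ← hz] at this
  change H.fInf.eval z * x ^ (2 * g + 2) = H.f.eval x at this
  rw [← this, mul_assoc, ← mul_pow, mul_comm x z, h, one_pow, mul_one]

theorem derivative_ne_zero (x : ℂ) (h : H.f.eval x = 0) : H.f.derivative.eval x ≠ 0 := by
  have hs : H.f.Separable := PerfectField.separable_iff_squarefree.2 H.squarefree
  obtain ⟨a, b, hab⟩ := hs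
  intro h'
  have := congrArg (Polynomial.eval x) hab
  simp [h, h'] at this

theorem derivative_fInf_ne_zero (h : H.fInf.eval 0 = 0) : H.fInf.derivative.eval 0 ≠ 0 := by
  have h0 : H.fInf.eval 0 = H.f.coeff (2 * g + 2) := by
    rw [← Polynomial.coeff_zero_eq_eval_zero, fInf, Polynomial.coeff_reflect]
    simp [Polynomial.revAt_le]
  have h1 : H.fInf.derivative.eval 0 = H.f.coeff (2 * g + 1) := by
    rw [← Polynomial.coeff_zero_eq_eval_zero, Polynomial.coeff_derivative, fInf,
      Polynomial.coeff_reflect, Polynomial.revAt_le (by omega)]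
    simp
  have hm : H.f.coeff H.f.natDegree = 1 := H.monic
  rcases H.natDegree_eq with hd | hd
  · rw [h1, ← hd, hm]; exact one_ne_zero
  · rw [h0, ← hd, hm] at h; exact absurd h one_ne_zero

/-- The affine curve `C₀ : y² = f(x)`. -/
abbrev AffineZero : Type := AffineCurve H.f

/-- The affine curve `C₀' : w² = z^(2g+2) f(1/z)`. -/
abbrev AffineInf : Type := AffineCurve H.fInf

/-- The gluing relation on `C₀ ⊔ C₀'`: the point `(x, y)` of `C₀` with `x ≠ 0` is identified with
the point `(z, w) = (1/x, y/x^(g+1))` of `C₀'`. -/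
def Glue : H.AffineZero ⊕ H.AffineInf → H.AffineZero ⊕ H.AffineInf → Prop
  | .inl p, .inl q => p = q
  | .inr p, .inr q => p = q
  | .inl p, .inr q => q.1.1 * p.1.1 = 1 ∧ q.1.2 = p.1.2 * q.1.1 ^ (g + 1)
  | .inr q, .inl p => q.1.1 * p.1.1 = 1 ∧ q.1.2 = p.1.2 * q.1.1 ^ (g + 1)

theorem glue_unique_right {p : H.AffineZero} {q r : H.AffineInf}
    (h : H.Glue (.inl p) (.inr q)) (h' : H.Glue (.inl p) (.inr r)) : q = r := by
  obtain ⟨h1, h2⟩ := h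
  obtain ⟨h3, h4⟩ := h'
  have hz : q.1.1 = r.1.1 :=
    (eq_inv_of_mul_eq_one_left h1).trans (eq_inv_of_mul_eq_one_left h3).symm
  exact Subtype.ext (Prod.ext hz (by rw [h2, h4, hz]))

theorem glue_unique_left {p r : H.AffineZero} {q : H.AffineInf}
    (h : H.Glue (.inl p) (.inr q)) (h' : H.Glue (.inl r) (.inr q)) : p = r := by
  obtain ⟨h1, h2⟩ := h
  obtain ⟨h3, h4⟩ := h'
  have hq : q.1.1 ≠ 0 := left_ne_zero_of_mul_eq_one h1
  refine Subtype.ext (Prod.ext (mul_left_cancel₀ hq (h1.trans h3.symm)) ?_)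
  exact mul_right_cancel₀ (pow_ne_zero (g + 1) hq) (h2.symm.trans h4)

/-- The gluing relation is an equivalence relation. -/
def glueSetoid : Setoid (H.AffineZero ⊕ H.AffineInf) where
  r := H.Glue
  iseqv :=
    { refl := by rintro (p | p) <;> exact rfl
      symm := by
        rintro (p | p) (q | q) h
        · exact Eq.symm h
        · exact h
        · exact h
        · exact Eq.symm h
      trans := by
        rintro (p | p) (q | q) (r | r) h h'
        · exact Eq.trans h h'
        · obtain rfl : p = q := h; exact h'
        · exact H.glue_unique_left (q := q) h h'
        · obtain rfl : q = r := h'; exact h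
        · obtain rfl : q = r := h'; exact h
        · exact H.glue_unique_right (p := q) h h'
        · obtain rfl : p = q := h; exact h'
        · exact Eq.trans h h' }

/-- The hyperelliptic curve `X`: the compactification of `y² = f(x)` obtained by gluing `C₀` and
`C₀'`, with the quotient topology. -/
def Curve : Type := Quotient H.glueSetoid

instance : TopologicalSpace H.Curve := inferInstanceAs (TopologicalSpace (Quotient H.glueSetoid))

instance : MeasurableSpace H.Curve := borel H.Curve

instance : BorelSpace H.Curve := ⟨rfl⟩

/-- The inclusion of `C₀` in `X`. -/
def incl (p : H.AffineZero) : H.Curve := Quotient.mk H.glueSetoid (Sum.inl p)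

/-- The inclusion of `C₀'` in `X`. -/
def inclInf (p : H.AffineInf) : H.Curve := Quotient.mk H.glueSetoid (Sum.inr p)

theorem continuous_incl : Continuous H.incl := continuous_quotient_mk'.comp continuous_inl

theorem continuous_inclInf : Continuous H.inclInf := continuous_quotient_mk'.comp continuous_inr

theorem incl_injective : Function.Injective H.incl := fun _ _ h => Quotient.exact h

theorem inclInf_injective : Function.Injective H.inclInf := fun _ _ h => Quotient.exact h

theorem incl_eq_inclInf {p : H.AffineZero} {q : H.AffineInf} :
    H.incl p = H.inclInf q ↔ H.Glue (.inl p) (.inr q) :=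
  ⟨fun h => Quotient.exact h, fun h => Quotient.sound h⟩

/-- The point of `C₀'` glued to a point of `C₀` with `x ≠ 0`. -/
def toInf (p : H.AffineZero) (hp : p.1.1 ≠ 0) : H.AffineInf :=
  ⟨(p.1.1⁻¹, p.1.2 * p.1.1⁻¹ ^ (g + 1)), by
    rw [H.eval_fInf_mul (inv_mul_cancel₀ hp), ← p.2]; ring⟩

theorem glue_toInf (p : H.AffineZero) (hp : p.1.1 ≠ 0) :
    H.Glue (.inl p) (.inr (H.toInf p hp)) := ⟨inv_mul_cancel₀ hp, rfl⟩

/-- The point of `C₀` glued to a point of `C₀'` with `z ≠ 0`. -/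
def toZero (q : H.AffineInf) (hq : q.1.1 ≠ 0) : H.AffineZero :=
  ⟨(q.1.1⁻¹, q.1.2 * q.1.1⁻¹ ^ (g + 1)), by
    have h := H.eval_fInf_mul (mul_inv_cancel₀ hq)
    rw [← q.2] at h
    have hz : q.1.1 ^ (2 * g + 2) * q.1.1⁻¹ ^ (2 * g + 2) = 1 := by
      rw [← mul_pow, mul_inv_cancel₀ hq, one_pow]
    calc (q.1.2 * q.1.1⁻¹ ^ (g + 1)) ^ 2 = q.1.2 ^ 2 * q.1.1⁻¹ ^ (2 * g + 2) := by ring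
      _ = H.f.eval q.1.1⁻¹ := by rw [h, mul_assoc, hz, mul_one]⟩

theorem glue_toZero (q : H.AffineInf) (hq : q.1.1 ≠ 0) :
    H.Glue (.inl (H.toZero q hq)) (.inr q) := by
  refine ⟨mul_inv_cancel₀ hq, ?_⟩
  change q.1.2 = q.1.2 * q.1.1⁻¹ ^ (g + 1) * q.1.1 ^ (g + 1)
  rw [mul_assoc, ← mul_pow, inv_mul_cancel₀ hq, one_pow, mul_one]

theorem isOpenEmbedding_incl : Topology.IsOpenEmbedding H.incl := by
  refine .of_continuous_injective_isOpenMap H.continuous_incl H.incl_injective fun U hU => ?_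
  change IsOpen (Quotient.mk H.glueSetoid ⁻¹' (H.incl '' U))
  rw [isOpen_sum_iff]
  constructor
  · convert hU using 1
    exact H.incl_injective.preimage_image U
  · have hV : IsOpen {q : H.AffineInf | q.1.1 ≠ 0} :=
      isOpen_ne_fun (by fun_prop) continuous_const
    have hc : Continuous fun q : {q : H.AffineInf | q.1.1 ≠ 0} => H.toZero q.1 q.2 := by
      have hi : Continuous fun q : {q : H.AffineInf | q.1.1 ≠ 0} => (q.1.1.1)⁻¹ :=
        Continuous.inv₀ (by fun_prop) fun q => q.2
      refine Continuous.subtype_mk (hi.prodMk ?_) _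
      exact Continuous.mul (by fun_prop) (hi.pow _)
    convert hV.isOpenEmbedding_subtypeVal.isOpenMap _ (hU.preimage hc) using 1
    ext q
    constructor
    · rintro ⟨p, hp, hpq⟩
      have hg := H.incl_eq_inclInf.1 hpq
      have hq : q.1.1 ≠ 0 := left_ne_zero_of_mul_eq_one hg.1
      refine ⟨⟨q, hq⟩, ?_, rfl⟩
      have := H.glue_unique_left hg (H.glue_toZero q hq)
      change H.toZero q hq ∈ U
      rwa [← this]
    · rintro ⟨⟨r, hr⟩, hrU, rfl⟩
      exact ⟨_, hrU, H.incl_eq_inclInf.2 (H.glue_toZero r hr)⟩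

theorem isOpenEmbedding_inclInf : Topology.IsOpenEmbedding H.inclInf := by
  refine .of_continuous_injective_isOpenMap H.continuous_inclInf H.inclInf_injective fun U hU => ?_
  change IsOpen (Quotient.mk H.glueSetoid ⁻¹' (H.inclInf '' U))
  rw [isOpen_sum_iff]
  constructor
  · have hV : IsOpen {q : H.AffineZero | q.1.1 ≠ 0} :=
      isOpen_ne_fun (by fun_prop) continuous_const
    have hc : Continuous fun q : {q : H.AffineZero | q.1.1 ≠ 0} => H.toInf q.1 q.2 := by
      have hi : Continuous fun q : {q : H.AffineZero | q.1.1 ≠ 0} => (q.1.1.1)⁻¹ :=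
        Continuous.inv₀ (by fun_prop) fun q => q.2
      refine Continuous.subtype_mk (hi.prodMk ?_) _
      exact Continuous.mul (by fun_prop) (hi.pow _)
    convert hV.isOpenEmbedding_subtypeVal.isOpenMap _ (hU.preimage hc) using 1
    ext q
    constructor
    · rintro ⟨p, hp, hpq⟩
      have hg := H.incl_eq_inclInf.1 hpq.symm
      have hq : q.1.1 ≠ 0 := right_ne_zero_of_mul_eq_one hg.1
      refine ⟨⟨q, hq⟩, ?_, rfl⟩
      have := H.glue_unique_right hg (H.glue_toInf q hq)
      change H.toInf q hq ∈ U
      rwa [← this]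
    · rintro ⟨⟨r, hr⟩, hrU, rfl⟩
      exact ⟨_, hrU, (H.incl_eq_inclInf.2 (H.glue_toInf r hr)).symm⟩
  · convert hU using 1
    exact H.inclInf_injective.preimage_image U

/-- The points of `X` not in `C₀` are the points of `C₀'` with `z = 0`. -/
theorem exists_inclInf_of_notMem {Q : H.Curve} (hQ : Q ∉ Set.range H.incl) :
    ∃ q : H.AffineInf, q.1.1 = 0 ∧ H.inclInf q = Q := by
  induction Q using Quotient.inductionOn with
  | h a =>
    rcases a with p | q
    · exact absurd ⟨p, rfl⟩ hQ
    · refine ⟨q, ?_, rfl⟩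
      by_contra hq
      exact hQ ⟨H.toZero q hq, H.incl_eq_inclInf.2 (H.glue_toZero q hq)⟩

/-! ### Coordinate functions, the involution and the complex structure -/

/-- The coordinate `x` on `X`, extended by `0` to the points at infinity. -/
def x : H.Curve → ℂ :=
  Quotient.lift (Sum.elim (fun p => p.1.1) (fun q => q.1.1⁻¹)) (by
    rintro (p | p) (q | q) h
    · exact congrArg (fun r : H.AffineZero => r.1.1) h
    · exact eq_inv_of_mul_eq_one_right h.1
    · exact (eq_inv_of_mul_eq_one_right h.1).symm
    · exact congrArg (fun r : H.AffineInf => r.1.1⁻¹) h)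

/-- The coordinate `y` on `X`, extended by `0` to the points at infinity. -/
def y : H.Curve → ℂ :=
  Quotient.lift (Sum.elim (fun p => p.1.2) (fun q => q.1.2 * q.1.1⁻¹ ^ (g + 1))) (by
    have key : ∀ (p : H.AffineZero) (q : H.AffineInf), H.Glue (.inl p) (.inr q) →
        p.1.2 = q.1.2 * q.1.1⁻¹ ^ (g + 1) := by
      rintro p q ⟨h1, h2⟩
      have hq : q.1.1 ≠ 0 := left_ne_zero_of_mul_eq_one h1
      rw [h2, mul_assoc, ← mul_pow, mul_inv_cancel₀ hq, one_pow, mul_one]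
    rintro (p | p) (q | q) h
    · exact congrArg (fun r : H.AffineZero => r.1.2) h
    · exact key p q h
    · exact (key q p h).symm
    · exact congrArg (fun r : H.AffineInf => r.1.2 * r.1.1⁻¹ ^ (g + 1)) h)

/-- The coordinate `z` on `X`, extended by `0` to the points of `C₀` with `x = 0`. -/
def z : H.Curve → ℂ :=
  Quotient.lift (Sum.elim (fun p => p.1.1⁻¹) (fun q => q.1.1)) (by
    rintro (p | p) (q | q) h
    · exact congrArg (fun r : H.AffineZero => r.1.1⁻¹) h
    · exact (eq_inv_of_mul_eq_one_left h.1).symm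
    · exact eq_inv_of_mul_eq_one_left h.1
    · exact congrArg (fun r : H.AffineInf => r.1.1) h)

/-- The coordinate `w` on `X`, extended by `0` to the points of `C₀` with `x = 0`. -/
def w : H.Curve → ℂ :=
  Quotient.lift (Sum.elim (fun p => p.1.2 * p.1.1⁻¹ ^ (g + 1)) (fun q => q.1.2)) (by
    have key : ∀ (p : H.AffineZero) (q : H.AffineInf), H.Glue (.inl p) (.inr q) →
        p.1.2 * p.1.1⁻¹ ^ (g + 1) = q.1.2 := by
      rintro p q ⟨h1, h2⟩
      rw [h2, eq_inv_of_mul_eq_one_left h1]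
    rintro (p | p) (q | q) h
    · exact congrArg (fun r : H.AffineZero => r.1.2 * r.1.1⁻¹ ^ (g + 1)) h
    · exact key p q h
    · exact (key q p h).symm
    · exact congrArg (fun r : H.AffineInf => r.1.2) h)

/-- The hyperelliptic involution `(x, y) ↦ (x, -y)`, `(z, w) ↦ (z, -w)`. -/
def invol : H.Curve → H.Curve :=
  Quotient.map
    (Sum.map (fun p : H.AffineZero => (⟨(p.1.1, -p.1.2), by rw [neg_sq]; exact p.2⟩ : H.AffineZero))
      (fun q : H.AffineInf => (⟨(q.1.1, -q.1.2), by rw [neg_sq]; exact q.2⟩ : H.AffineInf))) (by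
    have key : ∀ (p : H.AffineZero) (q : H.AffineInf), H.Glue (.inl p) (.inr q) →
        q.1.1 * p.1.1 = 1 ∧ -q.1.2 = -p.1.2 * q.1.1 ^ (g + 1) := by
      rintro p q ⟨h1, h2⟩
      exact ⟨h1, by rw [h2, neg_mul]⟩
    rintro (p | p) (q | q) h
    · obtain rfl : p = q := h; exact rfl
    · exact key p q h
    · exact key q p h
    · obtain rfl : p = q := h; exact rfl)

open Classical in
/-- The chart of `X` at `Q`: one of the coordinates `x`, `y` if `Q ∈ C₀`, and one of the coordinates
`z`, `w` otherwise. -/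
def chartAtPoint (Q : H.Curve) : OpenPartialHomeomorph H.Curve ℂ :=
  if h : Q ∈ Set.range H.incl then
    (AffineCurve.chart h.choose fun h0 => H.derivative_ne_zero _ (by
      rw [← h.choose.2, h0]; ring)).lift_openEmbedding H.isOpenEmbedding_incl
  else
    (AffineCurve.chart (H.exists_inclInf_of_notMem h).choose fun h0 => by
      have hz := (H.exists_inclInf_of_notMem h).choose_spec.1
      rw [hz]
      refine H.derivative_fInf_ne_zero ?_
      have h2 := (H.exists_inclInf_of_notMem h).choose.2
      rw [hz, h0] at h2
      rw [← h2]
      ring).lift_openEmbedding H.isOpenEmbedding_inclInf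

theorem mem_chartAtPoint_source (Q : H.Curve) : Q ∈ (H.chartAtPoint Q).source := by
  unfold chartAtPoint
  split_ifs with h
  · exact ⟨_, AffineCurve.mem_chart_source _ _, h.choose_spec⟩
  · exact ⟨_, AffineCurve.mem_chart_source _ _, (H.exists_inclInf_of_notMem h).choose_spec.2⟩

instance : ChartedSpace ℂ H.Curve where
  atlas := Set.range H.chartAtPoint
  chartAt := H.chartAtPoint
  mem_chart_source := H.mem_chartAtPoint_source
  chart_mem_atlas Q := ⟨Q, rfl⟩

/-- What the compatibility of the charts needs: a chart is one of the coordinates `x`, `y` on an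
open set of `C₀`, or `z`, `w` on an open set of `C₀'`, with holomorphic inverse. -/
theorem chartAtPoint_cases (Q : H.Curve) :
    (∃ c : OpenPartialHomeomorph H.AffineZero ℂ,
      H.chartAtPoint Q = c.lift_openEmbedding H.isOpenEmbedding_incl ∧
      ((∀ r, c r = r.1.1) ∨ ∀ r, c r = r.1.2) ∧
      ContDiffOn ℂ ω (fun t => (c.symm t).1) c.target) ∨
    (∃ c : OpenPartialHomeomorph H.AffineInf ℂ,
      H.chartAtPoint Q = c.lift_openEmbedding H.isOpenEmbedding_inclInf ∧
      ((∀ r, c r = r.1.1) ∨ ∀ r, c r = r.1.2) ∧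
      ContDiffOn ℂ ω (fun t => (c.symm t).1) c.target) := by
  unfold chartAtPoint
  split_ifs with h
  · exact Or.inl ⟨_, rfl, AffineCurve.chart_eq_or _ _, AffineCurve.contDiffOn_chart_symm _ _⟩
  · exact Or.inr ⟨_, rfl, AffineCurve.chart_eq_or _ _, AffineCurve.contDiffOn_chart_symm _ _⟩

theorem contDiffOn_coord {p : Polynomial ℂ} {c c' : OpenPartialHomeomorph (AffineCurve p) ℂ}
    (hc' : (∀ r, c' r = r.1.1) ∨ ∀ r, c' r = r.1.2)
    (hc : ContDiffOn ℂ ω (fun t => (c.symm t).1) c.target) :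
    ContDiffOn ℂ ω (c.symm.trans c') (c.symm.trans c').source := by
  have hc := hc.mono (fun t (ht : t ∈ (c.symm.trans c').source) => ht.1)
  rcases hc' with hc' | hc'
  · exact hc.fst.congr fun t _ => hc' _
  · exact hc.snd.congr fun t _ => hc' _

/-- `X` is a Riemann surface. -/
instance : IsManifold 𝓘(ℂ) ω H.Curve := by
  refine isManifold_of_contDiffOn _ _ _ ?_
  rintro e e' ⟨Q, rfl⟩ ⟨Q', rfl⟩
  have key : ContDiffOn ℂ ω ((H.chartAtPoint Q).symm.trans (H.chartAtPoint Q'))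
      ((H.chartAtPoint Q).symm.trans (H.chartAtPoint Q')).source := by
    rcases H.chartAtPoint_cases Q with ⟨c, hcQ, -, hc⟩ | ⟨c, hcQ, -, hc⟩ <;>
    rcases H.chartAtPoint_cases Q' with ⟨c', hcQ', hc', -⟩ | ⟨c', hcQ', hc', -⟩ <;>
    rw [hcQ, hcQ']
    · rw [OpenPartialHomeomorph.lift_openEmbedding_trans]
      exact contDiffOn_coord hc' hc
    · have hsub : ∀ t ∈ ((c.lift_openEmbedding H.isOpenEmbedding_incl).symm.trans
          (c'.lift_openEmbedding H.isOpenEmbedding_inclInf)).source,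
          ∃ h0 : (c.symm t).1.1 ≠ 0, t ∈ c.target ∧
          ((c.lift_openEmbedding H.isOpenEmbedding_incl).symm.trans
          (c'.lift_openEmbedding H.isOpenEmbedding_inclInf)) t = c' (H.toInf (c.symm t) h0) := by
        rintro t ⟨ht, q, hq, hqt⟩
        have hg := H.incl_eq_inclInf.1 hqt.symm
        have h0 : (c.symm t).1.1 ≠ 0 := right_ne_zero_of_mul_eq_one hg.1
        refine ⟨h0, ht, ?_⟩
        have : H.inclInf (H.toInf (c.symm t) h0) = H.incl (c.symm t) :=
          (H.incl_eq_inclInf.2 (H.glue_toInf _ h0)).symm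
        change (c'.lift_openEmbedding H.isOpenEmbedding_inclInf) (H.incl (c.symm t)) = _
        rw [← this, OpenPartialHomeomorph.lift_openEmbedding_apply]
      have hc := hc.mono fun t ht => (hsub t ht).2.1
      have hi := hc.fst.inv fun t ht => (hsub t ht).1
      rcases hc' with hc' | hc'
      · exact hi.congr fun t ht => by
          obtain ⟨h0, -, h⟩ := hsub t ht
          rw [h, hc']; rfl
      · exact (hc.snd.mul (hi.pow (g + 1))).congr fun t ht => by
          obtain ⟨h0, -, h⟩ := hsub t ht
          rw [h, hc']; rfl
    · have hsub : ∀ t ∈ ((c.lift_openEmbedding H.isOpenEmbedding_inclInf).symm.trans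
          (c'.lift_openEmbedding H.isOpenEmbedding_incl)).source,
          ∃ h0 : (c.symm t).1.1 ≠ 0, t ∈ c.target ∧
          ((c.lift_openEmbedding H.isOpenEmbedding_inclInf).symm.trans
          (c'.lift_openEmbedding H.isOpenEmbedding_incl)) t = c' (H.toZero (c.symm t) h0) := by
        rintro t ⟨ht, q, hq, hqt⟩
        have hg := H.incl_eq_inclInf.1 hqt
        have h0 : (c.symm t).1.1 ≠ 0 := left_ne_zero_of_mul_eq_one hg.1
        refine ⟨h0, ht, ?_⟩
        have : H.incl (H.toZero (c.symm t) h0) = H.inclInf (c.symm t) :=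
          H.incl_eq_inclInf.2 (H.glue_toZero _ h0)
        change (c'.lift_openEmbedding H.isOpenEmbedding_incl) (H.inclInf (c.symm t)) = _
        rw [← this, OpenPartialHomeomorph.lift_openEmbedding_apply]
      have hc := hc.mono fun t ht => (hsub t ht).2.1
      have hi := hc.fst.inv fun t ht => (hsub t ht).1
      rcases hc' with hc' | hc'
      · exact hi.congr fun t ht => by
          obtain ⟨h0, -, h⟩ := hsub t ht
          rw [h, hc']; rfl
      · exact (hc.snd.mul (hi.pow (g + 1))).congr fun t ht => by
          obtain ⟨h0, -, h⟩ := hsub t ht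
          rw [h, hc']; rfl
    · rw [OpenPartialHomeomorph.lift_openEmbedding_trans]
      exact contDiffOn_coord hc' hc
  refine key.mono ?_
  rintro t ⟨ht, -⟩
  exact ht

/-! ### The canonical metric, its area measure, Laplacian and curvature -/

open Classical in
/-- The coefficient of the holomorphic one-form `x^j dx / y` (`0 ≤ j < g`) in the coordinate `e`, at
the point `Q = e⁻¹(ζ)`. Where `y = 0`, one has `dx / y = 2 dy / f'(x)`; at infinity,
`x^j dx / y = -z^(g-1-j) dz / w`, and `dz / w = 2 dw / fInf'(z)` if moreover `w = 0`. -/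
def omegaCoeff (j : ℕ) (e : OpenPartialHomeomorph H.Curve ℂ) (ζ : ℂ) : ℂ :=
  let Q := e.symm ζ
  if Q ∈ Set.range H.incl then
    if H.y Q ≠ 0 then
      H.x Q ^ j * deriv (fun t => H.x (e.symm t)) ζ / H.y Q
    else
      H.x Q ^ j * (2 * deriv (fun t => H.y (e.symm t)) ζ) / H.f.derivative.eval (H.x Q)
  else
    if H.w Q ≠ 0 then
      -(H.z Q ^ (g - 1 - j) * deriv (fun t => H.z (e.symm t)) ζ / H.w Q)
    else
      -(H.z Q ^ (g - 1 - j) * (2 * deriv (fun t => H.w (e.symm t)) ζ) /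
        H.fInf.derivative.eval (H.z Q))

/-- The conformal factor `ρ` of the canonical metric
`ds² = ∑ ω_j ⊗ conj ω_j = ρ(ζ) dζ ⊗ conj dζ`, `ω_j = x^j dx / y` for `0 ≤ j < g`, in the coordinate
`ζ` given by the chart `e`. It is the pull-back of the standard flat metric of the Jacobian under the
Abel-Jacobi map defined by the forms `ω_j`. -/
def conformalFactor (e : OpenPartialHomeomorph H.Curve ℂ) (ζ : ℂ) : ℝ :=
  ∑ j ∈ Finset.range g, ‖H.omegaCoeff j e ζ‖ ^ 2

/-- The Laplace-Beltrami operator of the canonical metric: `ρ⁻¹ (∂²/∂s² + ∂²/∂t²)` in a holomorphic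
coordinate `ζ = s + i t`. -/
def laplaceBeltrami (φ : H.Curve → ℂ) (Q : H.Curve) : ℂ :=
  ((H.conformalFactor (chartAt ℂ Q) (chartAt ℂ Q Q))⁻¹ : ℝ) •
    Laplacian.laplacian (fun ζ => φ ((chartAt ℂ Q).symm ζ)) (chartAt ℂ Q Q)

/-- The Gaussian curvature of the canonical metric: `K = -(1/(2ρ)) (∂²/∂s² + ∂²/∂t²) log ρ`. -/
def gaussCurvature (Q : H.Curve) : ℝ :=
  -(1 / 2) * (H.conformalFactor (chartAt ℂ Q) (chartAt ℂ Q Q))⁻¹ *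
    Laplacian.laplacian (fun ζ => Real.log (H.conformalFactor (chartAt ℂ Q) ζ)) (chartAt ℂ Q Q)

/-- `σ_g(t) = 1 + t + ⋯ + t^(g-1)`. -/
def sigma (g : ℕ) (t : ℝ) : ℝ := ∑ i ∈ Finset.range g, t ^ i

/-- The two (discontinuous, measurable) sections `x ↦ (x, √f(x))` and `x ↦ (x, -√f(x))` of the
coordinate `x`. Together they pass through every point of `C₀`, and exactly once if `y ≠ 0`. -/
def sheet (s : ℤˣ) (t : ℂ) : H.Curve :=
  H.incl ⟨(t, ((s : ℤ) : ℂ) * H.f.eval t ^ (1 / 2 : ℂ)), by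
    have h : (H.f.eval t ^ (1 / 2 : ℂ)) ^ 2 = H.f.eval t := by
      rw [one_div]; exact Complex.cpow_ofNat_inv_pow _ 2
    have hs : (((s : ℤ) : ℂ)) ^ 2 = 1 := by
      rw [← Int.cast_pow, ← Units.val_pow_eq_pow_val, Int.units_sq]; simp
    change (((s : ℤ) : ℂ) * H.f.eval t ^ (1 / 2 : ℂ)) ^ 2 = H.f.eval t
    rw [mul_pow, h, hs, one_mul]⟩

theorem measurable_sheet (s : ℤˣ) : Measurable (H.sheet s) := by
  refine H.continuous_incl.measurable.comp (Measurable.subtype_mk ?_)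
  refine measurable_id.prodMk (measurable_const.mul ?_)
  exact H.f.continuous.measurable.pow_const _

/-- The area measure `dν` of the canonical metric. In the coordinate `x` it is `ρ` times Lebesgue
measure, `ρ = σ_g(|x|²) / |f(x)|`, on each of the two sheets of `x`; the finitely many points of `X`
with `y = 0` or at infinity have measure zero. -/
def area : Measure H.Curve :=
  ∑ s : ℤˣ, Measure.map (H.sheet s)
    (volume.withDensity fun t : ℂ => ENNReal.ofReal (sigma g (‖t‖ ^ 2) / ‖H.f.eval t‖))

/-! ### The functions `F_P` and `u_P` -/

/-- The denominator `(σ_g(|t|²) (1 + |t|²)²)^(1/(2g+2))`. -/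
def den (g : ℕ) (t : ℂ) : ℝ :=
  (sigma g (‖t‖ ^ 2) * (1 + ‖t‖ ^ 2) ^ 2) ^ (1 / (2 * (g : ℝ) + 2))

open Classical in
/-- The function `F_P`. A point not in `C₀` has `z = 0`; for `Q` in both `C₀` and `C₀'`, the formulas
in `x(Q)` and in `z(Q) = 1 / x(Q)` agree. -/
def F (P Q : H.Curve) : ℝ :=
  if P ∈ Set.range H.incl then
    if Q ∈ Set.range H.incl then ‖H.x Q - H.x P‖ / den g (H.x Q)
    else ‖1 - H.z Q * H.x P‖ / den g (H.z Q)
  else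
    if Q ∈ Set.range H.incl then 1 / den g (H.x Q)
    else ‖H.z Q‖ / den g (H.z Q)

/-- The Weierstrass points: the (finitely many) fixed points of the involution. -/
def weierstrassPoints : Set H.Curve := {Q | H.invol Q = Q}

/-- `F_W = ∏ F_P`, the product over the Weierstrass points `P`. -/
def FW (Q : H.Curve) : ℝ := ∏ᶠ P ∈ H.weierstrassPoints, H.F P Q

/-- `u_P = log F_P`. -/
def u (P Q : H.Curve) : ℝ := Real.log (H.F P Q)

/-! ### Smooth functions and distributions -/

/-- The complex vector space of smooth functions `X → ℂ`. -/
def smoothSubmodule : Submodule ℂ (H.Curve → ℂ) where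
  carrier := {φ | ContMDiff 𝓘(ℝ, ℂ) 𝓘(ℝ, ℂ) ∞ φ}
  add_mem' ha hb := ContMDiff.add ha hb
  zero_mem' := contMDiff_const
  smul_mem' c φ hφ := by
    have h : ContMDiff 𝓘(ℝ, ℂ) 𝓘(ℝ, ℂ) ∞ (fun v : ℂ => c * v) :=
      ContDiff.contMDiff (contDiff_const.mul contDiff_id)
    exact h.comp hφ

/-- `C^∞(X, ℂ)`. -/
def SmoothFunction : Type := H.smoothSubmodule

instance : AddCommGroup H.SmoothFunction := inferInstanceAs (AddCommGroup H.smoothSubmodule)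

instance : Module ℂ H.SmoothFunction := inferInstanceAs (Module ℂ H.smoothSubmodule)

instance : CoeFun H.SmoothFunction (fun _ => H.Curve → ℂ) := ⟨fun φ => φ.1⟩

/-- The Fréchet topology of `C^∞(X, ℂ)`: uniform convergence of the derivatives of every order `n`,
in every chart, on the compact subsets of the chart. -/
instance : TopologicalSpace H.SmoothFunction :=
  ⨅ (Q : H.Curve) (n : ℕ), TopologicalSpace.induced
    (fun φ : H.SmoothFunction =>
      UniformOnFun.ofFun {S : Set ℂ | IsCompact S ∧ S ⊆ (chartAt ℂ Q).target}
        (iteratedFDeriv ℝ n fun ζ => φ ((chartAt ℂ Q).symm ζ)))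
    inferInstance

/-- The closed coordinate disc of radius `ε` around `Q` in the holomorphic coordinate `e`. -/
def coordDisc (e : OpenPartialHomeomorph H.Curve ℂ) (Q : H.Curve) (ε : ℝ) : Set H.Curve :=
  {R | R ∈ e.source ∧ ‖e R - e Q‖ ≤ ε}

end HyperellipticEquation

end

/-!
The double cover `x : X → ℙ¹` turns the assertion into one about the plane. On either sheet of `x`,
`F_P` is `|t - a| / d(t)` with `a = x(P)`, or `1 / d(t)` if `P` is at infinity. Hence
`u_P = log |t - a| - log d(t)`, where the first summand (absent if `P` is at infinity) is
harmonic away from `a`, and the smooth part of `Δ u_P` is `-ρ⁻¹ Δ log d`. Since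
`d^(2g+2) = σ_g(|t|²)(1 + |t|²)²`, while `ρ = σ_g(|t|²) / |f(t)|` and `F_W = |f| / d^(2g+2)`, this is
`K / (g + 1) - 4 F_W / (g + 1)` (`density_mul_curvature`).

For the distributional statement a smooth function `φ` on `X` is replaced by its fibre sum
`Φ(t) = ∑ φ(sheet s t)` (`trace`). At points that are not roots of `f` it satisfies
`ΔΦ = ρ ∑ (Δ_X φ)(sheet s t)` (`laplacian_trace`), where `Δ_X` is the Laplace-Beltrami operator.
So `∫_X u_P Δ_X φ dν` is the integral of the potential `log |t - a| - log d` against `ΔΦ`. The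
function `Φ` is bounded and continuous on the sphere but in general not differentiable at the roots of
`f`, where `ΔΦ` may blow up like `|t - b|⁻¹`: `Δ_X φ` is bounded, since charts differ from `x` at most by
the conformal factor (`exists_bound_laplaceBeltrami`), and `ρ` has simple poles at the roots and
decays at infinity (`exists_density_le`). Boundedness, smoothness off the roots and the estimate of
`ΔΦ` are collected in `IsTame`.

For tame `Φ` Green's formula `∫ V ΔΦ = ∫ (ΔV) Φ` holds for every `V` that is smooth on the sphere,
without contributions from the roots: with the cut-offs `η(L⁻¹ ∑ log |t - b|)`, functions of a
harmonic function, the error terms are of order `L⁻¹` (`integral_smul_laplacian_comm_of_bounded`).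
The logarithmic pole is then obtained as the limit `c → 0` of `½ log(|t - a|² + c²)`, whose Laplacian
is an approximate identity of mass `2π`, and the pole at infinity as the limit `c → ∞`
(`tendsto_integral_laplacian_half_log`). This gives
`IsTame.integral_log_sub_log_den` and `IsTame.integral_neg_log_den`, with point masses at `Φ(a)`,
respectively `Φ(∞)`, equal to `φ(P) + φ(ι P)`.

As `u_P Δ_X φ` is integrable on all of `X` and single points have area zero, removing discs in
arbitrary coordinates and letting them shrink recovers the full integral by dominated convergence.
Continuity in `φ` holds because the right-hand side is bounded by the supremum norm of `φ`.
-/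

noncomputable section

/-! ### The Laplacian of the plane -/

section Laplacian

variable {F : Type*} [NormedAddCommGroup F] [NormedSpace ℝ F]

theorem laplacian_eq_fderiv_fderiv (f : ℂ → F) (z : ℂ) :
    Laplacian.laplacian f z = fderiv ℝ (fderiv ℝ f) z 1 1 +
      fderiv ℝ (fderiv ℝ f) z Complex.I Complex.I := by
  rw [InnerProductSpace.laplacian_eq_iteratedFDeriv_complexPlane]
  simp [iteratedFDeriv_two_apply]

theorem ContDiffAt.differentiableAt_fderiv_two {f : ℂ → F} {z : ℂ} (hf : ContDiffAt ℝ 2 f z) :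
    DifferentiableAt ℝ (fderiv ℝ f) z :=
  (hf.fderiv_right (m := 1) (by norm_num)).differentiableAt (by norm_num)

theorem ContDiffAt.eventually_differentiableAt_two {f : ℂ → F} {z : ℂ}
    (hf : ContDiffAt ℝ 2 f z) : ∀ᶠ w in 𝓝 z, DifferentiableAt ℝ f w :=
  (hf.eventually (by simp)).mono fun _ h => h.differentiableAt (by norm_num)

theorem ContDiffAt.continuousAt_laplacian {f : ℂ → F} {z : ℂ} (hf : ContDiffAt ℝ 2 f z) :
    ContinuousAt (Laplacian.laplacian f) z := by
  have h : ContinuousAt (fderiv ℝ (fderiv ℝ f)) z :=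
    ((hf.fderiv_right (m := 1) (by norm_num)).fderiv_right (m := 0) (by norm_num)).continuousAt
  have he : (Laplacian.laplacian f) = fun z => fderiv ℝ (fderiv ℝ f) z 1 1 +
      fderiv ℝ (fderiv ℝ f) z Complex.I Complex.I := funext (laplacian_eq_fderiv_fderiv f)
  rw [he]
  exact ((h.clm_apply continuousAt_const).clm_apply continuousAt_const).add
    ((h.clm_apply continuousAt_const).clm_apply continuousAt_const)

theorem laplacian_congr {f h : ℂ → F} {z : ℂ} (e : f =ᶠ[𝓝 z] h) :
    Laplacian.laplacian f z = Laplacian.laplacian h z :=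
  (InnerProductSpace.laplacian_congr_nhds e).self_of_nhds

/-- The Leibniz rule for the Laplacian of a product of two real functions. -/
theorem laplacian_mul {f h : ℂ → ℝ} {z : ℂ} (hf : ContDiffAt ℝ 2 f z) (hh : ContDiffAt ℝ 2 h z) :
    Laplacian.laplacian (fun w => f w * h w) z =
      f z * Laplacian.laplacian h z + h z * Laplacian.laplacian f z +
      2 * (fderiv ℝ f z 1 * fderiv ℝ h z 1 +
        fderiv ℝ f z Complex.I * fderiv ℝ h z Complex.I) := by
  have e : fderiv ℝ (fun w => f w * h w) =ᶠ[𝓝 z]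
      fun w => f w • fderiv ℝ h w + h w • fderiv ℝ f w := by
    filter_upwards [hf.eventually_differentiableAt_two, hh.eventually_differentiableAt_two]
      with w h1 h2 using fderiv_fun_mul h1 h2
  have d1 := (hf.differentiableAt (by norm_num)).hasFDerivAt
  have d2 := (hh.differentiableAt (by norm_num)).hasFDerivAt
  have d3 := hf.differentiableAt_fderiv_two.hasFDerivAt
  have d4 := hh.differentiableAt_fderiv_two.hasFDerivAt
  have := ((d1.fun_smul d4).add (d2.fun_smul d3)).fderiv
  rw [laplacian_eq_fderiv_fderiv, laplacian_eq_fderiv_fderiv, laplacian_eq_fderiv_fderiv,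
    e.fderiv_eq]
  erw [this]
  simp
  ring

/-- The chain rule for the Laplacian of `η ∘ k` with `η` a function of one real variable. -/
theorem laplacian_comp_real {η η' η'' : ℝ → ℝ} {k : ℂ → ℝ} {z : ℂ} (hk : ContDiffAt ℝ 2 k z)
    (h1 : ∀ᶠ s in 𝓝 (k z), HasDerivAt η (η' s) s) (h2 : HasDerivAt η' (η'' (k z)) (k z)) :
    Laplacian.laplacian (fun w => η (k w)) z =
      η'' (k z) * (fderiv ℝ k z 1 ^ 2 + fderiv ℝ k z Complex.I ^ 2) +
        η' (k z) * Laplacian.laplacian k z := by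
  have e : fderiv ℝ (fun w => η (k w)) =ᶠ[𝓝 z] fun w => η' (k w) • fderiv ℝ k w := by
    filter_upwards [hk.eventually_differentiableAt_two, hk.continuousAt.eventually h1] with w a b
    exact (b.comp_hasFDerivAt w a.hasFDerivAt).fderiv
  have d1 := (hk.differentiableAt (by norm_num)).hasFDerivAt
  have := ((h2.comp_hasFDerivAt z d1).fun_smul hk.differentiableAt_fderiv_two.hasFDerivAt).fderiv
  rw [laplacian_eq_fderiv_fderiv, laplacian_eq_fderiv_fderiv, e.fderiv_eq]
  erw [this]
  simp
  ring

/-- The Laplacian is conformally covariant in dimension two. -/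
theorem laplacian_comp_holomorphic {f : ℂ → F} {τ : ℂ → ℂ} {z : ℂ} (hτ : AnalyticAt ℂ τ z)
    (hf : ContDiffAt ℝ 2 f (τ z)) :
    Laplacian.laplacian (fun w => f (τ w)) z =
      ‖deriv τ z‖ ^ 2 • Laplacian.laplacian f (τ z) := by
  have hd : ∀ᶠ w in 𝓝 z, HasFDerivAt τ
      (((1 : ℂ →L[ℂ] ℂ).smulRight (deriv τ w)).restrictScalars ℝ) w := by
    filter_upwards [hτ.eventually_analyticAt] with w hw
    exact hw.differentiableAt.hasDerivAt.hasFDerivAt.restrictScalars ℝ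
  have e : fderiv ℝ (fun w => f (τ w)) =ᶠ[𝓝 z] fun w => (fderiv ℝ f (τ w)).comp
      (((1 : ℂ →L[ℂ] ℂ).smulRight (deriv τ w)).restrictScalars ℝ) := by
    filter_upwards [hd, hτ.continuousAt.eventually hf.eventually_differentiableAt_two] with w a b
    exact (b.hasFDerivAt.comp w a).fderiv
  have d1 := hf.differentiableAt_fderiv_two.hasFDerivAt.comp z hd.self_of_nhds
  have d2 : HasFDerivAt (fun w => (((1 : ℂ →L[ℂ] ℂ).smulRight (deriv τ w)).restrictScalars ℝ))
      ((ContinuousLinearMap.restrictScalarsL ℂ ℂ ℂ ℝ ℝ).comp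
        ((((ContinuousLinearMap.smulRightL ℂ ℂ ℂ) (1 : ℂ →L[ℂ] ℂ)).restrictScalars ℝ).comp
        (((1 : ℂ →L[ℂ] ℂ).smulRight (deriv (deriv τ) z)).restrictScalars ℝ))) z :=
    ((ContinuousLinearMap.restrictScalarsL ℂ ℂ ℂ ℝ ℝ).hasFDerivAt.comp z
      ((((ContinuousLinearMap.smulRightL ℂ ℂ ℂ) (1 : ℂ →L[ℂ] ℂ)).restrictScalars ℝ).hasFDerivAt.comp
        z (hτ.deriv.differentiableAt.hasDerivAt.hasFDerivAt.restrictScalars ℝ)))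
  have := (d1.clm_comp d2).fderiv
  rw [laplacian_eq_fderiv_fderiv, laplacian_eq_fderiv_fderiv, e.fderiv_eq]
  erw [this]
  obtain ⟨p, q, hpq⟩ : ∃ p q : ℝ, deriv τ z = p + q * Complex.I :=
    ⟨_, _, (Complex.re_add_im _).symm⟩
  set B := fderiv ℝ (fderiv ℝ f) (τ z)
  set A := fderiv ℝ f (τ z)
  have hn : ‖deriv τ z‖ ^ 2 = p ^ 2 + q ^ 2 := by
    rw [hpq, Complex.sq_norm, Complex.normSq_add_mul_I]
  have h1 : (deriv τ z) = p • (1 : ℂ) + q • Complex.I := by simp [hpq]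
  have h2 : Complex.I * (deriv τ z) = p • Complex.I - q • (1 : ℂ) := by
    simp [hpq]; ring_nf; simp [← sub_eq_add_neg]
  rw [hn]
  simp
  rw [h2, h1]
  simp only [map_add, map_sub, map_smul, add_apply,
    sub_apply, smul_apply]
  have h3 : A (-deriv (deriv τ) z) = - A (deriv (deriv τ) z) := map_neg _ _
  have h4 : Complex.I * (Complex.I * deriv (deriv τ) z) = - deriv (deriv τ) z := by
    rw [← mul_assoc, Complex.I_mul_I]; ring
  rw [h4, h3]
  module

end Laplacian

/-! ### Integration by parts in the plane -/

section IntegrationByParts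

theorem integrable_smul_of_hasCompactSupport {F : Type*} [NormedAddCommGroup F] [NormedSpace ℝ F]
    {ψ : ℂ → ℝ} {G : ℂ → F} (hψ : Continuous ψ) (hc : HasCompactSupport ψ)
    (hG : ∀ z ∈ tsupport ψ, ContinuousAt G z) : Integrable fun z => ψ z • G z := by
  refine Continuous.integrable_of_hasCompactSupport ?_ hc.smul_right
  rw [continuous_iff_continuousAt]
  intro z
  by_cases hz : z ∈ tsupport ψ
  · exact hψ.continuousAt.smul (hG z hz)
  · have : (fun z => ψ z • G z) =ᶠ[𝓝 z] fun _ => 0 := by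
      filter_upwards [notMem_tsupport_iff_eventuallyEq.1 hz] with w hw
      simp [hw]
    exact continuousAt_const.congr this.symm

/-- Integration by parts twice in the direction `v`; `Φ` has to be smooth only on the
support of `ψ`. -/
theorem integral_smul_fderiv_fderiv_comm {F : Type*} [NormedAddCommGroup F] [NormedSpace ℝ F]
    {ψ : ℂ → ℝ} {Φ : ℂ → F} (hψ : ContDiff ℝ 2 ψ)
    (hc : HasCompactSupport ψ) (hΦ : ∀ z ∈ tsupport ψ, ContDiffAt ℝ 2 Φ z) (v : ℂ) :
    Integrable (fun z => ψ z • fderiv ℝ (fderiv ℝ Φ) z v v) ∧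
    Integrable (fun z => fderiv ℝ (fderiv ℝ ψ) z v v • Φ z) ∧
    ∫ z, ψ z • fderiv ℝ (fderiv ℝ Φ) z v v = ∫ z, fderiv ℝ (fderiv ℝ ψ) z v v • Φ z := by
  have s1 : tsupport (fun z => fderiv ℝ ψ z v) ⊆ tsupport ψ := tsupport_fderiv_apply_subset ℝ v
  have s2 : tsupport (fun z => fderiv ℝ (fderiv ℝ ψ) z v v) ⊆ tsupport ψ := by
    have h := (tsupport_fderiv_subset ℝ (f := fderiv ℝ ψ)).trans (tsupport_fderiv_subset ℝ)
    refine (closure_mono ?_).trans h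
    intro z hz h0
    exact hz (by simp [h0])
  have c1 : HasCompactSupport (fun z => fderiv ℝ ψ z v) := hc.of_isClosed_subset
    (isClosed_tsupport _) s1
  have c2 : HasCompactSupport (fun z => fderiv ℝ (fderiv ℝ ψ) z v v) := hc.of_isClosed_subset
    (isClosed_tsupport _) s2
  have hψ1 : ContDiff ℝ 1 (fderiv ℝ ψ) := hψ.fderiv_right (by norm_num)
  have hψ1v : ContDiff ℝ 1 (fun z => fderiv ℝ ψ z v) := hψ1.clm_apply contDiff_const
  have hψ2 : Continuous (fun z => fderiv ℝ (fderiv ℝ ψ) z v v) :=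
    (((hψ1.fderiv_right (m := 0) (by norm_num)).continuous.clm_apply continuous_const).clm_apply
      continuous_const)
  have k1 : ∀ z ∈ tsupport ψ, ContinuousAt (fun z => fderiv ℝ Φ z v) z := fun z hz =>
    ((hΦ z hz).fderiv_right (m := 1) (by norm_num)).continuousAt.clm_apply continuousAt_const
  have k2 : ∀ z ∈ tsupport ψ, ContinuousAt (fun z => fderiv ℝ (fderiv ℝ Φ) z v v) z :=
    fun z hz => ((((hΦ z hz).fderiv_right (m := 1) (by norm_num)).fderiv_right (m := 0)
      (by norm_num)).continuousAt.clm_apply continuousAt_const).clm_apply continuousAt_const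
  have i0 := integrable_smul_of_hasCompactSupport hψ.continuous hc k1
  have i1 := integrable_smul_of_hasCompactSupport hψ.continuous hc k2
  have i2 := integrable_smul_of_hasCompactSupport hψ1v.continuous c1 fun z hz => k1 z (s1 hz)
  have i3 := integrable_smul_of_hasCompactSupport hψ1v.continuous c1 (G := Φ)
    fun z hz => (hΦ z (s1 hz)).continuousAt
  have i4 := integrable_smul_of_hasCompactSupport hψ2 c2 (G := Φ)
    fun z hz => (hΦ z (s2 hz)).continuousAt
  refine ⟨i1, i4, ?_⟩
  have e1 := integral_bilinear_hasLineDerivAt_right_eq_neg_left_of_integrable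
    (B := ContinuousLinearMap.lsmul ℝ ℝ) (μ := volume) (v := v) (f := ψ)
    (f' := fun z => fderiv ℝ ψ z v) (g := fun z => fderiv ℝ Φ z v)
    (g' := fun z => fderiv ℝ (fderiv ℝ Φ) z v v) i2 i1 i0
    (fun z _ => (hψ.differentiable (by norm_num) z).hasFDerivAt.hasLineDerivAt v)
    (fun z hz => by
      have := ((hΦ z hz).differentiableAt_fderiv_two.hasFDerivAt.clm_apply
        (hasFDerivAt_const v z)).hasLineDerivAt v
      simpa using this)
  have e2 := integral_bilinear_hasLineDerivAt_right_eq_neg_left_of_integrable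
    (B := ContinuousLinearMap.lsmul ℝ ℝ) (μ := volume) (v := v)
    (f := fun z => fderiv ℝ ψ z v) (f' := fun z => fderiv ℝ (fderiv ℝ ψ) z v v) (g := Φ)
    (g' := fun z => fderiv ℝ Φ z v) i4 i2 i3
    (fun z _ => by
      have := ((hψ1.differentiable (by norm_num) z).hasFDerivAt.clm_apply
        (hasFDerivAt_const v z)).hasLineDerivAt v
      simpa using this)
    (fun z hz => ((hΦ z (s1 hz)).differentiableAt (by norm_num)).hasFDerivAt.hasLineDerivAt v)
  simp only [ContinuousLinearMap.lsmul_apply] at e1 e2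
  rw [e1, e2, neg_neg]

/-- Green's second identity in the plane, for a compactly supported factor. -/
theorem integral_smul_laplacian_comm {F : Type*} [NormedAddCommGroup F] [NormedSpace ℝ F]
    {ψ : ℂ → ℝ} {Φ : ℂ → F} (hψ : ContDiff ℝ 2 ψ)
    (hc : HasCompactSupport ψ) (hΦ : ∀ z ∈ tsupport ψ, ContDiffAt ℝ 2 Φ z) :
    ∫ z, ψ z • Laplacian.laplacian Φ z = ∫ z, Laplacian.laplacian ψ z • Φ z := by
  obtain ⟨a1, a2, a3⟩ := integral_smul_fderiv_fderiv_comm hψ hc hΦ 1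
  obtain ⟨b1, b2, b3⟩ := integral_smul_fderiv_fderiv_comm hψ hc hΦ Complex.I
  simp only [laplacian_eq_fderiv_fderiv, smul_add, add_smul]
  rw [integral_add a1 b1, integral_add a2 b2, a3, b3]

end IntegrationByParts

/-! ### Logarithmic potentials -/

section LogPotential

theorem laplacian_norm_sub_sq (a z : ℂ) (b : ℝ) :
    Laplacian.laplacian (fun w : ℂ => ‖w - a‖ ^ 2 + b) z = 4 := by
  have h1 : fderiv ℝ (fun w : ℂ => ‖w - a‖ ^ 2 + b) = fun w => (2 : ℝ) • innerSL ℝ (w - a) := by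
    ext1 w
    have := (((hasFDerivAt_id (𝕜 := ℝ) w).sub_const a).norm_sq.add_const b).fderiv
    rw [show (fun w : ℂ => ‖w - a‖ ^ 2 + b) = fun w => ‖id w - a‖ ^ 2 + b from rfl, this]
    ext v
    simp
  have h2 : HasFDerivAt (fun w => (2 : ℝ) • innerSL ℝ (w - a))
      ((2 : ℝ) • (innerSL ℝ : ℂ →L[ℝ] ℂ →L[ℝ] ℝ)) z :=
    (((innerSL ℝ : ℂ →L[ℝ] ℂ →L[ℝ] ℝ).hasFDerivAt.comp z
      ((hasFDerivAt_id (𝕜 := ℝ) z).sub_const a)).const_smul (2 : ℝ))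
  rw [laplacian_eq_fderiv_fderiv, h1, h2.fderiv]
  change 2 * inner ℝ (1 : ℂ) 1 + 2 * inner ℝ Complex.I Complex.I = 4
  rw [real_inner_self_eq_norm_sq, real_inner_self_eq_norm_sq]
  norm_num

theorem fderiv_norm_sub_sq_apply (a z v : ℂ) (b : ℝ) :
    fderiv ℝ (fun w : ℂ => ‖w - a‖ ^ 2 + b) z v = 2 * ((z - a) * (starRingEnd ℂ) v).re := by
  have := (((hasFDerivAt_id (𝕜 := ℝ) z).sub_const a).norm_sq.add_const b).fderiv
  rw [show (fun w : ℂ => ‖w - a‖ ^ 2 + b) = fun w => ‖id w - a‖ ^ 2 + b from rfl, this]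
  simp
  ring

theorem contDiff_norm_sub_sq (a : ℂ) (b : ℝ) {n : WithTop ℕ∞} :
    ContDiff ℝ n (fun w : ℂ => ‖w - a‖ ^ 2 + b) :=
  ((contDiff_id.sub contDiff_const).norm_sq ℝ).add contDiff_const

/-- The regularised logarithm `½ log(|z - a|² + b)` has Laplacian `2b / (|z - a|² + b)²`. -/
theorem laplacian_half_log (a z : ℂ) {b : ℝ} (hb : 0 < b) :
    Laplacian.laplacian (fun w : ℂ => 1 / 2 * Real.log (‖w - a‖ ^ 2 + b)) z =
      2 * b / (‖z - a‖ ^ 2 + b) ^ 2 := by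
  have hk : 0 < ‖z - a‖ ^ 2 + b := by positivity
  rw [laplacian_comp_real (η := fun s => 1 / 2 * Real.log s) (η' := fun s => 1 / 2 * s⁻¹)
    (η'' := fun s => 1 / 2 * (-(s ^ 2)⁻¹)) (k := fun w : ℂ => ‖w - a‖ ^ 2 + b)
    (contDiff_norm_sub_sq a b).contDiffAt
    ((lt_mem_nhds hk).mono fun s hs => (Real.hasDerivAt_log hs.ne').const_mul _)
    ((hasDerivAt_inv hk.ne').const_mul _), laplacian_norm_sub_sq, fderiv_norm_sub_sq_apply,
    fderiv_norm_sub_sq_apply]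
  have hn : ‖z - a‖ ^ 2 = (z - a).re ^ 2 + (z - a).im ^ 2 := by
    rw [Complex.sq_norm, Complex.normSq_apply]; ring
  rw [hn] at hk ⊢
  simp only [map_one, mul_one, Complex.conj_I, mul_neg, Complex.neg_re, Complex.mul_I_re, neg_neg]
  field_simp
  ring

theorem contDiff_half_log (a : ℂ) {b : ℝ} (hb : 0 < b) {n : WithTop ℕ∞} :
    ContDiff ℝ n (fun w : ℂ => 1 / 2 * Real.log (‖w - a‖ ^ 2 + b)) :=
  contDiff_const.mul ((contDiff_norm_sub_sq a b).log fun z => by positivity)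

theorem abs_fderiv_log_norm_le {f : ℂ → ℂ} {f' z : ℂ} (hf : HasDerivAt f f' z) (h0 : f z ≠ 0)
    (v : ℂ) : |fderiv ℝ (fun w => Real.log ‖f w‖) z v| ≤ ‖f' / f z‖ * ‖v‖ := by
  have e : (fun w => Real.log ‖f w‖) = fun w => 1 / 2 * Real.log (‖f w‖ ^ 2) := by
    ext w; rw [Real.log_pow]; push_cast; ring
  have h1 := (hf.hasFDerivAt.restrictScalars ℝ).norm_sq
  have h2 := (h1.log (by simpa using h0)).const_mul (1 / 2)
  rw [e, h2.fderiv]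
  have hp : 0 < ‖f z‖ := norm_pos_iff.2 h0
  rw [two_smul]
  change |1 / 2 * ((‖f z‖ ^ 2)⁻¹ * (inner ℝ (f z) (v * f') + inner ℝ (f z) (v * f')))| ≤ _
  rw [← two_mul]
  have h3 := abs_real_inner_le_norm (f z) (v * f')
  rw [norm_mul] at h3
  rw [abs_mul, abs_mul, abs_mul, abs_inv, abs_pow, abs_norm, abs_two, norm_div,
    div_mul_eq_mul_div, le_div_iff₀ hp, abs_of_pos (by norm_num : (0 : ℝ) < 1 / 2)]
  calc _ = |inner ℝ (f z) (v * f')| / ‖f z‖ := by field_simp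
    _ ≤ _ := by rw [div_le_iff₀ hp]; linarith

end LogPotential

/-! ### Integrable weights in the plane -/

section Weights

theorem integrableOn_ball_norm_sub_rpow (c : ℂ) {p : ℝ} (hp : p < 2) :
    IntegrableOn (fun t : ℂ => ‖t - c‖ ^ (-p)) (Metric.ball c 1) := by
  have h0 : IntegrableOn (fun t : ℂ => ‖t‖ ^ (-p)) (Metric.ball 0 1) := by
    rw [integrableOn_fun_norm_addHaar volume (f := fun y => y ^ (-p)), Complex.finrank_real_complex]
    have := (intervalIntegral.integrableOn_Ioo_rpow_iff (s := 1 - p) (t := 1) one_pos).2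
      (by linarith)
    refine this.congr_fun (fun y hy => ?_) measurableSet_Ioo
    simp only [Nat.add_one_sub_one, pow_one, smul_eq_mul]
    rw [sub_eq_add_neg, Real.rpow_add hy.1, Real.rpow_one]
  rw [← integrable_indicator_iff measurableSet_ball] at h0 ⊢
  refine (h0.comp_sub_right c).congr (.of_forall fun t => ?_)
  simp only [Set.indicator, Metric.mem_ball, dist_eq_norm, sub_zero]

theorem integrable_norm_sub_rpow_mul (c : ℂ) {p q : ℝ} (hp0 : 0 ≤ p) (hp : p < 2) (hq : 0 ≤ q)
    (hpq : 2 < p + q) : Integrable fun t : ℂ => ‖t - c‖ ^ (-p) * (1 + ‖t‖) ^ (-q) := by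
  have h1 := (integrable_indicator_iff measurableSet_ball).2 (integrableOn_ball_norm_sub_rpow c hp)
  have h2 : Integrable fun t : ℂ => (2 + ‖c‖) ^ p * (1 + ‖t‖) ^ (-(p + q)) :=
    (integrable_one_add_norm (by rw [Complex.finrank_real_complex]; exact_mod_cast hpq)).const_mul _
  refine (h1.add h2).mono' (by fun_prop) (.of_forall fun t => ?_)
  have ht : 0 ≤ ‖t‖ := norm_nonneg t
  have h3 : 0 ≤ (2 + ‖c‖) ^ p * (1 + ‖t‖) ^ (-(p + q)) := by positivity
  rw [Real.norm_of_nonneg (by positivity)]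
  by_cases h : t ∈ Metric.ball c 1
  · simp only [Pi.add_apply, Set.indicator_of_mem h]
    have h4 : (1 + ‖t‖) ^ (-q) ≤ 1 :=
      Real.rpow_le_one_of_one_le_of_nonpos (by linarith) (neg_nonpos.2 hq)
    have h5 : 0 ≤ ‖t - c‖ ^ (-p) := by positivity
    nlinarith
  · simp only [Pi.add_apply, Set.indicator_of_notMem h, zero_add]
    have h6 : 1 ≤ ‖t - c‖ := by simpa [dist_eq_norm] using h
    have h7 : 1 + ‖t‖ ≤ (2 + ‖c‖) * ‖t - c‖ := by
      have : ‖t‖ ≤ ‖t - c‖ + ‖c‖ := by simpa using norm_add_le (t - c) c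
      nlinarith [norm_nonneg c]
    have h8 : ‖t - c‖ ^ (-p) ≤ ((1 + ‖t‖) / (2 + ‖c‖)) ^ (-p) :=
      Real.rpow_le_rpow_of_nonpos (by positivity)
        (by rw [div_le_iff₀ (by positivity)]; linarith) (by linarith)
    rw [Real.div_rpow (by positivity) (by positivity), Real.rpow_neg (by positivity : 0 ≤ 2 + ‖c‖),
      div_inv_eq_mul] at h8
    rw [neg_add, Real.rpow_add (by positivity)]
    have h9 : 0 ≤ (1 + ‖t‖) ^ (-q) := by positivity
    nlinarith

/-- The weight `∑ |t - b|⁻¹ (1 + |t|)⁻²` that dominates the area density of the double cover of the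
plane branched over `S`. -/
def poleWeight (S : Finset ℂ) (t : ℂ) : ℝ := ∑ b ∈ S, ‖t - b‖⁻¹ * ((1 + ‖t‖) ^ 2)⁻¹

theorem poleWeight_nonneg (S : Finset ℂ) (t : ℂ) : 0 ≤ poleWeight S t :=
  Finset.sum_nonneg fun b _ => by positivity

theorem measurable_poleWeight (S : Finset ℂ) : Measurable (poleWeight S) := by
  unfold poleWeight; fun_prop

/-- A bound for the logarithms that occur as potentials. -/
def logWeight (a t : ℂ) : ℝ := 1 + |Real.log ‖t - a‖| + Real.log (1 + ‖t‖ ^ 2)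

theorem measurable_logWeight (a : ℂ) : Measurable (logWeight a) := by
  unfold logWeight; fun_prop

theorem log_one_add_sq_nonneg (t : ℂ) : 0 ≤ Real.log (1 + ‖t‖ ^ 2) :=
  Real.log_nonneg (by nlinarith [norm_nonneg t])

theorem one_le_logWeight (a t : ℂ) : 1 ≤ logWeight a t := by
  have := log_one_add_sq_nonneg t
  unfold logWeight; linarith [abs_nonneg (Real.log ‖t - a‖)]

theorem abs_log_le_rpow {r : ℝ} (hr : 0 ≤ r) :
    |Real.log r| ≤ 2 * r ^ (1 / 2 : ℝ) + 2 * r ^ (-(1 / 2) : ℝ) := by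
  have h1 := Real.log_le_rpow_div hr (ε := 1 / 2) (by norm_num)
  have h2 := Real.log_le_rpow_div (inv_nonneg.2 hr) (ε := 1 / 2) (by norm_num)
  rw [Real.log_inv, Real.inv_rpow hr, ← Real.rpow_neg hr] at h2
  have h3 : 0 ≤ r ^ (1 / 2 : ℝ) := by positivity
  have h4 : 0 ≤ r ^ (-(1 / 2) : ℝ) := by positivity
  rw [abs_le]; constructor <;> linarith

/-- Logarithms are dominated by square roots, which `poleWeight` can absorb. -/
theorem logWeight_le (a t : ℂ) : logWeight a t ≤
    (5 + 2 * (1 + ‖a‖)) * (1 + ‖t‖) ^ (1 / 2 : ℝ) + 2 * ‖t - a‖ ^ (-(1 / 2) : ℝ) := by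
  have h1 := abs_log_le_rpow (norm_nonneg (t - a))
  have ht := norm_nonneg t
  have ha := norm_nonneg a
  have h2 : ‖t - a‖ ^ (1 / 2 : ℝ) ≤ (1 + ‖a‖) * (1 + ‖t‖) ^ (1 / 2 : ℝ) := by
    have h3 : ‖t - a‖ ≤ (1 + ‖a‖) * (1 + ‖t‖) := by
      have := norm_sub_le t a
      nlinarith
    refine (Real.rpow_le_rpow (norm_nonneg _) h3 (by norm_num)).trans ?_
    rw [Real.mul_rpow (by positivity) (by positivity)]
    gcongr
    exact Real.rpow_le_self_of_one_le (by linarith) (by norm_num)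
  have h4 : Real.log (1 + ‖t‖ ^ 2) ≤ 4 * (1 + ‖t‖) ^ (1 / 2 : ℝ) := by
    have h5 : Real.log (1 + ‖t‖ ^ 2) ≤ Real.log ((1 + ‖t‖) ^ 2) :=
      Real.log_le_log (by positivity) (by nlinarith)
    rw [Real.log_pow] at h5
    have h6 := Real.log_le_rpow_div (x := 1 + ‖t‖) (by positivity) (ε := 1 / 2) (by norm_num)
    push_cast at h5
    linarith
  have h7 : 1 ≤ (1 + ‖t‖) ^ (1 / 2 : ℝ) := Real.one_le_rpow (by linarith) (by norm_num)
  unfold logWeight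
  linarith

theorem integrable_poleWeight_mul_logWeight (S : Finset ℂ) (a : ℂ) :
    Integrable fun t => poleWeight S t * logWeight a t := by
  simp only [poleWeight, Finset.sum_mul]
  refine integrable_finsetSum _ fun b _ => ?_
  have i1 := (integrable_norm_sub_rpow_mul b (p := 1) (q := 3 / 2) (by norm_num) (by norm_num)
    (by norm_num) (by norm_num)).const_mul (5 + 2 * (1 + ‖a‖))
  have i2 := (integrable_norm_sub_rpow_mul b (p := 3 / 2) (q := 2) (by norm_num) (by norm_num)
    (by norm_num) (by norm_num)).const_mul 2
  have i3 := (integrable_norm_sub_rpow_mul a (p := 3 / 2) (q := 2) (by norm_num) (by norm_num)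
    (by norm_num) (by norm_num)).const_mul 2
  refine ((i1.add i2).add i3).mono' ?_ (.of_forall fun t => ?_)
  · exact ((by fun_prop : Measurable fun t : ℂ => ‖t - b‖⁻¹ * ((1 + ‖t‖) ^ 2)⁻¹).mul
      (measurable_logWeight a)).aestronglyMeasurable
  have hl := logWeight_le a t
  have ht : 0 < 1 + ‖t‖ := by positivity
  rw [Real.norm_of_nonneg (mul_nonneg (by positivity) (zero_le_one.trans (one_le_logWeight a t)))]
  have e1 : ‖t - b‖ ^ (-1 : ℝ) = ‖t - b‖⁻¹ := Real.rpow_neg_one _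
  have e2 : (1 + ‖t‖) ^ (-2 : ℝ) = ((1 + ‖t‖) ^ 2)⁻¹ := by
    rw [Real.rpow_neg ht.le]; norm_cast
  have e3 : (1 + ‖t‖) ^ (-(3 / 2) : ℝ) = ((1 + ‖t‖) ^ 2)⁻¹ * (1 + ‖t‖) ^ (1 / 2 : ℝ) := by
    rw [← e2, ← Real.rpow_add ht]; norm_num
  have e4 : ∀ c : ℂ, ‖t - c‖ ^ (-(3 / 2) : ℝ) = (‖t - c‖ ^ (-(1 / 2) : ℝ)) ^ 3 := by
    intro c; rw [← Real.rpow_natCast, ← Real.rpow_mul (norm_nonneg _)]; norm_num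
  have e5 : ‖t - b‖⁻¹ = (‖t - b‖ ^ (-(1 / 2) : ℝ)) ^ 2 := by
    rw [← Real.rpow_natCast, ← Real.rpow_mul (norm_nonneg _), ← e1]; norm_num
  simp only [Pi.add_apply]
  rw [e1, e3, e2, e4, e4]
  set x := ‖t - b‖ ^ (-(1 / 2) : ℝ)
  set y := ‖t - a‖ ^ (-(1 / 2) : ℝ)
  have hx : 0 ≤ x := by positivity
  have hy : 0 ≤ y := by positivity
  -- Young's inequality separates the poles at `a` and `b`.
  have hxy : x ^ 2 * y ≤ x ^ 3 + y ^ 3 := by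
    rcases le_total x y with h | h
    · nlinarith [pow_le_pow_left₀ hx h 2, pow_nonneg hx 3]
    · nlinarith [pow_nonneg hy 3, pow_nonneg hx 2]
  rw [e5]
  set m := ((1 + ‖t‖) ^ 2)⁻¹
  have hm : 0 ≤ m := by positivity
  calc x ^ 2 * m * logWeight a t ≤ x ^ 2 * m *
        ((5 + 2 * (1 + ‖a‖)) * (1 + ‖t‖) ^ (1 / 2 : ℝ) + 2 * y) := by gcongr
    _ = (5 + 2 * (1 + ‖a‖)) * (x ^ 2 * (m * (1 + ‖t‖) ^ (1 / 2 : ℝ))) + 2 * m * (x ^ 2 * y) := by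
        ring
    _ ≤ (5 + 2 * (1 + ‖a‖)) * (x ^ 2 * (m * (1 + ‖t‖) ^ (1 / 2 : ℝ))) +
        2 * m * (x ^ 3 + y ^ 3) := by gcongr
    _ = _ := by ring

theorem integrable_poleWeight (S : Finset ℂ) : Integrable (poleWeight S) := by
  refine (integrable_poleWeight_mul_logWeight S 0).mono'
    (measurable_poleWeight S).aestronglyMeasurable (.of_forall fun t => ?_)
  rw [Real.norm_of_nonneg (poleWeight_nonneg S t)]
  nlinarith [poleWeight_nonneg S t, one_le_logWeight 0 t]

/-- `∫ |t|⁻² dt = 4πR` over the annulus `|log |t|| ≤ R`. -/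
theorem integral_annulus_inv_sq {R : ℝ} (hR : 0 ≤ R) (c : ℂ) :
    Integrable (fun t : ℂ => (Set.Ioc (Real.exp (-R)) (Real.exp R)).indicator
      (fun r => (r ^ 2)⁻¹) ‖t - c‖) ∧
    ∫ t : ℂ, (Set.Ioc (Real.exp (-R)) (Real.exp R)).indicator (fun r => (r ^ 2)⁻¹) ‖t - c‖ =
      4 * Real.pi * R := by
  set I := Set.Ioc (Real.exp (-R)) (Real.exp R)
  have hsub : I ⊆ Set.Ioi 0 := fun r hr => (Real.exp_pos _).trans hr.1
  have e : ∀ y ∈ Set.Ioi (0 : ℝ), y ^ (Module.finrank ℝ ℂ - 1) • I.indicator (fun r => (r ^ 2)⁻¹) y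
      = I.indicator (fun r => r⁻¹) y := by
    intro y hy
    rw [Complex.finrank_real_complex]
    by_cases h : y ∈ I
    · have : y ≠ 0 := (ne_of_gt hy)
      simp only [Set.indicator_of_mem h, Nat.add_one_sub_one, pow_one, smul_eq_mul]
      field_simp
    · simp [Set.indicator_of_notMem h]
  have hle : Real.exp (-R) ≤ Real.exp R := Real.exp_le_exp.2 (by linarith)
  have hint : IntegrableOn (fun r : ℝ => r⁻¹) I := by
    rw [← intervalIntegrable_iff_integrableOn_Ioc_of_le hle]
    refine intervalIntegral.intervalIntegrable_inv (fun x hx => ?_) continuousOn_id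
    rw [Set.uIcc_of_le hle] at hx
    exact ((Real.exp_pos _).trans_le hx.1).ne'
  have h0 : Integrable (fun t : ℂ => I.indicator (fun r => (r ^ 2)⁻¹) ‖t‖) := by
    rw [integrable_fun_norm_addHaar, integrableOn_congr_fun e measurableSet_Ioi]
    exact ((integrable_indicator_iff measurableSet_Ioc).2 hint).integrableOn
  refine ⟨h0.comp_sub_right c, ?_⟩
  rw [integral_sub_right_eq_self (fun t : ℂ => I.indicator (fun r => (r ^ 2)⁻¹) ‖t‖),
    integral_fun_norm_addHaar, setIntegral_congr_fun measurableSet_Ioi e,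
    setIntegral_indicator measurableSet_Ioc, Set.inter_eq_right.2 hsub,
    ← intervalIntegral.integral_of_le hle, integral_inv_of_pos (Real.exp_pos _) (Real.exp_pos _),
    ← Real.exp_sub, Real.log_exp, Complex.finrank_real_complex]
  simp [Measure.real, Complex.volume_ball]
  ring

/-- The Fubini–Study form `2 (1 + |t|²)⁻² dt` has total mass `2π`. -/
theorem integral_fubiniStudy :
    Integrable (fun t : ℂ => 2 / (‖t‖ ^ 2 + 1) ^ 2) ∧
    ∫ t : ℂ, 2 / (‖t‖ ^ 2 + 1) ^ 2 = 2 * Real.pi := by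
  have hd : ∀ x ∈ Set.Ici (0 : ℝ), HasDerivAt (fun y : ℝ => -(y ^ 2 + 1)⁻¹)
      (x ^ (Module.finrank ℝ ℂ - 1) • (2 / (x ^ 2 + 1) ^ 2)) x := by
    intro x _
    have h := (((hasDerivAt_id x).pow 2).add_const 1).inv (by simp; positivity)
    convert! h.neg using 1
    rw [Complex.finrank_real_complex]
    simp
    ring
  have hl : Filter.Tendsto (fun y : ℝ => -(y ^ 2 + 1)⁻¹) Filter.atTop (𝓝 (-0)) :=
    (tendsto_inv_atTop_zero.comp (Filter.tendsto_atTop_add_const_right _ 1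
      (Filter.tendsto_pow_atTop two_ne_zero))).neg
  have hi : IntegrableOn (fun x : ℝ => x ^ (Module.finrank ℝ ℂ - 1) • (2 / (x ^ 2 + 1) ^ 2))
      (Set.Ioi 0) :=
    integrableOn_Ioi_deriv_of_nonneg' hd (fun x hx => by
      have : 0 < x := hx
      rw [smul_eq_mul]; positivity) hl
  refine ⟨(integrable_fun_norm_addHaar (f := fun r : ℝ => 2 / (r ^ 2 + 1) ^ 2) volume).2 hi, ?_⟩
  rw [integral_fun_norm_addHaar volume (f := fun r : ℝ => 2 / (r ^ 2 + 1) ^ 2),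
    integral_Ioi_of_hasDerivAt_of_tendsto' hd hi hl, Complex.finrank_real_complex]
  simp [Measure.real, Complex.volume_ball]

end Weights

/-! ### Logarithmic cut-offs -/

section Cutoff

/-- A smooth bump function on the line, equal to `1` on `[-1, 1]` and supported in `[-2, 2]`. -/
def lineBump : ContDiffBump (0 : ℝ) := ⟨1, 2, one_pos, one_lt_two⟩

theorem contDiff_lineBump {n : ℕ∞} : ContDiff ℝ n (lineBump : ℝ → ℝ) := lineBump.contDiff

theorem hasDerivAt_lineBump (s : ℝ) : HasDerivAt lineBump (deriv lineBump s) s :=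
  ((contDiff_lineBump (n := 1)).differentiable (by norm_num) s).hasDerivAt

theorem hasDerivAt_deriv_lineBump (s : ℝ) :
    HasDerivAt (deriv lineBump) (deriv (deriv lineBump) s) s := by
  have h : ContDiff ℝ 1 (deriv lineBump) := by
    have := (contDiff_lineBump (n := 2))
    exact (contDiff_succ_iff_deriv (n := 1).1 (by exact_mod_cast this)).2.2
  exact (h.differentiable (by norm_num) s).hasDerivAt

theorem exists_bound_deriv_lineBump :
    ∃ B : ℝ, 0 ≤ B ∧ ∀ s, |deriv lineBump s| ≤ B ∧ |deriv (deriv lineBump) s| ≤ B := by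
  have hc : HasCompactSupport (lineBump : ℝ → ℝ) := lineBump.hasCompactSupport
  have h2 : ContDiff ℝ 2 (lineBump : ℝ → ℝ) := contDiff_lineBump (n := 2)
  have h1 : ContDiff ℝ 1 (deriv lineBump) :=
    (contDiff_succ_iff_deriv (n := 1).1 (by exact_mod_cast h2)).2.2
  obtain ⟨B1, hB1⟩ := hc.deriv.exists_bound_of_continuous h1.continuous
  obtain ⟨B2, hB2⟩ := hc.deriv.deriv.exists_bound_of_continuous (h1.continuous_deriv le_rfl)
  exact ⟨max B1 B2, (norm_nonneg _).trans ((hB1 0).trans (le_max_left _ _)),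
    fun s => ⟨(hB1 s).trans (le_max_left _ _), (hB2 s).trans (le_max_right _ _)⟩⟩

theorem deriv_deriv_lineBump_eq_zero {s : ℝ} (hs : 2 < |s|) : deriv (deriv lineBump) s = 0 := by
  have h : ∀ᶠ r in 𝓝 s, lineBump r = 0 := by
    filter_upwards [continuous_abs.continuousAt.eventually (lt_mem_nhds hs)] with r hr
    exact lineBump.zero_of_le_dist (by simpa [lineBump] using hr.le)
  have h' : deriv lineBump =ᶠ[𝓝 s] fun _ => 0 := by
    have := Filter.EventuallyEq.deriv (f₁ := lineBump) (f := fun _ => (0 : ℝ)) h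
    simpa using this
  rw [h'.deriv_eq]; simp

variable (S : Finset ℂ)

/-- `∑ log |t - b|`: harmonic off `S`, with a logarithmic pole at every point of `S` and at
infinity. -/
def sumLog (t : ℂ) : ℝ := ∑ b ∈ S, Real.log ‖t - b‖

theorem harmonicAt_log_norm_sub {b t : ℂ} (h : t ≠ b) :
    InnerProductSpace.HarmonicAt (fun w : ℂ => Real.log ‖w - b‖) t :=
  AnalyticAt.harmonicAt_log_norm (f := fun w => w - b) (by fun_prop) (sub_ne_zero.2 h)

theorem harmonicAt_sumLog {t : ℂ} (ht : t ∉ S) :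
    InnerProductSpace.HarmonicAt (sumLog S) t := by
  classical
  unfold sumLog
  induction S using Finset.induction_on with
  | empty => simp
  | insert b T hb ih =>
    rw [Finset.mem_insert, not_or] at ht
    have := (harmonicAt_log_norm_sub ht.1).add (ih ht.2)
    simp only [Finset.sum_insert hb]
    exact this

theorem abs_fderiv_sumLog_le {t : ℂ} (ht : t ∉ S) (v : ℂ) :
    |fderiv ℝ (sumLog S) t v| ≤ (∑ b ∈ S, ‖t - b‖⁻¹) * ‖v‖ := by
  have hne : ∀ b ∈ S, t ≠ b := fun b hb h => ht (h ▸ hb)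
  have h : HasFDerivAt (sumLog S) (∑ b ∈ S, fderiv ℝ (fun w : ℂ => Real.log ‖w - b‖) t) t := by
    refine HasFDerivAt.fun_sum fun b hb => ?_
    exact ((harmonicAt_log_norm_sub (hne b hb)).1.differentiableAt (by norm_num)).hasFDerivAt
  rw [h.fderiv, sum_apply, Finset.sum_mul]
  refine (Finset.abs_sum_le_sum_abs _ _).trans (Finset.sum_le_sum fun b hb => ?_)
  have := abs_fderiv_log_norm_le (f := fun w => w - b) ((hasDerivAt_id t).sub_const b)
    (sub_ne_zero.2 (hne b hb)) v
  simpa using this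

theorem tendsto_sumLog_atBot {b : ℂ} (hb : b ∈ S) :
    Filter.Tendsto (sumLog S) (𝓝[≠] b) Filter.atBot := by
  classical
  have e : sumLog S = fun t => Real.log ‖t - b‖ + sumLog (S.erase b) t := by
    ext t; exact (Finset.add_sum_erase S (fun c => Real.log ‖t - c‖) hb).symm
  rw [e]
  have h1 : Filter.Tendsto (fun t : ℂ => Real.log ‖t - b‖) (𝓝[≠] b) Filter.atBot := by
    refine Real.tendsto_log_nhdsNE_zero.comp ?_
    rw [tendsto_nhdsWithin_iff]
    constructor
    · have : ContinuousAt (fun t : ℂ => ‖t - b‖) b := by fun_prop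
      simpa [ContinuousAt] using this.tendsto.mono_left nhdsWithin_le_nhds
    · filter_upwards [self_mem_nhdsWithin] with t ht
      simpa [sub_eq_zero] using ht
  have h2 := (harmonicAt_sumLog (S.erase b) (t := b) (by simp)).1.continuousAt
  exact h1.atBot_add (h2.tendsto.mono_left nhdsWithin_le_nhds)

open Classical in
/-- The cut-off `η(∑ log |t - b| / L)`. Since the logarithm is harmonic, the Laplacian of the
cut-off is only of size `L⁻¹` in the mean. -/
def cutoff (L : ℝ) (t : ℂ) : ℝ := if t ∈ S then 0 else lineBump (sumLog S t / L)

variable {S}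

theorem cutoff_eventuallyEq {t : ℂ} (ht : t ∉ S) (L : ℝ) :
    cutoff S L =ᶠ[𝓝 t] fun w => lineBump (L⁻¹ * sumLog S w) := by
  filter_upwards [S.finite_toSet.isClosed.isOpen_compl.mem_nhds ht] with w hw
  have : w ∉ S := hw
  simp [cutoff, this, div_eq_inv_mul]

theorem cutoff_eventually_zero {b : ℂ} (hb : b ∈ S) {L : ℝ} (hL : 0 < L) :
    cutoff S L =ᶠ[𝓝 b] fun _ => 0 := by
  have h := (tendsto_sumLog_atBot S hb).eventually (Filter.eventually_le_atBot (-(2 * L)))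
  rw [eventually_nhdsWithin_iff] at h
  filter_upwards [h] with t ht
  by_cases htS : t ∈ S
  · simp [cutoff, htS]
  · have h1 := ht fun e => htS (by rw [Set.mem_singleton_iff.1 e]; exact hb)
    simp only [cutoff, htS, if_false]
    refine lineBump.zero_of_le_dist ?_
    have : sumLog S t / L ≤ -2 := by rw [div_le_iff₀ hL]; linarith
    rw [Real.dist_eq, sub_zero, abs_of_nonpos (by linarith)]
    change (2 : ℝ) ≤ _
    linarith

theorem contDiff_cutoff {L : ℝ} (hL : 0 < L) : ContDiff ℝ 2 (cutoff S L) := by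
  rw [contDiff_iff_contDiffAt]
  intro t
  by_cases ht : t ∈ S
  · exact contDiffAt_const.congr_of_eventuallyEq (cutoff_eventually_zero ht hL)
  · refine ContDiffAt.congr_of_eventuallyEq ?_ (cutoff_eventuallyEq ht L)
    exact (contDiff_lineBump (n := 2)).contDiffAt.comp t
      (contDiffAt_const.mul (harmonicAt_sumLog S ht).1)

theorem cutoff_mem_Icc (L : ℝ) (t : ℂ) : cutoff S L t ∈ Set.Icc (0 : ℝ) 1 := by
  unfold cutoff
  split_ifs
  · simp
  · exact ⟨lineBump.nonneg, lineBump.le_one⟩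

theorem notMem_tsupport_cutoff {b : ℂ} (hb : b ∈ S) {L : ℝ} (hL : 0 < L) :
    b ∉ tsupport (cutoff S L) :=
  notMem_tsupport_iff_eventuallyEq.2 (cutoff_eventually_zero hb hL)

theorem tendsto_cutoff {t : ℂ} (ht : t ∉ S) :
    Filter.Tendsto (fun L => cutoff S L t) Filter.atTop (𝓝 1) := by
  refine tendsto_const_nhds.congr' ?_
  filter_upwards [Filter.eventually_ge_atTop (|sumLog S t| + 1)] with L hL
  simp only [cutoff, ht, if_false]
  refine (lineBump.one_of_mem_closedBall ?_).symm
  have h0 : 0 < L := by linarith [abs_nonneg (sumLog S t)]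
  rw [Metric.mem_closedBall, Real.dist_eq, sub_zero, abs_div, abs_of_pos h0]
  change _ ≤ (1 : ℝ)
  rw [div_le_one h0]; linarith

/-- Where `∑ log |t - b|` is at most `2L`, every `log |t - b|` is at most `3L`, for large `L`. -/
theorem exists_forall_abs_log_le (S : Finset ℂ) : ∃ L₀ : ℝ, 1 ≤ L₀ ∧ ∀ L, L₀ ≤ L → ∀ t ∉ S,
    |sumLog S t| ≤ 2 * L → ∀ b ∈ S, |Real.log ‖t - b‖| ≤ 3 * L := by
  classical
  obtain ⟨D, hD0, hD⟩ : ∃ D : ℝ, 0 ≤ D ∧ ∀ b ∈ S, ∀ c ∈ S, ‖b - c‖ ≤ D := by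
    refine ⟨∑ b ∈ S, ∑ c ∈ S, ‖b - c‖, by positivity, fun b hb c hc => ?_⟩
    exact (Finset.single_le_sum (f := fun c => ‖b - c‖) (fun _ _ => norm_nonneg _) hc).trans
      (Finset.single_le_sum (f := fun b => ∑ c ∈ S, ‖b - c‖) (fun _ _ => by positivity) hb)
  have hl : 0 ≤ Real.log (1 + D) := Real.log_nonneg (by linarith)
  refine ⟨1 + (S.card + 1) * Real.log (1 + D), by
    have : 0 ≤ ((S.card : ℝ) + 1) * Real.log (1 + D) := by positivity
    linarith, fun L hL t ht h b hb => ?_⟩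
  -- If `log |t - b|` is very negative, the other terms are bounded above; if it is very large, they
  -- are nonnegative. In either case the sum exceeds `2L` in absolute value.
  have hcard : 0 ≤ (S.card : ℝ) * Real.log (1 + D) := by positivity
  have hpos : ∀ c ∈ S, 0 < ‖t - c‖ := fun c hc =>
    norm_pos_iff.2 (sub_ne_zero.2 fun e => ht (e ▸ hc))
  have hsum : sumLog S t = Real.log ‖t - b‖ + ∑ c ∈ S.erase b, Real.log ‖t - c‖ :=
    (Finset.add_sum_erase S (fun c => Real.log ‖t - c‖) hb).symm
  rw [abs_le] at h ⊢
  constructor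
  · by_contra! hlt
    have h1 : ‖t - b‖ ≤ 1 := by
      rw [← Real.exp_log (hpos b hb), Real.exp_le_one_iff]; linarith
    have h2 : ∑ c ∈ S.erase b, Real.log ‖t - c‖ ≤ S.card * Real.log (1 + D) := by
      refine (Finset.sum_le_card_nsmul _ _ (Real.log (1 + D)) fun c hc => ?_).trans ?_
      · refine Real.log_le_log (hpos c (Finset.mem_of_mem_erase hc)) ?_
        have := norm_sub_le_norm_sub_add_norm_sub t b c
        linarith [hD b hb c (Finset.mem_of_mem_erase hc)]
      · rw [nsmul_eq_mul]
        gcongr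
        exact Finset.erase_subset _ _
    linarith
  · by_contra! hlt
    have h1 : 1 + D ≤ ‖t - b‖ := by
      rw [← Real.log_le_log_iff (by linarith) (hpos b hb)]
      linarith
    have h2 : 0 ≤ ∑ c ∈ S.erase b, Real.log ‖t - c‖ := by
      refine Finset.sum_nonneg fun c hc => Real.log_nonneg ?_
      have := norm_sub_le_norm_sub_add_norm_sub t c b
      have h3 := hD c (Finset.mem_of_mem_erase hc) b hb
      linarith
    linarith

theorem hasCompactSupport_cutoff (hS : S.Nonempty) {L L₀ : ℝ} (h1 : 1 ≤ L₀)
    (h : ∀ L, L₀ ≤ L → ∀ t ∉ S, |sumLog S t| ≤ 2 * L → ∀ b ∈ S, |Real.log ‖t - b‖| ≤ 3 * L)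
    (hL : L₀ ≤ L) : HasCompactSupport (cutoff S L) := by
  obtain ⟨b, hb⟩ := hS
  refine HasCompactSupport.intro (isCompact_closedBall b (Real.exp (3 * L))) fun t ht => ?_
  by_contra h0
  have htS : t ∉ S := fun hm => h0 (by simp [cutoff, hm])
  have hle : |sumLog S t| ≤ 2 * L := by
    by_contra! hlt
    refine h0 ?_
    simp only [cutoff, htS, if_false]
    refine lineBump.zero_of_le_dist ?_
    rw [Real.dist_eq, sub_zero, abs_div, abs_of_pos (by linarith : 0 < L)]
    change (2 : ℝ) ≤ _
    rw [le_div_iff₀ (by linarith)]; linarith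
  have h2 := (abs_le.1 (h L hL t htS hle b hb)).2
  have hp : 0 < ‖t - b‖ := norm_pos_iff.2 (sub_ne_zero.2 fun e => htS (e ▸ hb))
  rw [Real.log_le_iff_le_exp hp] at h2
  exact ht (by rwa [Metric.mem_closedBall, dist_eq_norm])

theorem abs_fderiv_cutoff_le {L B : ℝ} (hL : 0 < L) (hB0 : 0 ≤ B)
    (hB : ∀ s, |deriv lineBump s| ≤ B) (t v : ℂ) :
    |fderiv ℝ (cutoff S L) t v| ≤ B / L * (∑ b ∈ S, ‖t - b‖⁻¹) * ‖v‖ := by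
  have hs : 0 ≤ ∑ b ∈ S, ‖t - b‖⁻¹ := Finset.sum_nonneg fun _ _ => by positivity
  by_cases ht : t ∈ S
  · rw [(cutoff_eventually_zero ht hL).fderiv_eq]
    simp
    positivity
  · rw [(cutoff_eventuallyEq ht L).fderiv_eq]
    have h1 := ((harmonicAt_sumLog S ht).1.differentiableAt (by norm_num)).hasFDerivAt.const_mul L⁻¹
    have h2 := (hasDerivAt_lineBump (L⁻¹ * sumLog S t)).comp_hasFDerivAt t h1
    have h3 := h2.fderiv
    simp only [Function.comp_def] at h3
    rw [h3]
    change |deriv lineBump _ * (L⁻¹ * fderiv ℝ (sumLog S) t v)| ≤ _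
    rw [abs_mul, abs_mul, abs_of_pos (inv_pos.2 hL)]
    calc _ ≤ B * (L⁻¹ * ((∑ b ∈ S, ‖t - b‖⁻¹) * ‖v‖)) := by
          gcongr
          · exact hB _
          · exact abs_fderiv_sumLog_le S ht v
      _ = _ := by ring

/-- As `∑ log |t - b|` is harmonic, only the square of its gradient enters the Laplacian. It
lives where `|log |t - b|| ≤ 3L`; the slightly larger annuli `|log |t - b|| ≤ 4L` absorb the boundary. -/
theorem abs_laplacian_cutoff_le {L L₀ B : ℝ} (h1 : 1 ≤ L₀)
    (h : ∀ L, L₀ ≤ L → ∀ t ∉ S, |sumLog S t| ≤ 2 * L → ∀ b ∈ S, |Real.log ‖t - b‖| ≤ 3 * L)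
    (hL : L₀ ≤ L) (hB0 : 0 ≤ B) (hB : ∀ s, |deriv (deriv lineBump) s| ≤ B) (t : ℂ) :
    |Laplacian.laplacian (cutoff S L) t| ≤ 2 * B * S.card / L ^ 2 *
      ∑ b ∈ S, (Set.Ioc (Real.exp (-(4 * L))) (Real.exp (4 * L))).indicator
        (fun r => (r ^ 2)⁻¹) ‖t - b‖ := by
  have hL0 : 0 < L := by linarith
  have hs : 0 ≤ ∑ b ∈ S, (Set.Ioc (Real.exp (-(4 * L))) (Real.exp (4 * L))).indicator
        (fun r => (r ^ 2)⁻¹) ‖t - b‖ :=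
    Finset.sum_nonneg fun _ _ => Set.indicator_nonneg (fun _ _ => by positivity) _
  by_cases ht : t ∈ S
  · rw [laplacian_congr (cutoff_eventually_zero ht hL0)]
    rw [InnerProductSpace.laplacian_const]
    simp
    positivity
  have hh := harmonicAt_sumLog S ht
  have hk : ContDiffAt ℝ 2 (fun w => L⁻¹ * sumLog S w) t := contDiffAt_const.mul hh.1
  have hk0 : Laplacian.laplacian (fun w => L⁻¹ * sumLog S w) t = 0 := by
    have := InnerProductSpace.laplacian_smul (𝕜 := ℝ) L⁻¹ hh.1
    rw [hh.2.self_of_nhds] at this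
    simpa [Pi.smul_def] using! this
  have hf : ∀ v, fderiv ℝ (fun w => L⁻¹ * sumLog S w) t v = L⁻¹ * fderiv ℝ (sumLog S) t v := by
    intro v
    rw [((hh.1.differentiableAt (by norm_num)).hasFDerivAt.const_mul L⁻¹).fderiv]
    simp
  rw [laplacian_congr (cutoff_eventuallyEq ht L), laplacian_comp_real
    (η := lineBump) (η' := deriv lineBump) (η'' := deriv (deriv lineBump)) hk
    (.of_forall hasDerivAt_lineBump) (hasDerivAt_deriv_lineBump _), hk0, hf, hf, mul_zero, add_zero]
  by_cases hle : |sumLog S t| ≤ 2 * L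
  · have e : ∀ b ∈ S, (Set.Ioc (Real.exp (-(4 * L))) (Real.exp (4 * L))).indicator
        (fun r => (r ^ 2)⁻¹) ‖t - b‖ = ‖t - b‖⁻¹ ^ 2 := by
      intro b hb
      have h2 := abs_le.1 (h L hL t ht hle b hb)
      have hp : 0 < ‖t - b‖ := norm_pos_iff.2 (sub_ne_zero.2 fun e => ht (e ▸ hb))
      rw [Set.indicator_of_mem, inv_pow]
      constructor
      · rw [← Real.lt_log_iff_exp_lt hp]; linarith
      · rw [← Real.log_le_iff_le_exp hp]; linarith
    rw [Finset.sum_congr rfl e]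
    have h3 := sq_sum_le_card_mul_sum_sq (s := S) (f := fun b => ‖t - b‖⁻¹)
    have h4 : ∀ v : ℂ, ‖v‖ = 1 →
        (L⁻¹ * fderiv ℝ (sumLog S) t v) ^ 2 ≤ (L ^ 2)⁻¹ * (∑ b ∈ S, ‖t - b‖⁻¹) ^ 2 := by
      intro v hv
      rw [mul_pow, inv_pow]
      gcongr ?_ * ?_
      rw [← sq_abs]
      have := abs_fderiv_sumLog_le S ht v
      rw [hv, mul_one] at this
      exact pow_le_pow_left₀ (abs_nonneg _) this 2
    have h5 := h4 1 (by simp)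
    have h6 := h4 Complex.I (by simp)
    rw [abs_mul, abs_of_nonneg (by positivity :
      0 ≤ (L⁻¹ * fderiv ℝ (sumLog S) t 1) ^ 2 + (L⁻¹ * fderiv ℝ (sumLog S) t Complex.I) ^ 2)]
    calc _ ≤ B * ((L ^ 2)⁻¹ * (∑ b ∈ S, ‖t - b‖⁻¹) ^ 2 +
          (L ^ 2)⁻¹ * (∑ b ∈ S, ‖t - b‖⁻¹) ^ 2) := by
          gcongr
          exact hB _
      _ = 2 * B * (L ^ 2)⁻¹ * (∑ b ∈ S, ‖t - b‖⁻¹) ^ 2 := by ring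
      _ ≤ 2 * B * (L ^ 2)⁻¹ * (S.card * ∑ b ∈ S, ‖t - b‖⁻¹ ^ 2) := by gcongr
      _ = _ := by ring
  · rw [deriv_deriv_lineBump_eq_zero]
    · simp; positivity
    · rw [abs_mul, abs_of_pos (inv_pos.2 hL0), ← div_eq_inv_mul, lt_div_iff₀ hL0]
      exact not_le.1 hle

end Cutoff

/-! ### Green's identity across isolated singularities -/

section Green

theorem ae_notMem_finset (S : Finset ℂ) : ∀ᵐ t : ℂ, t ∉ S :=
  (Finset.measure_zero S volume : _) |> measure_eq_zero_iff_ae_notMem.1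

theorem aestronglyMeasurable_of_continuousAt_compl {F : Type*} [NormedAddCommGroup F]
    [NormedSpace ℝ F] {S : Finset ℂ} {Φ : ℂ → F} (h : ∀ t ∉ S, ContinuousAt Φ t) :
    AEStronglyMeasurable Φ volume := by
  have hm : MeasurableSet ((S : Set ℂ)ᶜ) := S.finite_toSet.measurableSet.compl
  have h1 : ContinuousOn Φ ((S : Set ℂ)ᶜ) := fun t ht => (h t ht).continuousWithinAt
  have h2 := h1.aestronglyMeasurable (μ := volume) hm
  have h3 : ∀ᵐ t : ℂ, t ∈ ((S : Set ℂ)ᶜ) := ae_notMem_finset S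
  rwa [Measure.restrict_eq_self_of_ae_mem h3] at h2

/-- Green's second identity for a function `V` that is smooth on the sphere and a function `Φ` that
is bounded with integrable Laplacian and smooth off a finite set: no boundary terms arise at the
finite set or at infinity. -/
theorem integral_smul_laplacian_comm_of_bounded {S : Finset ℂ} (hS : S.Nonempty) {V : ℂ → ℝ}
    {C : ℝ} (hV : ContDiff ℝ 2 V) (hV0 : ∀ t, |V t| ≤ C)
    (hV1 : ∀ t v, |fderiv ℝ V t v| ≤ C * ((1 + ‖t‖) ^ 2)⁻¹ * ‖v‖)
    (hV2 : Integrable (Laplacian.laplacian V)) {Φ : ℂ → ℂ} (hΦ : ∀ t ∉ S, ContDiffAt ℝ 2 Φ t)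
    {M : ℝ} (hM : ∀ t, ‖Φ t‖ ≤ M) (hΔ : Integrable (Laplacian.laplacian Φ)) :
    ∫ t, V t • Laplacian.laplacian Φ t = ∫ t, Laplacian.laplacian V t • Φ t := by
  obtain ⟨L₀, hL₀, hlog⟩ := exists_forall_abs_log_le S
  obtain ⟨B, hB0, hB⟩ := exists_bound_deriv_lineBump
  have hC : 0 ≤ C := (abs_nonneg _).trans (hV0 0)
  have hM0 : 0 ≤ M := (norm_nonneg _).trans (hM 0)
  have hΦm : AEStronglyMeasurable Φ volume :=
    aestronglyMeasurable_of_continuousAt_compl fun t ht => (hΦ t ht).continuousAt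
  have hχm : ∀ L, AEStronglyMeasurable (cutoff S L) volume := fun L =>
    aestronglyMeasurable_of_continuousAt_compl (S := S) fun t ht => by
      refine ContinuousAt.congr ?_ (cutoff_eventuallyEq ht L).symm
      exact (contDiff_lineBump (n := 0)).continuous.continuousAt.comp
        (continuousAt_const.mul (harmonicAt_sumLog S ht).1.continuousAt)
  have hχ1 : ∀ L t, |cutoff S L t| ≤ 1 := fun L t => by
    have := cutoff_mem_Icc (S := S) L t
    rw [abs_of_nonneg this.1]; exact this.2
  have hVΔ : Integrable fun t => V t • Laplacian.laplacian Φ t :=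
    hΔ.bdd_smul C hV.continuous.aestronglyMeasurable (.of_forall hV0)
  have hΔV : Integrable fun t => Laplacian.laplacian V t • Φ t := by
    have := hV2.smul_bdd M hΦm (.of_forall hM)
    exact this
  have limit : ∀ G : ℂ → ℂ, Integrable G →
      Filter.Tendsto (fun L => ∫ t, cutoff S L t • G t) Filter.atTop (𝓝 (∫ t, G t)) := by
    intro G hG
    refine tendsto_integral_filter_of_dominated_convergence (fun t => ‖G t‖)
      (.of_forall fun L => (hχm L).smul hG.1) (.of_forall fun L => .of_forall fun t => ?_) hG.norm ?_
    · rw [norm_smul]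
      exact mul_le_of_le_one_left (norm_nonneg _) (hχ1 L t)
    · filter_upwards [ae_notMem_finset S] with t ht
      simpa using (tendsto_cutoff ht).smul_const (G t)
  have hA := limit _ hVΔ
  have hB' := limit _ hΔV
  set K : ℝ := M * (C * (2 * B * S.card) * (S.card * (16 * Real.pi)) +
    4 * B * C * ∫ t, poleWeight S t) with hK
  -- The error consists of the terms in which the cut-off is differentiated. Its Laplacian contributes
  -- `L⁻²` times the integral `16πL` of `|t - b|⁻²` over an annulus, its gradient is `O(L⁻¹)`.
  have key : ∀ L, L₀ ≤ L → ‖(∫ t, cutoff S L t • V t • Laplacian.laplacian Φ t) -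
      ∫ t, cutoff S L t • Laplacian.laplacian V t • Φ t‖ ≤ K * L⁻¹ := by
    intro L hL
    have hL0 : 0 < L := by linarith
    have hχ := contDiff_cutoff (S := S) hL0
    have hc := hasCompactSupport_cutoff hS hL₀ hlog hL
    have e1 : ∫ t, cutoff S L t • V t • Laplacian.laplacian Φ t =
        ∫ t, Laplacian.laplacian (fun t => cutoff S L t * V t) t • Φ t := by
      rw [← integral_smul_laplacian_comm (hχ.mul hV) hc.mul_right]
      · simp only [mul_smul]
      · intro z hz
        refine hΦ z fun hzS => notMem_tsupport_cutoff hzS hL0 ?_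
        exact tsupport_mul_subset_left hz
    have e2 : ∀ t, Laplacian.laplacian (fun t => cutoff S L t * V t) t • Φ t =
        cutoff S L t • Laplacian.laplacian V t • Φ t +
        (V t * Laplacian.laplacian (cutoff S L) t + 2 * (fderiv ℝ (cutoff S L) t 1 * fderiv ℝ V t 1 +
          fderiv ℝ (cutoff S L) t Complex.I * fderiv ℝ V t Complex.I)) • Φ t := by
      intro t
      rw [laplacian_mul hχ.contDiffAt hV.contDiffAt, add_assoc, add_smul, mul_smul]
    have i1 : Integrable fun t => cutoff S L t • Laplacian.laplacian V t • Φ t :=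
      hΔV.bdd_smul 1 (hχm L) (.of_forall (hχ1 L))
    have hbound : ∀ t, ‖(V t * Laplacian.laplacian (cutoff S L) t +
        2 * (fderiv ℝ (cutoff S L) t 1 * fderiv ℝ V t 1 +
          fderiv ℝ (cutoff S L) t Complex.I * fderiv ℝ V t Complex.I)) • Φ t‖ ≤
        M * (C * (2 * B * S.card / L ^ 2 *
          ∑ b ∈ S, (Set.Ioc (Real.exp (-(4 * L))) (Real.exp (4 * L))).indicator
            (fun r => (r ^ 2)⁻¹) ‖t - b‖) + 4 * B * C / L * poleWeight S t) := by
      intro t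
      rw [norm_smul, mul_comm]
      refine mul_le_mul (hM t) ?_ (norm_nonneg _) hM0
      have g1 := abs_laplacian_cutoff_le hL₀ hlog hL hB0 (fun s => (hB s).2) t
      have g2 : ∀ v : ℂ, ‖v‖ = 1 → |fderiv ℝ (cutoff S L) t v * fderiv ℝ V t v| ≤
          B * C / L * poleWeight S t := by
        intro v hv
        rw [abs_mul]
        have a1 := abs_fderiv_cutoff_le (S := S) hL0 hB0 (fun s => (hB s).1) t v
        have a2 := hV1 t v
        rw [hv, mul_one] at a1 a2
        have hs : 0 ≤ ∑ b ∈ S, ‖t - b‖⁻¹ := Finset.sum_nonneg fun _ _ => by positivity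
        refine (mul_le_mul a1 a2 (abs_nonneg _) (by positivity)).trans_eq ?_
        rw [poleWeight, ← Finset.sum_mul]; ring
      have g3 := g2 1 (by simp)
      have g4 := g2 Complex.I (by simp)
      have g5 := mul_le_mul (hV0 t) g1 (abs_nonneg _) hC
      rw [← abs_mul] at g5
      rw [Real.norm_eq_abs]
      have g6 := abs_add_le (V t * Laplacian.laplacian (cutoff S L) t)
        (2 * (fderiv ℝ (cutoff S L) t 1 * fderiv ℝ V t 1 +
          fderiv ℝ (cutoff S L) t Complex.I * fderiv ℝ V t Complex.I))
      have g7 := abs_add_le (fderiv ℝ (cutoff S L) t 1 * fderiv ℝ V t 1)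
          (fderiv ℝ (cutoff S L) t Complex.I * fderiv ℝ V t Complex.I)
      rw [abs_mul 2, abs_two] at g6
      have g8 : 4 * B * C / L * poleWeight S t = 4 * (B * C / L * poleWeight S t) := by ring
      rw [g8]
      linarith
    have hann := fun b => integral_annulus_inv_sq (by linarith : 0 ≤ 4 * L) b
    have i2 : Integrable fun t => M * (C * (2 * B * S.card / L ^ 2 *
          ∑ b ∈ S, (Set.Ioc (Real.exp (-(4 * L))) (Real.exp (4 * L))).indicator
            (fun r => (r ^ 2)⁻¹) ‖t - b‖) + 4 * B * C / L * poleWeight S t) :=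
      ((((integrable_finsetSum _ fun b _ => (hann b).1).const_mul _).const_mul _).add
        ((integrable_poleWeight S).const_mul _)).const_mul _
    have i3 : Integrable fun t => (V t * Laplacian.laplacian (cutoff S L) t +
        2 * (fderiv ℝ (cutoff S L) t 1 * fderiv ℝ V t 1 +
          fderiv ℝ (cutoff S L) t Complex.I * fderiv ℝ V t Complex.I)) • Φ t := by
      refine i2.mono' (AEStronglyMeasurable.fun_smul (Continuous.aestronglyMeasurable ?_) hΦm)
        (.of_forall hbound)
      have c1 : Continuous (Laplacian.laplacian (cutoff S L)) := continuous_iff_continuousAt.2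
        fun t => hχ.contDiffAt.continuousAt_laplacian
      have c2 := hχ.continuous_fderiv (by norm_num)
      have c3 := hV.continuous_fderiv (by norm_num)
      have c4 := hV.continuous
      fun_prop
    rw [e1]
    simp only [e2]
    rw [integral_add i1 i3, add_sub_cancel_left]
    refine (norm_integral_le_integral_norm _).trans ((integral_mono i3.norm i2 hbound).trans_eq ?_)
    rw [integral_const_mul, integral_add, integral_const_mul, integral_const_mul,
      integral_const_mul, integral_finsetSum _ fun b _ => (hann b).1,
      Finset.sum_congr rfl fun b _ => (hann b).2, Finset.sum_const, nsmul_eq_mul, hK]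
    · field_simp
      ring
    · exact ((integrable_finsetSum _ fun b _ => (hann b).1).const_mul _).const_mul _
    · exact (integrable_poleWeight S).const_mul _
  have hlim : Filter.Tendsto (fun L : ℝ => K * L⁻¹) Filter.atTop (𝓝 0) := by
    simpa using tendsto_inv_atTop_zero.const_mul K
  have h0 := squeeze_zero_norm' (Filter.eventually_atTop.2 ⟨L₀, key⟩) hlim
  exact sub_eq_zero.1 (tendsto_nhds_unique (hA.sub hB') h0)

end Green

/-! ### Smooth functions on the sphere -/

section Sphere

/-- A function on the plane which extends to a `C²` function on the sphere is bounded, its gradient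
is `O(|t|⁻²)` and its Laplacian is integrable. -/
theorem exists_bound_of_contDiff_sphere {V W : ℂ → ℝ} (hV : ContDiff ℝ 2 V) (hW : ContDiff ℝ 2 W)
    (h : ∀ t, t ≠ 0 → V t⁻¹ = W t) : ∃ C : ℝ, (∀ t, |V t| ≤ C) ∧
      (∀ t v, |fderiv ℝ V t v| ≤ C * ((1 + ‖t‖) ^ 2)⁻¹ * ‖v‖) ∧
      Integrable (Laplacian.laplacian V) := by
  have hK : IsCompact (Metric.closedBall (0 : ℂ) 1) := isCompact_closedBall _ _
  have cΔ : ∀ {U : ℂ → ℝ}, ContDiff ℝ 2 U → Continuous (Laplacian.laplacian U) := fun hU =>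
    continuous_iff_continuousAt.2 fun t => hU.contDiffAt.continuousAt_laplacian
  have bound : ∀ {U : ℂ → ℝ}, ContDiff ℝ 2 U → ∃ C : ℝ, ∀ t : ℂ, ‖t‖ ≤ 1 →
      |U t| ≤ C ∧ ‖fderiv ℝ U t‖ ≤ C ∧ |Laplacian.laplacian U t| ≤ C := by
    intro U hU
    obtain ⟨C1, h1⟩ := hK.exists_bound_of_continuousOn hU.continuous.continuousOn
    obtain ⟨C2, h2⟩ := hK.exists_bound_of_continuousOn
      (hU.continuous_fderiv (by norm_num)).continuousOn
    obtain ⟨C3, h3⟩ := hK.exists_bound_of_continuousOn (cΔ hU).continuousOn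
    refine ⟨max C1 (max C2 C3), fun t ht => ?_⟩
    have ht : t ∈ Metric.closedBall (0 : ℂ) 1 := by simpa using ht
    exact ⟨(h1 t ht).trans (le_max_left _ _),
      (h2 t ht).trans ((le_max_left _ _).trans (le_max_right _ _)),
      (h3 t ht).trans ((le_max_right _ _).trans (le_max_right _ _))⟩
  obtain ⟨C1, h1⟩ := bound hV
  obtain ⟨C2, h2⟩ := bound hW
  set C := max C1 C2
  have hC0 : 0 ≤ C := (abs_nonneg _).trans ((h1 0 (by simp)).1.trans (le_max_left _ _))
  have hout : ∀ t : ℂ, 1 < ‖t‖ → ‖t⁻¹‖ ≤ 1 ∧ V =ᶠ[𝓝 t] fun w => W w⁻¹ := by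
    intro t ht
    have h0 : t ≠ 0 := norm_pos_iff.1 (by linarith)
    refine ⟨by rw [norm_inv]; exact inv_le_one_of_one_le₀ ht.le, ?_⟩
    filter_upwards [isOpen_ne.mem_nhds h0] with w hw
    rw [← h w⁻¹ (inv_ne_zero hw), inv_inv]
  have hle : ∀ t : ℂ, 1 < ‖t‖ → (‖t‖ ^ 2)⁻¹ ≤ 4 * ((1 + ‖t‖) ^ 2)⁻¹ := by
    intro t ht
    rw [← div_eq_mul_inv, inv_le_comm₀ (by positivity) (by positivity), inv_div,
      div_le_iff₀ (by norm_num)]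
    nlinarith
  have hin : ∀ t : ℂ, ‖t‖ ≤ 1 → 1 ≤ 4 * ((1 + ‖t‖) ^ 2)⁻¹ := by
    intro t ht
    rw [← div_eq_mul_inv, le_div_iff₀ (by positivity)]
    nlinarith [norm_nonneg t]
  -- Outside the unit disc `V = W(1/t)`, so the conformal covariance gives a factor `|t|⁻⁴`.
  have hΔ : ∀ t, ‖Laplacian.laplacian V t‖ ≤ C * (4 * ((1 + ‖t‖) ^ 2)⁻¹) ^ 2 := by
    intro t
    rcases le_or_gt ‖t‖ 1 with ht | ht
    · refine ((h1 t ht).2.2.trans (le_max_left C1 C2)).trans ?_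
      exact le_mul_of_one_le_right hC0 (one_le_pow₀ (hin t ht))
    · obtain ⟨g1, g2⟩ := hout t ht
      have h0 : t ≠ 0 := norm_pos_iff.1 (by linarith)
      rw [laplacian_congr g2, laplacian_comp_holomorphic (analyticAt_inv h0) hW.contDiffAt,
        deriv_inv, norm_smul, mul_comm]
      refine mul_le_mul ((h2 _ g1).2.2.trans (le_max_right _ _)) ?_ (norm_nonneg _) hC0
      rw [norm_neg, norm_inv, norm_pow, norm_pow, norm_inv, norm_pow, norm_norm]
      exact pow_le_pow_left₀ (by positivity) (hle t ht) 2
  refine ⟨4 * C, fun t => ?_, fun t v => ?_, ?_⟩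
  · rcases le_or_gt ‖t‖ 1 with ht | ht
    · linarith [(h1 t ht).1, le_max_left C1 C2]
    · obtain ⟨g1, g2⟩ := hout t ht
      rw [g2.self_of_nhds]
      linarith [(h2 _ g1).1, le_max_right C1 C2]
  · rcases le_or_gt ‖t‖ 1 with ht | ht
    · have := (fderiv ℝ V t).le_opNorm v
      calc |fderiv ℝ V t v| ≤ ‖fderiv ℝ V t‖ * ‖v‖ := this
        _ ≤ C * (4 * ((1 + ‖t‖) ^ 2)⁻¹) * ‖v‖ := by
          gcongr
          exact ((h1 t ht).2.1.trans (le_max_left _ _)).trans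
            (le_mul_of_one_le_right hC0 (hin t ht))
        _ = _ := by ring
    · obtain ⟨g1, g2⟩ := hout t ht
      have h0 : t ≠ 0 := norm_pos_iff.1 (by linarith)
      have d := ((hW.differentiable (by norm_num) t⁻¹).hasFDerivAt.comp t
        ((hasDerivAt_inv h0).hasFDerivAt.restrictScalars ℝ)).fderiv
      rw [g2.fderiv_eq]
      simp only [Function.comp_def] at d
      rw [d]
      change |fderiv ℝ W t⁻¹ (v * (-(t ^ 2)⁻¹))| ≤ _
      refine ((fderiv ℝ W t⁻¹).le_opNorm _).trans ?_
      rw [norm_mul, norm_neg, norm_inv, norm_pow]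
      calc _ ≤ C * (‖v‖ * (4 * ((1 + ‖t‖) ^ 2)⁻¹)) := by
            gcongr
            · exact (h2 _ g1).2.1.trans (le_max_right _ _)
            · exact hle t ht
        _ = _ := by ring
  · have i : Integrable fun t : ℂ => C * 16 * (1 + ‖t‖) ^ (-4 : ℝ) :=
      (integrable_one_add_norm (by rw [Complex.finrank_real_complex]; norm_num)).const_mul _
    refine i.mono' (cΔ hV).aestronglyMeasurable (.of_forall fun t => (hΔ t).trans_eq ?_)
    rw [Real.rpow_neg (by positivity)]
    norm_cast
    field_simp
    norm_num

/-- `½ log(|t - a|² + b) - ½ log(|t|² + 1)` is smooth on the sphere. -/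
theorem exists_bound_half_log_sub (a : ℂ) {b : ℝ} (hb : 0 < b) :
    ∃ C : ℝ, (∀ t : ℂ, |1 / 2 * Real.log (‖t - a‖ ^ 2 + b) -
        1 / 2 * Real.log (‖t - 0‖ ^ 2 + 1)| ≤ C) ∧
      (∀ t v : ℂ, |fderiv ℝ (fun t : ℂ => 1 / 2 * Real.log (‖t - a‖ ^ 2 + b) -
        1 / 2 * Real.log (‖t - 0‖ ^ 2 + 1)) t v| ≤ C * ((1 + ‖t‖) ^ 2)⁻¹ * ‖v‖) ∧
      Integrable (Laplacian.laplacian fun t : ℂ => 1 / 2 * Real.log (‖t - a‖ ^ 2 + b) -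
        1 / 2 * Real.log (‖t - 0‖ ^ 2 + 1)) := by
  have hpos : ∀ t : ℂ, 0 < ‖1 - a * t‖ ^ 2 + b * ‖t‖ ^ 2 := by
    intro t
    by_cases ht : t = 0
    · simp [ht]
    · have : 0 < ‖t‖ := norm_pos_iff.2 ht
      positivity
  refine exists_bound_of_contDiff_sphere (W := fun t => 1 / 2 *
    Real.log (‖1 - a * t‖ ^ 2 + b * ‖t‖ ^ 2) - 1 / 2 * Real.log (‖t - 0‖ ^ 2 + 1))
    ((contDiff_half_log a hb).sub (contDiff_half_log 0 one_pos))
    (ContDiff.sub ?_ (contDiff_half_log 0 one_pos)) fun t ht => ?_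
  · refine contDiff_const.mul (ContDiff.log ?_ fun t => (hpos t).ne')
    exact ((contDiff_const.sub (contDiff_const.mul contDiff_id)).norm_sq ℝ).add
      (contDiff_const.mul (contDiff_id.norm_sq ℝ))
  · have hn : 0 < ‖t‖ := norm_pos_iff.2 ht
    have e1 : ‖t⁻¹ - a‖ ^ 2 + b = (‖1 - a * t‖ ^ 2 + b * ‖t‖ ^ 2) / ‖t‖ ^ 2 := by
      have : t⁻¹ - a = (1 - a * t) / t := by field_simp
      rw [this, norm_div, div_pow]
      field_simp
    have e2 : ‖t⁻¹ - 0‖ ^ 2 + 1 = (‖t - 0‖ ^ 2 + 1) / ‖t‖ ^ 2 := by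
      rw [sub_zero, sub_zero, norm_inv]
      field_simp
      ring
    change 1 / 2 * Real.log _ - 1 / 2 * Real.log _ = _
    rw [e1, e2, Real.log_div (hpos t).ne' (by positivity), Real.log_div (by positivity)
      (by positivity)]
    ring

open HyperellipticEquation

theorem one_le_sigma {g : ℕ} (hg : 1 ≤ g) {s : ℝ} (hs : 0 ≤ s) : 1 ≤ sigma g s := by
  have := Finset.single_le_sum (f := fun i => s ^ i) (fun i _ => pow_nonneg hs i)
    (Finset.mem_range.2 hg)
  simpa [sigma] using this

theorem contDiff_sigma_norm_sq (g : ℕ) {n : WithTop ℕ∞} :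
    ContDiff ℝ n fun t : ℂ => sigma g (‖t‖ ^ 2) := by
  unfold sigma
  exact ContDiff.sum fun i _ => (contDiff_id.norm_sq ℝ).pow i

theorem contDiff_log_sigma {g : ℕ} (hg : 1 ≤ g) {n : WithTop ℕ∞} :
    ContDiff ℝ n fun t : ℂ => Real.log (sigma g (‖t‖ ^ 2)) :=
  (contDiff_sigma_norm_sq g).log fun t => by linarith [one_le_sigma hg (sq_nonneg ‖t‖)]

theorem sigma_inv {g : ℕ} (hg : 1 ≤ g) {s : ℝ} (hs : s ≠ 0) :
    sigma g s⁻¹ = sigma g s / s ^ (g - 1) := by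
  rw [eq_div_iff (pow_ne_zero _ hs), sigma, sigma, Finset.sum_mul,
    ← Finset.sum_range_reflect (fun i => s ^ i)]
  refine Finset.sum_congr rfl fun i hi => ?_
  have h : g - 1 = i + (g - 1 - i) := by have := Finset.mem_range.1 hi; omega
  conv_lhs => rw [h, pow_add, ← mul_assoc, ← mul_pow, inv_mul_cancel₀ hs, one_pow, one_mul]

/-- `log σ_g(|t|²) - (g - 1) log(1 + |t|²)` is smooth on the sphere. -/
theorem exists_bound_log_sigma_sub {g : ℕ} (hg : 1 ≤ g) (κ : ℝ) :
    ∃ C : ℝ, (∀ t : ℂ, |κ * (Real.log (sigma g (‖t‖ ^ 2)) -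
        2 * (g - 1) * (1 / 2 * Real.log (‖t - 0‖ ^ 2 + 1)))| ≤ C) ∧
      (∀ t v : ℂ, |fderiv ℝ (fun t : ℂ => κ * (Real.log (sigma g (‖t‖ ^ 2)) -
        2 * (g - 1) * (1 / 2 * Real.log (‖t - 0‖ ^ 2 + 1)))) t v| ≤
          C * ((1 + ‖t‖) ^ 2)⁻¹ * ‖v‖) ∧
      Integrable (Laplacian.laplacian fun t : ℂ => κ * (Real.log (sigma g (‖t‖ ^ 2)) -
        2 * (g - 1) * (1 / 2 * Real.log (‖t - 0‖ ^ 2 + 1)))) := by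
  have hc : ContDiff ℝ 2 fun t : ℂ => κ * (Real.log (sigma g (‖t‖ ^ 2)) -
        2 * (g - 1) * (1 / 2 * Real.log (‖t - 0‖ ^ 2 + 1))) :=
    contDiff_const.mul ((contDiff_log_sigma hg).sub
      (contDiff_const.mul (contDiff_half_log 0 one_pos)))
  refine exists_bound_of_contDiff_sphere hc hc fun t ht => ?_
  have hn : 0 < ‖t‖ := norm_pos_iff.2 ht
  have e2 : ‖t⁻¹ - 0‖ ^ 2 + 1 = (‖t - 0‖ ^ 2 + 1) / ‖t‖ ^ 2 := by
    rw [sub_zero, sub_zero, norm_inv]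
    field_simp
    ring
  have e3 : sigma g (‖t⁻¹‖ ^ 2) = sigma g (‖t‖ ^ 2) / (‖t‖ ^ 2) ^ (g - 1) := by
    rw [norm_inv, inv_pow, sigma_inv hg (by positivity)]
  change κ * (Real.log _ - _ * (1 / 2 * Real.log _)) = _
  rw [e2, e3, Real.log_div (by linarith [one_le_sigma hg (sq_nonneg ‖t‖)]) (by positivity),
    Real.log_div (by positivity) (by positivity), Real.log_pow, Nat.cast_sub hg]
  push_cast
  ring

theorem log_den {g : ℕ} (hg : 1 ≤ g) (t : ℂ) : Real.log (den g t) =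
    1 / (2 * (g : ℝ) + 2) * (Real.log (sigma g (‖t‖ ^ 2)) -
        2 * (g - 1) * (1 / 2 * Real.log (‖t - 0‖ ^ 2 + 1))) +
      1 / 2 * Real.log (‖t - 0‖ ^ 2 + 1) := by
  have h := one_le_sigma hg (sq_nonneg ‖t‖)
  rw [den, Real.log_rpow (by positivity), Real.log_mul (by positivity) (by positivity),
    Real.log_pow, sub_zero, add_comm (‖t‖ ^ 2) 1]
  push_cast
  field_simp
  ring

theorem laplacian_log_den {g : ℕ} (hg : 1 ≤ g) (t : ℂ) :
    Laplacian.laplacian (fun t => Real.log (den g t)) t =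
      1 / (2 * (g : ℝ) + 2) *
        (Laplacian.laplacian (fun t : ℂ => Real.log (sigma g (‖t‖ ^ 2))) t +
          8 / (1 + ‖t‖ ^ 2) ^ 2) := by
  have e : (fun t => Real.log (den g t)) =
      (1 / (2 * (g : ℝ) + 2)) • ((fun t : ℂ => Real.log (sigma g (‖t‖ ^ 2))) +
        (4 : ℝ) • fun t : ℂ => 1 / 2 * Real.log (‖t - 0‖ ^ 2 + 1)) := by
    ext t
    rw [log_den hg]
    simp only [Pi.smul_apply, Pi.add_apply, smul_eq_mul]
    field_simp
    ring
  have c1 : ContDiffAt ℝ 2 (fun t : ℂ => Real.log (sigma g (‖t‖ ^ 2))) t :=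
    (contDiff_log_sigma hg).contDiffAt
  have c2 : ContDiffAt ℝ 2 (fun t : ℂ => 1 / 2 * Real.log (‖t - 0‖ ^ 2 + 1)) t :=
    (contDiff_half_log 0 one_pos).contDiffAt
  have c3 : ContDiffAt ℝ 2 ((4 : ℝ) • fun t : ℂ => 1 / 2 * Real.log (‖t - 0‖ ^ 2 + 1)) t :=
    contDiffAt_const.smul c2
  have c4 : ContDiffAt ℝ 2 ((fun t : ℂ => Real.log (sigma g (‖t‖ ^ 2))) +
      (4 : ℝ) • fun t : ℂ => 1 / 2 * Real.log (‖t - 0‖ ^ 2 + 1)) t := c1.add c3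
  rw [e, InnerProductSpace.laplacian_smul _ c4, c1.laplacian_add c3,
    InnerProductSpace.laplacian_smul _ c2, laplacian_half_log 0 t one_pos, sub_zero]
  simp only [smul_eq_mul]
  ring

end Sphere

/-! ### The fundamental solution -/

section PointMass

theorem integral_laplacian_half_log_smul (a : ℂ) {c : ℝ} (hc : 0 < c) (Φ : ℂ → ℂ) :
    ∫ t : ℂ, (2 * c ^ 2 / (‖t - a‖ ^ 2 + c ^ 2) ^ 2) • Φ t =
      ∫ w : ℂ, (2 / (‖w‖ ^ 2 + 1) ^ 2) • Φ (c • w + a) := by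
  have h1 := integral_sub_right_eq_self (μ := volume)
    (fun t : ℂ => (2 * c ^ 2 / (‖t‖ ^ 2 + c ^ 2) ^ 2) • Φ (t + a)) a
  have h2 := Measure.integral_comp_smul (volume : Measure ℂ)
    (fun t : ℂ => (2 * c ^ 2 / (‖t‖ ^ 2 + c ^ 2) ^ 2) • Φ (t + a)) c
  simp only [sub_add_cancel] at h1
  rw [Complex.finrank_real_complex, abs_of_pos (by positivity), ← h1] at h2
  have h3 : ∫ t : ℂ, (2 * c ^ 2 / (‖t - a‖ ^ 2 + c ^ 2) ^ 2) • Φ t = c ^ 2 •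
      ∫ x : ℂ, (2 * c ^ 2 / (‖c • x‖ ^ 2 + c ^ 2) ^ 2) • Φ (c • x + a) := by
    rw [h2, smul_smul, mul_inv_cancel₀ (by positivity), one_smul]
  rw [h3, ← integral_smul]
  refine integral_congr_ae (.of_forall fun w => ?_)
  simp only [smul_smul, norm_smul, Real.norm_eq_abs, abs_of_pos hc]
  congr 1
  field_simp

/-- The Laplacians of the regularised logarithms concentrate: they converge to `2π` times the limit
of the rescaled function. -/
theorem tendsto_integral_laplacian_half_log {Φ : ℂ → ℂ} (hm : Measurable Φ) {M : ℝ}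
    (hM : ∀ t, ‖Φ t‖ ≤ M) (a A : ℂ) {l : Filter ℝ} [l.IsCountablyGenerated]
    (hl : ∀ᶠ c in l, 0 < c)
    (hA : ∀ w : ℂ, w ≠ 0 → Filter.Tendsto (fun c : ℝ => Φ (c • w + a)) l (𝓝 A)) :
    Filter.Tendsto (fun c : ℝ => ∫ t : ℂ, (2 * c ^ 2 / (‖t - a‖ ^ 2 + c ^ 2) ^ 2) • Φ t) l
      (𝓝 (2 * Real.pi * A)) := by
  obtain ⟨hi, he⟩ := integral_fubiniStudy
  have e : (2 * Real.pi * A : ℂ) = ∫ w : ℂ, (2 / (‖w‖ ^ 2 + 1) ^ 2 : ℝ) • A := by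
    rw [integral_smul_const, he]; simp
  rw [e]
  have key : Filter.Tendsto (fun c : ℝ => ∫ w : ℂ, (2 / (‖w‖ ^ 2 + 1) ^ 2 : ℝ) • Φ (c • w + a)) l
      (𝓝 (∫ w : ℂ, (2 / (‖w‖ ^ 2 + 1) ^ 2 : ℝ) • A)) := by
    refine tendsto_integral_filter_of_dominated_convergence
      (fun w => 2 / (‖w‖ ^ 2 + 1) ^ 2 * M) (.of_forall fun c => ?_)
      (.of_forall fun c => .of_forall fun w => ?_) (hi.mul_const M) ?_
    · exact hi.1.smul (hm.comp (by fun_prop)).aestronglyMeasurable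
    · rw [norm_smul, Real.norm_of_nonneg (by positivity)]
      gcongr
      exact hM _
    · filter_upwards [ae_notMem_finset {0}] with w hw
      exact (hA w (by simpa using hw)).const_smul _
  refine key.congr' ?_
  filter_upwards [hl] with c hc
  exact (integral_laplacian_half_log_smul a hc Φ).symm

end PointMass

/-! ### Logarithmic potentials against functions with branch points -/

section Potential

open HyperellipticEquation

theorem measurable_den (g : ℕ) : Measurable (den g) := by
  unfold den sigma; fun_prop

theorem exists_abs_log_den_le {g : ℕ} (hg : 1 ≤ g) :
    ∃ K : ℝ, 0 ≤ K ∧ ∀ a t : ℂ, |Real.log (den g t)| ≤ K * logWeight a t := by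
  obtain ⟨C, hC, -⟩ := exists_bound_log_sigma_sub hg (1 / (2 * (g : ℝ) + 2))
  have hC0 : 0 ≤ C := (abs_nonneg _).trans (hC 0)
  refine ⟨C + 1, by linarith, fun a t => ?_⟩
  rw [log_den hg]
  refine (abs_add_le _ _).trans ?_
  have h1 := hC t
  have h2 := log_one_add_sq_nonneg t
  have h3 : |1 / 2 * Real.log (‖t - 0‖ ^ 2 + 1)| ≤ logWeight a t := by
    rw [sub_zero, add_comm (‖t‖ ^ 2) 1, abs_of_nonneg (by positivity), logWeight]
    linarith [abs_nonneg (Real.log ‖t - a‖)]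
  have h4 := one_le_logWeight a t
  nlinarith

/-- The properties of the push-forward to the `x`-plane of a smooth function on a double cover
branched over `S`: bounded, smooth off `S`, with Laplacian controlled by the area density. -/
structure IsTame (S : Finset ℂ) (Φ : ℂ → ℂ) : Prop where
  nonempty : S.Nonempty
  measurable : Measurable Φ
  bounded : ∃ M : ℝ, ∀ t, ‖Φ t‖ ≤ M
  contDiffAt : ∀ t ∉ S, ContDiffAt ℝ 2 Φ t
  laplacian_le : ∃ N : ℝ, ∀ t ∉ S, ‖Laplacian.laplacian Φ t‖ ≤ N * poleWeight S t

namespace IsTame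

variable {S : Finset ℂ} {Φ : ℂ → ℂ}

theorem aestronglyMeasurable_laplacian (h : IsTame S Φ) :
    AEStronglyMeasurable (Laplacian.laplacian Φ) volume :=
  aestronglyMeasurable_of_continuousAt_compl fun t ht => (h.contDiffAt t ht).continuousAt_laplacian

/-- A dominating function for all potentials with logarithmic poles at `a` and infinity. -/
theorem exists_integrable_bound (h : IsTame S Φ) (a : ℂ) (K : ℝ) :
    ∃ G : ℂ → ℝ, Integrable G ∧ ∀ U : ℂ → ℝ, ∀ t ∉ S, |U t| ≤ K * logWeight a t →
      ‖U t • Laplacian.laplacian Φ t‖ ≤ G t := by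
  obtain ⟨N, hN⟩ := h.laplacian_le
  refine ⟨fun t => K * N * (poleWeight S t * logWeight a t),
    (integrable_poleWeight_mul_logWeight S a).const_mul _, fun U t ht hU => ?_⟩
  rw [norm_smul]
  refine (mul_le_mul hU (hN t ht) (norm_nonneg _) ((abs_nonneg _).trans hU)).trans_eq ?_
  ring

theorem integrable_smul_laplacian (h : IsTame S Φ) {U : ℂ → ℝ}
    (hU : AEStronglyMeasurable U volume) {a : ℂ} {K : ℝ}
    (hUK : ∀ᵐ t, |U t| ≤ K * logWeight a t) :
    Integrable fun t => U t • Laplacian.laplacian Φ t := by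
  obtain ⟨G, hG, hb⟩ := h.exists_integrable_bound a K
  refine hG.mono' (hU.smul h.aestronglyMeasurable_laplacian) ?_
  filter_upwards [ae_notMem_finset S, hUK] with t ht h1 using hb U t ht h1

theorem integrable_laplacian (h : IsTame S Φ) : Integrable (Laplacian.laplacian Φ) := by
  simpa using h.integrable_smul_laplacian (U := fun _ => 1) (a := 0) (K := 1)
    aestronglyMeasurable_const (.of_forall fun t => by simpa using one_le_logWeight 0 t)

theorem aestronglyMeasurable (h : IsTame S Φ) : AEStronglyMeasurable Φ volume :=
  h.measurable.aestronglyMeasurable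

theorem integral_smul_laplacian (h : IsTame S Φ) {V : ℂ → ℝ} (hV : ContDiff ℝ 2 V)
    (hb : ∃ C : ℝ, (∀ t, |V t| ≤ C) ∧
      (∀ t v, |fderiv ℝ V t v| ≤ C * ((1 + ‖t‖) ^ 2)⁻¹ * ‖v‖) ∧
      Integrable (Laplacian.laplacian V)) :
    Integrable (fun t => V t • Laplacian.laplacian Φ t) ∧
      Integrable (fun t => Laplacian.laplacian V t • Φ t) ∧
      ∫ t, V t • Laplacian.laplacian Φ t = ∫ t, Laplacian.laplacian V t • Φ t := by
  obtain ⟨C, h0, h1, h2⟩ := hb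
  obtain ⟨M, hM⟩ := h.bounded
  exact ⟨h.integrable_laplacian.bdd_smul C hV.continuous.aestronglyMeasurable (.of_forall h0),
    h2.smul_bdd M h.aestronglyMeasurable (.of_forall hM),
    integral_smul_laplacian_comm_of_bounded h.nonempty hV h0 h1 h2 h.contDiffAt hM
      h.integrable_laplacian⟩

theorem integral_laplacian_eq_zero (h : IsTame S Φ) : ∫ t, Laplacian.laplacian Φ t = 0 := by
  have := (h.integral_smul_laplacian (V := fun _ => 1) contDiff_const
    ⟨1, by simp, fun t v => by simp; positivity, by
      rw [InnerProductSpace.laplacian_const]; exact integrable_zero _ _ _⟩).2.2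
  rw [InnerProductSpace.laplacian_const] at this
  simpa using this

/-- Green's identity for the difference of two regularised logarithms; the difference is smooth on the
sphere, which a single one is not. -/
theorem integral_half_log_sub (h : IsTame S Φ) (a : ℂ) {c : ℝ} (hc : 0 < c) :
    ∫ t : ℂ, (1 / 2 * Real.log (‖t - a‖ ^ 2 + c ^ 2) - 1 / 2 * Real.log (‖t - 0‖ ^ 2 + 1)) •
        Laplacian.laplacian Φ t =
      (∫ t : ℂ, (2 * c ^ 2 / (‖t - a‖ ^ 2 + c ^ 2) ^ 2) • Φ t) -
        ∫ t : ℂ, (2 / (‖t‖ ^ 2 + 1) ^ 2) • Φ t := by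
  have hc2 : 0 < c ^ 2 := by positivity
  obtain ⟨M, hM⟩ := h.bounded
  have e : ∀ t : ℂ, Laplacian.laplacian (fun t : ℂ => 1 / 2 * Real.log (‖t - a‖ ^ 2 + c ^ 2) -
      1 / 2 * Real.log (‖t - 0‖ ^ 2 + 1)) t =
      2 * c ^ 2 / (‖t - a‖ ^ 2 + c ^ 2) ^ 2 - 2 / (‖t‖ ^ 2 + 1) ^ 2 := by
    intro t
    have := (contDiff_half_log a hc2 (n := 2)).contDiffAt.laplacian_sub
      (contDiff_half_log 0 one_pos (n := 2)).contDiffAt (x := t)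
    rw [laplacian_half_log a t hc2, laplacian_half_log 0 t one_pos, mul_one, sub_zero] at this
    exact this
  obtain ⟨-, h2, h3⟩ := h.integral_smul_laplacian
    ((contDiff_half_log a hc2).sub (contDiff_half_log 0 one_pos)) (exists_bound_half_log_sub a hc2)
  rw [h3]
  simp only [e, sub_smul] at h2 ⊢
  have i1 : Integrable fun t : ℂ => (2 / (‖t‖ ^ 2 + 1) ^ 2) • Φ t :=
    integral_fubiniStudy.1.smul_bdd M h.aestronglyMeasurable (.of_forall hM)
  rw [integral_sub _ i1]
  exact (h2.add i1).congr (.of_forall fun t => by simp)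

theorem abs_half_log_le_logWeight {a t : ℂ} (ht : t ≠ a) {c : ℝ} (hc : 0 < c) (hc1 : c ≤ 1) :
    |1 / 2 * Real.log (‖t - a‖ ^ 2 + c ^ 2) - 1 / 2 * Real.log (‖t - 0‖ ^ 2 + 1)| ≤
      logWeight a t := by
  have hr : 0 < ‖t - a‖ := norm_pos_iff.2 (sub_ne_zero.2 ht)
  have hl := log_one_add_sq_nonneg t
  rw [sub_zero, add_comm (‖t‖ ^ 2) 1]
  set r := ‖t - a‖
  have h1 : 2 * Real.log r ≤ Real.log (r ^ 2 + c ^ 2) := by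
    have := Real.log_le_log (by positivity : 0 < r ^ 2) (by nlinarith : r ^ 2 ≤ r ^ 2 + c ^ 2)
    rw [Real.log_pow] at this
    exact_mod_cast this
  have h2 : Real.log (r ^ 2 + c ^ 2) ≤ 2 + 2 * |Real.log r| := by
    have h3 : Real.log 2 ≤ 1 := by linarith [Real.log_two_lt_d9]
    rcases le_total r 1 with hr1 | hr1
    · have := Real.log_le_log (by positivity) (by nlinarith : r ^ 2 + c ^ 2 ≤ 2)
      linarith [abs_nonneg (Real.log r)]
    · have := Real.log_le_log (by positivity) (by nlinarith : r ^ 2 + c ^ 2 ≤ 2 * r ^ 2)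
      rw [Real.log_mul (by norm_num) (by positivity), Real.log_pow] at this
      push_cast at this
      linarith [le_abs_self (Real.log r)]
  unfold logWeight
  have h4 := neg_abs_le (Real.log r)
  rw [abs_le]
  constructor <;> linarith

/-- `log |t - a|` is a fundamental solution with pole `2π` at `a`. -/
theorem integral_log_norm_sub (h : IsTame S Φ) {a : ℂ} (ha : ContinuousAt Φ a) :
    ∫ t : ℂ, (Real.log ‖t - a‖ - 1 / 2 * Real.log (‖t - 0‖ ^ 2 + 1)) •
        Laplacian.laplacian Φ t =
      2 * Real.pi * Φ a - ∫ t : ℂ, (2 / (‖t‖ ^ 2 + 1) ^ 2) • Φ t := by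
  obtain ⟨M, hM⟩ := h.bounded
  obtain ⟨G, hG, hb⟩ := h.exists_integrable_bound a 1
  have hpos : ∀ᶠ c : ℝ in 𝓝[>] 0, 0 < c := self_mem_nhdsWithin
  -- Both sides of `integral_half_log_sub` converge as `c → 0`.
  have t1 := (tendsto_integral_laplacian_half_log h.measurable hM a (Φ a) (l := 𝓝[>] (0 : ℝ))
    hpos fun w _ => by
      have hc : ContinuousAt (fun c : ℝ => Φ (c • w + a)) 0 := by
        refine ContinuousAt.comp (g := Φ) ?_ (by fun_prop)
        simpa using ha
      have := hc.tendsto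
      simp only [zero_smul, zero_add] at this
      exact this.mono_left nhdsWithin_le_nhds).sub_const
        (∫ t : ℂ, (2 / (‖t‖ ^ 2 + 1) ^ 2 : ℝ) • Φ t)
  have t2 : Filter.Tendsto (fun c : ℝ => ∫ t : ℂ, (1 / 2 * Real.log (‖t - a‖ ^ 2 + c ^ 2) -
      1 / 2 * Real.log (‖t - 0‖ ^ 2 + 1)) • Laplacian.laplacian Φ t) (𝓝[>] 0)
      (𝓝 (∫ t : ℂ, (Real.log ‖t - a‖ - 1 / 2 * Real.log (‖t - 0‖ ^ 2 + 1)) •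
        Laplacian.laplacian Φ t)) := by
    refine tendsto_integral_filter_of_dominated_convergence G ?_ ?_ hG ?_
    · filter_upwards with c
      have m : Measurable fun t : ℂ => 1 / 2 * Real.log (‖t - a‖ ^ 2 + c ^ 2) -
          1 / 2 * Real.log (‖t - 0‖ ^ 2 + 1) := by fun_prop
      exact m.aestronglyMeasurable.smul h.aestronglyMeasurable_laplacian
    · filter_upwards [hpos, nhdsWithin_le_nhds (Iic_mem_nhds (zero_lt_one (α := ℝ)))] with c h0 h1
      filter_upwards [ae_notMem_finset S, ae_notMem_finset {a}] with t ht hta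
      refine hb (fun t => 1 / 2 * Real.log (‖t - a‖ ^ 2 + c ^ 2) -
        1 / 2 * Real.log (‖t - 0‖ ^ 2 + 1)) t ht ?_
      rw [one_mul]
      exact abs_half_log_le_logWeight (by simpa using hta) h0 h1
    · filter_upwards [ae_notMem_finset {a}] with t hta
      have hr : 0 < ‖t - a‖ := norm_pos_iff.2 (sub_ne_zero.2 (by simpa using hta))
      refine Filter.Tendsto.smul_const (Filter.Tendsto.sub_const ?_ _) _
      have hc : ContinuousAt (fun c : ℝ => 1 / 2 * Real.log (‖t - a‖ ^ 2 + c ^ 2)) 0 := by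
        refine continuousAt_const.mul (ContinuousAt.log (by fun_prop) ?_)
        positivity
      have := hc.tendsto
      rw [zero_pow two_ne_zero, add_zero, Real.log_pow] at this
      convert this.mono_left nhdsWithin_le_nhds using 2
      push_cast
      ring
  refine tendsto_nhds_unique (t2.congr' ?_) t1
  filter_upwards [hpos] with c hc using h.integral_half_log_sub a hc

/-- `-½ log(1 + |t|²)` has its pole at infinity. -/
theorem integral_neg_half_log (h : IsTame S Φ) {A : ℂ}
    (hA : Filter.Tendsto Φ (Filter.cocompact ℂ) (𝓝 A)) :
    ∫ t : ℂ, (-(1 / 2 * Real.log (‖t - 0‖ ^ 2 + 1))) • Laplacian.laplacian Φ t =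
      2 * Real.pi * A - ∫ t : ℂ, (2 / (‖t‖ ^ 2 + 1) ^ 2) • Φ t := by
  obtain ⟨M, hM⟩ := h.bounded
  obtain ⟨G, hG, hb⟩ := h.exists_integrable_bound 0 1
  -- Now `c → ∞`. On the left the constant `log c` may be subtracted, since `∫ ΔΦ = 0`.
  have t1 := (tendsto_integral_laplacian_half_log h.measurable hM 0 A (l := Filter.atTop)
    (Filter.eventually_gt_atTop 0) fun w hw => by
      refine hA.comp ?_
      rw [← Metric.cobounded_eq_cocompact, ← tendsto_norm_atTop_iff_cobounded]
      have hn : 0 < ‖w‖ := norm_pos_iff.2 hw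
      have := Filter.tendsto_abs_atTop_atTop.atTop_mul_const (r := ‖w‖) hn
      simpa [norm_smul, Function.comp_def] using this).sub_const (∫ t : ℂ, (2 / (‖t‖ ^ 2 + 1) ^ 2 : ℝ) • Φ t)
  have key : ∀ c : ℝ, 0 < c → ∀ t : ℂ,
      1 / 2 * Real.log (‖t - 0‖ ^ 2 + c ^ 2) - 1 / 2 * Real.log (‖t - 0‖ ^ 2 + 1) =
      (1 / 2 * Real.log (‖t‖ ^ 2 / c ^ 2 + 1) - 1 / 2 * Real.log (‖t - 0‖ ^ 2 + 1)) +
        Real.log c := by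
    intro c hc t
    have : ‖t - 0‖ ^ 2 + c ^ 2 = (‖t‖ ^ 2 / c ^ 2 + 1) * c ^ 2 := by
      rw [sub_zero]; field_simp
    rw [this, Real.log_mul (by positivity) (by positivity), Real.log_pow]
    push_cast
    ring
  have hle : ∀ c : ℝ, 1 ≤ c → ∀ t : ℂ,
      |1 / 2 * Real.log (‖t‖ ^ 2 / c ^ 2 + 1) - 1 / 2 * Real.log (‖t - 0‖ ^ 2 + 1)| ≤
        1 * logWeight 0 t := by
    intro c hc t
    have h1 : 0 ≤ Real.log (‖t‖ ^ 2 / c ^ 2 + 1) := Real.log_nonneg (by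
      have : 0 ≤ ‖t‖ ^ 2 / c ^ 2 := by positivity
      linarith)
    have h2 : Real.log (‖t‖ ^ 2 / c ^ 2 + 1) ≤ Real.log (1 + ‖t‖ ^ 2) := by
      refine Real.log_le_log (by positivity) ?_
      have : ‖t‖ ^ 2 / c ^ 2 ≤ ‖t‖ ^ 2 := div_le_self (by positivity) (one_le_pow₀ hc)
      linarith
    have h3 := abs_nonneg (Real.log ‖t - 0‖)
    unfold logWeight
    rw [sub_zero, add_comm (‖t‖ ^ 2) 1, abs_le] at *
    constructor <;> linarith
  have t2 : Filter.Tendsto (fun c : ℝ => ∫ t : ℂ, (1 / 2 * Real.log (‖t‖ ^ 2 / c ^ 2 + 1) -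
      1 / 2 * Real.log (‖t - 0‖ ^ 2 + 1)) • Laplacian.laplacian Φ t) Filter.atTop
      (𝓝 (∫ t : ℂ, (-(1 / 2 * Real.log (‖t - 0‖ ^ 2 + 1))) • Laplacian.laplacian Φ t)) := by
    refine tendsto_integral_filter_of_dominated_convergence G ?_ ?_ hG ?_
    · filter_upwards with c
      have m : Measurable fun t : ℂ => 1 / 2 * Real.log (‖t‖ ^ 2 / c ^ 2 + 1) -
          1 / 2 * Real.log (‖t - 0‖ ^ 2 + 1) := by fun_prop
      exact m.aestronglyMeasurable.smul h.aestronglyMeasurable_laplacian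
    · filter_upwards [Filter.eventually_ge_atTop 1] with c hc
      filter_upwards [ae_notMem_finset S] with t ht
      exact hb (fun t => 1 / 2 * Real.log (‖t‖ ^ 2 / c ^ 2 + 1) -
        1 / 2 * Real.log (‖t - 0‖ ^ 2 + 1)) t ht (hle c hc t)
    · filter_upwards with t
      refine Filter.Tendsto.smul_const ?_ _
      rw [← zero_sub (1 / 2 * Real.log (‖t - 0‖ ^ 2 + 1))]
      refine Filter.Tendsto.sub_const ?_ _
      have h1 : Filter.Tendsto (fun c : ℝ => ‖t‖ ^ 2 / c ^ 2 + 1) Filter.atTop (𝓝 (0 + 1)) :=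
        ((Filter.tendsto_pow_atTop two_ne_zero).const_div_atTop _).add_const 1
      rw [zero_add] at h1
      have h2 := (h1.log one_ne_zero).const_mul (1 / 2)
      rwa [Real.log_one, mul_zero] at h2
  refine tendsto_nhds_unique (t2.congr' ?_) t1
  filter_upwards [Filter.eventually_ge_atTop 1] with c hc
  have hc0 : 0 < c := by linarith
  rw [← h.integral_half_log_sub 0 hc0]
  simp only [key c hc0, add_smul]
  rw [integral_add, integral_smul, h.integral_laplacian_eq_zero, smul_zero, add_zero]
  · exact h.integrable_smul_laplacian (Measurable.aestronglyMeasurable (by fun_prop))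
      (.of_forall (hle c hc))
  · exact h.integrable_laplacian.smul _

/-- Pairing `log d` with `ΔΦ`, relative to the potential of a point mass. -/
theorem integral_log_den_sub (h : IsTame S Φ) {g : ℕ} (hg : 1 ≤ g) :
    Integrable (fun t => Laplacian.laplacian (fun t => Real.log (den g t)) t • Φ t) ∧
    ∫ t : ℂ, (Real.log (den g t) - 1 / 2 * Real.log (‖t - 0‖ ^ 2 + 1)) •
        Laplacian.laplacian Φ t =
      (∫ t : ℂ, Laplacian.laplacian (fun t => Real.log (den g t)) t • Φ t) -
        ∫ t : ℂ, (2 / (‖t‖ ^ 2 + 1) ^ 2) • Φ t := by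
  obtain ⟨M, hM⟩ := h.bounded
  set V : ℂ → ℝ := fun t : ℂ => 1 / (2 * (g : ℝ) + 2) * (Real.log (sigma g (‖t‖ ^ 2)) -
        2 * (g - 1) * (1 / 2 * Real.log (‖t - 0‖ ^ 2 + 1))) with hV
  have hVc : ContDiff ℝ 2 V := contDiff_const.mul ((contDiff_log_sigma hg).sub
      (contDiff_const.mul (contDiff_half_log 0 one_pos)))
  have e1 : (fun t => Real.log (den g t)) =
      V + fun t => 1 / 2 * Real.log (‖t - 0‖ ^ 2 + 1) := by
    ext t; exact log_den hg t
  have e2 : ∀ t, Laplacian.laplacian (fun t => Real.log (den g t)) t =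
      Laplacian.laplacian V t + 2 / (‖t‖ ^ 2 + 1) ^ 2 := by
    intro t
    rw [e1, hVc.contDiffAt.laplacian_add (contDiff_half_log 0 one_pos (n := 2)).contDiffAt,
      laplacian_half_log 0 t one_pos, sub_zero, mul_one]
  obtain ⟨-, i2, h3⟩ := h.integral_smul_laplacian hVc (exists_bound_log_sigma_sub hg _)
  have i1 : Integrable fun t : ℂ => (2 / (‖t‖ ^ 2 + 1) ^ 2) • Φ t :=
    integral_fubiniStudy.1.smul_bdd M h.aestronglyMeasurable (.of_forall hM)
  simp only [e2, add_smul]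
  refine ⟨i2.add i1, ?_⟩
  rw [integral_add i2 i1, add_sub_cancel_right, ← h3]
  refine integral_congr_ae (.of_forall fun t => ?_)
  have : Real.log (den g t) - 1 / 2 * Real.log (‖t - 0‖ ^ 2 + 1) = V t := by
    have := congrFun e1 t
    simp only [Pi.add_apply] at this
    linarith
  simp only [this]

/-- The distributional Laplacian of `log |t - a| - log d(t)` on the sphere. -/
theorem integral_log_sub_log_den (h : IsTame S Φ) {g : ℕ} (hg : 1 ≤ g) {a : ℂ}
    (ha : ContinuousAt Φ a) :
    ∫ t : ℂ, (Real.log ‖t - a‖ - Real.log (den g t)) • Laplacian.laplacian Φ t =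
      2 * Real.pi * Φ a -
        ∫ t : ℂ, Laplacian.laplacian (fun t => Real.log (den g t)) t • Φ t := by
  obtain ⟨K, hK0, hK⟩ := exists_abs_log_den_le hg
  have hl : ∀ t, |Real.log ‖t - a‖| ≤ 1 * logWeight a t := fun t => by
    unfold logWeight; linarith [log_one_add_sq_nonneg t]
  have hl2 : ∀ t : ℂ, |1 / 2 * Real.log (‖t - 0‖ ^ 2 + 1)| ≤ 1 * logWeight a t := fun t => by
    have h2 := log_one_add_sq_nonneg t
    rw [sub_zero, add_comm (‖t‖ ^ 2) 1, abs_of_nonneg (by positivity), logWeight]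
    linarith [abs_nonneg (Real.log ‖t - a‖)]
  have m1 : Measurable fun t : ℂ => Real.log ‖t - a‖ := by fun_prop
  have m2 : Measurable fun t : ℂ => 1 / 2 * Real.log (‖t - 0‖ ^ 2 + 1) := by fun_prop
  have m3 : Measurable fun t : ℂ => Real.log (den g t) := (measurable_den g).log
  have i1 := h.integrable_smul_laplacian m1.aestronglyMeasurable (.of_forall hl)
  have i2 := h.integrable_smul_laplacian m2.aestronglyMeasurable (.of_forall hl2)
  have i3 := h.integrable_smul_laplacian m3.aestronglyMeasurable (.of_forall (hK a))
  have e1 := h.integral_log_norm_sub ha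
  have e2 := (h.integral_log_den_sub hg).2
  simp only [sub_smul] at e1 e2 ⊢
  rw [integral_sub i1 i2] at e1
  rw [integral_sub i3 i2] at e2
  rw [integral_sub i1 i3]
  linear_combination e1 - e2

/-- The distributional Laplacian of `-log d(t)` on the sphere. -/
theorem integral_neg_log_den (h : IsTame S Φ) {g : ℕ} (hg : 1 ≤ g) {A : ℂ}
    (hA : Filter.Tendsto Φ (Filter.cocompact ℂ) (𝓝 A)) :
    ∫ t : ℂ, (-Real.log (den g t)) • Laplacian.laplacian Φ t =
      2 * Real.pi * A - ∫ t : ℂ, Laplacian.laplacian (fun t => Real.log (den g t)) t • Φ t := by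
  obtain ⟨K, hK0, hK⟩ := exists_abs_log_den_le hg
  have hl2 : ∀ t : ℂ, |1 / 2 * Real.log (‖t - 0‖ ^ 2 + 1)| ≤ 1 * logWeight 0 t := fun t => by
    have h2 := log_one_add_sq_nonneg t
    rw [sub_zero, add_comm (‖t‖ ^ 2) 1, abs_of_nonneg (by positivity), logWeight]
    linarith [abs_nonneg (Real.log ‖t - 0‖)]
  have m2 : Measurable fun t : ℂ => 1 / 2 * Real.log (‖t - 0‖ ^ 2 + 1) := by fun_prop
  have m3 : Measurable fun t : ℂ => Real.log (den g t) := (measurable_den g).log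
  have i2 := h.integrable_smul_laplacian m2.aestronglyMeasurable (.of_forall hl2)
  have i3 := h.integrable_smul_laplacian m3.aestronglyMeasurable (.of_forall (hK 0))
  have e1 := h.integral_neg_half_log hA
  have e2 := (h.integral_log_den_sub hg).2
  simp only [sub_smul, neg_smul] at e1 e2 ⊢
  rw [integral_neg] at e1 ⊢
  rw [integral_sub i3 i2] at e2
  linear_combination e1 - e2

end IsTame

end Potential

/-! ### Coordinates on the hyperelliptic curve -/

namespace AffineCurve

variable {p : Polynomial ℂ}

theorem chart_apply_of_ne (q : AffineCurve p) (hq : q.1.2 = 0 → p.derivative.eval q.1.1 ≠ 0)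
    (h : q.1.2 ≠ 0) (r : AffineCurve p) : chart q hq r = r.1.1 := by
  unfold chart; rw [dif_neg h]; rfl

theorem chart_apply_of_eq (q : AffineCurve p) (hq : q.1.2 = 0 → p.derivative.eval q.1.1 ≠ 0)
    (h : q.1.2 = 0) (r : AffineCurve p) : chart q hq r = r.1.2 := by
  unfold chart; rw [dif_pos h]; rfl

theorem analyticAt_chart_symm (q : AffineCurve p)
    (hq : q.1.2 = 0 → p.derivative.eval q.1.1 ≠ 0) {t : ℂ} (ht : t ∈ (chart q hq).target) :
    AnalyticAt ℂ (fun t => ((chart q hq).symm t).1.1) t ∧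
      AnalyticAt ℂ (fun t => ((chart q hq).symm t).1.2) t := by
  have h := ((contDiffOn_chart_symm q hq).contDiffAt ((chart q hq).open_target.mem_nhds ht))
  exact ⟨(h.fst).analyticAt, (h.snd).analyticAt⟩

theorem isCompact_setOf_norm_le (p : Polynomial ℂ) (r : ℝ) :
    IsCompact {q : AffineCurve p | ‖q.1.1‖ ≤ r} := by
  rw [Subtype.isCompact_iff]
  obtain ⟨C, hC⟩ := (isCompact_closedBall (0 : ℂ) r).exists_bound_of_continuousOn
    p.continuous.continuousOn
  refine (isCompact_closedBall (0 : ℂ × ℂ) (max r (max C 1))).of_isClosed_subset ?_ ?_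
  · have : Subtype.val '' {q : AffineCurve p | ‖q.1.1‖ ≤ r} =
        {q : ℂ × ℂ | q.2 ^ 2 = p.eval q.1} ∩ {q | ‖q.1‖ ≤ r} := by
      ext q
      constructor
      · rintro ⟨q, hq, rfl⟩; exact ⟨q.2, hq⟩
      · rintro ⟨h1, h2⟩; exact ⟨⟨q, h1⟩, h2, rfl⟩
    rw [this]
    refine (isClosed_eq (by fun_prop) ?_).inter (isClosed_le (by fun_prop) continuous_const)
    exact p.continuous.comp continuous_fst
  · rintro _ ⟨q, hq, rfl⟩
    have hq : ‖q.1.1‖ ≤ r := hq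
    have h1 := hC q.1.1 (by simpa using hq)
    rw [← q.2, norm_pow] at h1
    rw [mem_closedBall_zero_iff, Prod.norm_def]
    refine max_le (hq.trans (le_max_left _ _)) (le_trans ?_ (le_max_right _ _))
    by_contra! h
    have h2 := (le_max_left C 1).trans_lt h
    have h3 := (le_max_right C 1).trans_lt h
    nlinarith

end AffineCurve

namespace HyperellipticEquation

variable {g : ℕ} (H : HyperellipticEquation g)

theorem x_incl (p : H.AffineZero) : H.x (H.incl p) = p.1.1 := rfl
theorem y_incl (p : H.AffineZero) : H.y (H.incl p) = p.1.2 := rfl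
theorem z_inclInf (q : H.AffineInf) : H.z (H.inclInf q) = q.1.1 := rfl
theorem z_incl (p : H.AffineZero) : H.z (H.incl p) = p.1.1⁻¹ := rfl

theorem mem_range_or (Q : H.Curve) :
    (∃ p, H.incl p = Q) ∨ ∃ q : H.AffineInf, q.1.1 = 0 ∧ H.inclInf q = Q := by
  by_cases h : Q ∈ Set.range H.incl
  · exact Or.inl h
  · exact Or.inr (H.exists_inclInf_of_notMem h)

theorem inclInf_notMem_range {q : H.AffineInf} (hq : q.1.1 = 0) :
    H.inclInf q ∉ Set.range H.incl := by
  rintro ⟨p, hp⟩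
  have := (H.incl_eq_inclInf.1 hp).1
  rw [hq, zero_mul] at this
  exact zero_ne_one this

theorem mem_range_inclInf_iff {p : H.AffineZero} :
    H.incl p ∈ Set.range H.inclInf ↔ p.1.1 ≠ 0 := by
  constructor
  · rintro ⟨q, hq⟩
    exact right_ne_zero_of_mul_eq_one (H.incl_eq_inclInf.1 hq.symm).1
  · intro h
    exact ⟨H.toInf p h, (H.incl_eq_inclInf.2 (H.glue_toInf p h)).symm⟩

instance : CompactSpace H.Curve := by
  refine ⟨?_⟩
  have h : (Set.univ : Set H.Curve) = H.incl '' {q | ‖q.1.1‖ ≤ 1} ∪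
      H.inclInf '' {q | ‖q.1.1‖ ≤ 1} := by
    refine (Set.eq_univ_of_forall fun Q => ?_).symm
    rcases H.mem_range_or Q with ⟨p, rfl⟩ | ⟨q, hq, rfl⟩
    · rcases le_or_gt ‖p.1.1‖ 1 with h | h
      · exact Or.inl ⟨p, h, rfl⟩
      · have h0 : p.1.1 ≠ 0 := norm_pos_iff.1 (by linarith)
        refine Or.inr ⟨H.toInf p h0, ?_, (H.incl_eq_inclInf.2 (H.glue_toInf p h0)).symm⟩
        change ‖p.1.1⁻¹‖ ≤ 1
        rw [norm_inv]
        exact inv_le_one_of_one_le₀ h.le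
    · exact Or.inr ⟨q, by simp [hq], rfl⟩
  rw [h]
  exact ((AffineCurve.isCompact_setOf_norm_le H.f 1).image H.continuous_incl).union
    ((AffineCurve.isCompact_setOf_norm_le H.fInf 1).image H.continuous_inclInf)

theorem smooth_incl (p : H.AffineZero) (h : p.1.2 = 0) : H.f.derivative.eval p.1.1 ≠ 0 :=
  H.derivative_ne_zero _ (by rw [← p.2, h]; ring)

theorem smooth_inclInf (q : H.AffineInf) (hz : q.1.1 = 0) (h : q.1.2 = 0) :
    H.fInf.derivative.eval q.1.1 ≠ 0 := by
  rw [hz]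
  refine H.derivative_fInf_ne_zero ?_
  have := q.2
  rw [hz, h] at this
  rw [← this]; ring

theorem chartAt_incl (p : H.AffineZero) : chartAt ℂ (H.incl p) =
    (AffineCurve.chart p (H.smooth_incl p)).lift_openEmbedding H.isOpenEmbedding_incl := by
  change H.chartAtPoint _ = _
  have h : H.incl p ∈ Set.range H.incl := ⟨p, rfl⟩
  have hp : h.choose = p := H.incl_injective h.choose_spec
  unfold chartAtPoint
  rw [dif_pos h]
  congr!

theorem chartAt_inclInf (q : H.AffineInf) (hz : q.1.1 = 0) : chartAt ℂ (H.inclInf q) =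
    (AffineCurve.chart q (H.smooth_inclInf q hz)).lift_openEmbedding H.isOpenEmbedding_inclInf := by
  change H.chartAtPoint _ = _
  have h := H.inclInf_notMem_range hz
  have hp : (H.exists_inclInf_of_notMem h).choose = q :=
    H.inclInf_injective (H.exists_inclInf_of_notMem h).choose_spec.2
  unfold chartAtPoint
  rw [dif_neg h]
  congr!

/-- The chart at a point of `C₀`: it is `x` or `y`, and the inverse is holomorphic. -/
theorem chartAt_incl_spec (p : H.AffineZero) :
    (p.1.2 ≠ 0 → ∀ q, chartAt ℂ (H.incl p) (H.incl q) = q.1.1) ∧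
    (p.1.2 = 0 → ∀ q, chartAt ℂ (H.incl p) (H.incl q) = q.1.2) ∧
    (chartAt ℂ (H.incl p)).source ⊆ Set.range H.incl ∧
    ∃ X Y : ℂ → ℂ, ∀ t ∈ (chartAt ℂ (H.incl p)).target, AnalyticAt ℂ X t ∧ AnalyticAt ℂ Y t ∧
      ∃ q : H.AffineZero, (chartAt ℂ (H.incl p)).symm t = H.incl q ∧ q.1 = (X t, Y t) := by
  rw [chartAt_incl]
  refine ⟨fun h q => ?_, fun h q => ?_, ?_, fun t => ((AffineCurve.chart p (H.smooth_incl p)).symm t).1.1,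
    fun t => ((AffineCurve.chart p (H.smooth_incl p)).symm t).1.2, fun t ht => ?_⟩
  · rw [OpenPartialHomeomorph.lift_openEmbedding_apply, AffineCurve.chart_apply_of_ne _ _ h]
  · rw [OpenPartialHomeomorph.lift_openEmbedding_apply, AffineCurve.chart_apply_of_eq _ _ h]
  · rintro _ ⟨q, -, rfl⟩; exact ⟨q, rfl⟩
  · obtain ⟨h1, h2⟩ := AffineCurve.analyticAt_chart_symm p (H.smooth_incl p) ht
    exact ⟨h1, h2, _, rfl, rfl⟩

/-- The chart at a point at infinity: it is `z` or `w`, and the inverse is holomorphic. -/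
theorem chartAt_inclInf_spec (p : H.AffineInf) (hz : p.1.1 = 0) :
    (p.1.2 ≠ 0 → ∀ q, chartAt ℂ (H.inclInf p) (H.inclInf q) = q.1.1) ∧
    (p.1.2 = 0 → ∀ q, chartAt ℂ (H.inclInf p) (H.inclInf q) = q.1.2) ∧
    (chartAt ℂ (H.inclInf p)).source ⊆ Set.range H.inclInf ∧
    ∃ Z W : ℂ → ℂ, ∀ t ∈ (chartAt ℂ (H.inclInf p)).target, AnalyticAt ℂ Z t ∧ AnalyticAt ℂ W t ∧
      ∃ q : H.AffineInf, (chartAt ℂ (H.inclInf p)).symm t = H.inclInf q ∧ q.1 = (Z t, W t) := by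
  rw [chartAt_inclInf _ _ hz]
  refine ⟨fun h q => ?_, fun h q => ?_, ?_, fun t => ((AffineCurve.chart p (H.smooth_inclInf p hz)).symm t).1.1,
    fun t => ((AffineCurve.chart p (H.smooth_inclInf p hz)).symm t).1.2, fun t ht => ?_⟩
  · rw [OpenPartialHomeomorph.lift_openEmbedding_apply, AffineCurve.chart_apply_of_ne _ _ h]
  · rw [OpenPartialHomeomorph.lift_openEmbedding_apply, AffineCurve.chart_apply_of_eq _ _ h]
  · rintro _ ⟨q, -, rfl⟩; exact ⟨q, rfl⟩
  · obtain ⟨h1, h2⟩ := AffineCurve.analyticAt_chart_symm p (H.smooth_inclInf p hz) ht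
    exact ⟨h1, h2, _, rfl, rfl⟩

theorem continuousAt_x (p : H.AffineZero) : ContinuousAt H.x (H.incl p) := by
  rw [← H.isOpenEmbedding_incl.continuousAt_iff]
  exact (by fun_prop : Continuous fun q : H.AffineZero => q.1.1).continuousAt

theorem continuousAt_y (p : H.AffineZero) : ContinuousAt H.y (H.incl p) := by
  rw [← H.isOpenEmbedding_incl.continuousAt_iff]
  exact (by fun_prop : Continuous fun q : H.AffineZero => q.1.2).continuousAt

theorem continuousAt_z (q : H.AffineInf) : ContinuousAt H.z (H.inclInf q) := by
  rw [← H.isOpenEmbedding_inclInf.continuousAt_iff]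
  exact (by fun_prop : Continuous fun q : H.AffineInf => q.1.1).continuousAt

/-- The points of `C₀` with `y ≠ 0`, where `x` is a local coordinate. -/
def regularPoints : Set H.Curve := {Q | ∃ p : H.AffineZero, H.incl p = Q ∧ p.1.2 ≠ 0}

theorem isOpen_regularPoints : IsOpen H.regularPoints := by
  have : H.regularPoints = H.incl '' {p | p.1.2 ≠ 0} := by
    ext Q
    exact ⟨fun ⟨p, h1, h2⟩ => ⟨p, h2, h1⟩, fun ⟨p, h1, h2⟩ => ⟨p, h2, h1⟩⟩
  rw [this]
  exact H.isOpenEmbedding_incl.isOpenMap _ (isOpen_ne_fun (by fun_prop) continuous_const)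

theorem eval_f_ne_zero {p : H.AffineZero} (hp : p.1.2 ≠ 0) : H.f.eval p.1.1 ≠ 0 := by
  rw [← p.2]; exact pow_ne_zero 2 hp

/-- Near a regular point the chart is `x`, and its inverse is `x ↦ (x, Y(x))` with a holomorphic
square root `Y` of `f`. -/
theorem exists_branch (p : H.AffineZero) (hp : p.1.2 ≠ 0) : ∃ Y : ℂ → ℂ,
    AnalyticAt ℂ Y p.1.1 ∧ Y p.1.1 = p.1.2 ∧ chartAt ℂ (H.incl p) (H.incl p) = p.1.1 ∧
    ∀ᶠ t in 𝓝 p.1.1, Y t ≠ 0 ∧ ∃ q : H.AffineZero,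
      (chartAt ℂ (H.incl p)).symm t = H.incl q ∧ q.1 = (t, Y t) := by
  obtain ⟨h1, -, -, X, Y, h⟩ := H.chartAt_incl_spec p
  have hs := mem_chart_source ℂ (H.incl p)
  set e := chartAt ℂ (H.incl p)
  have he : e (H.incl p) = p.1.1 := h1 hp p
  have ht : p.1.1 ∈ e.target := by rw [← he]; exact e.map_source hs
  obtain ⟨-, hY, q, hq1, hq2⟩ := h _ ht
  have hqp : q = p := H.incl_injective (by rw [← hq1, ← he, e.left_inv hs])
  have hYp : Y p.1.1 = p.1.2 := by
    rw [hqp] at hq2; exact (congrArg Prod.snd hq2).symm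
  refine ⟨Y, hY, hYp, he, ?_⟩
  have hne : ∀ᶠ t in 𝓝 p.1.1, Y t ≠ 0 :=
    hY.continuousAt.eventually_ne (by rwa [hYp])
  filter_upwards [hne, e.open_target.mem_nhds ht] with t ht0 htt
  obtain ⟨-, -, q, hq1, hq2⟩ := h t htt
  refine ⟨ht0, q, hq1, ?_⟩
  have : q.1.1 = t := by rw [← h1 hp q, ← hq1, e.right_inv htt]
  exact Prod.ext this (congrArg Prod.snd hq2 :)

theorem conformalFactor_of_branch {e : OpenPartialHomeomorph H.Curve ℂ} {t : ℂ}
    (h : ∀ᶠ s in 𝓝 t, ∃ q : H.AffineZero, e.symm s = H.incl q ∧ q.1.1 = s ∧ q.1.2 ≠ 0) :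
    H.conformalFactor e t = sigma g (‖t‖ ^ 2) / ‖H.f.eval t‖ := by
  obtain ⟨q, hq1, hq2, hq3⟩ := h.self_of_nhds
  have hd : deriv (fun s => H.x (e.symm s)) t = 1 := by
    have : (fun s => H.x (e.symm s)) =ᶠ[𝓝 t] id := by
      filter_upwards [h] with s ⟨q, h1, h2, _⟩
      rw [h1]; exact h2
    rw [this.deriv_eq, deriv_id]
  rw [conformalFactor, sigma, Finset.sum_div]
  refine Finset.sum_congr rfl fun j _ => ?_
  have hm : e.symm t ∈ Set.range H.incl := ⟨q, hq1.symm⟩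
  have hy : H.y (e.symm t) ≠ 0 := by rw [hq1]; exact hq3
  have e1 : H.omegaCoeff j e t = t ^ j / q.1.2 := by
    simp only [omegaCoeff, if_pos hm, if_pos hy, hd, mul_one]
    rw [hq1, x_incl, y_incl, hq2]
  have e2 : H.f.eval t = q.1.2 ^ 2 := by rw [q.2, hq2]
  rw [e1, e2, norm_div, norm_pow, norm_pow, div_pow, ← pow_mul, ← pow_mul, mul_comm j 2]

theorem conformalFactor_chartAt (p : H.AffineZero) (hp : p.1.2 ≠ 0) :
    ∀ᶠ t in 𝓝 p.1.1, H.conformalFactor (chartAt ℂ (H.incl p)) t =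
      sigma g (‖t‖ ^ 2) / ‖H.f.eval t‖ := by
  obtain ⟨Y, -, -, -, h⟩ := H.exists_branch p hp
  filter_upwards [eventually_eventually_nhds.2 h] with t ht
  refine H.conformalFactor_of_branch ?_
  filter_upwards [ht] with s ⟨h0, q, h1, h2⟩
  exact ⟨q, h1, congrArg Prod.fst h2, by rw [h2]; exact h0⟩

theorem laplaceBeltrami_incl (φ : H.Curve → ℂ) (p : H.AffineZero) (hp : p.1.2 ≠ 0) :
    H.laplaceBeltrami φ (H.incl p) = ((‖H.f.eval p.1.1‖ / sigma g (‖p.1.1‖ ^ 2) : ℝ) : ℂ) *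
      Laplacian.laplacian (fun t => φ ((chartAt ℂ (H.incl p)).symm t)) p.1.1 := by
  obtain ⟨Y, -, -, h, -⟩ := H.exists_branch p hp
  rw [laplaceBeltrami, h, (H.conformalFactor_chartAt p hp).self_of_nhds, inv_div]
  rfl

theorem harmonicAt_log_norm_f {t : ℂ} (ht : H.f.eval t ≠ 0) :
    InnerProductSpace.HarmonicAt (fun t => Real.log ‖H.f.eval t‖) t :=
  AnalyticAt.harmonicAt_log_norm
    ((Differentiable.analyticAt (f := fun t => H.f.eval t) H.f.differentiable t)) ht

/-- The curvature at a regular point: the factor `|f|` does not contribute, since `log |f|` is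
harmonic. -/
theorem gaussCurvature_incl (hg : 1 ≤ g) (p : H.AffineZero) (hp : p.1.2 ≠ 0) :
    H.gaussCurvature (H.incl p) = -(1 / 2) * (‖H.f.eval p.1.1‖ / sigma g (‖p.1.1‖ ^ 2)) *
      Laplacian.laplacian (fun t : ℂ => Real.log (sigma g (‖t‖ ^ 2))) p.1.1 := by
  obtain ⟨Y, -, -, h, -⟩ := H.exists_branch p hp
  rw [gaussCurvature, h, (H.conformalFactor_chartAt p hp).self_of_nhds, inv_div]
  congr 1
  have hf := H.eval_f_ne_zero hp
  have hh := H.harmonicAt_log_norm_f hf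
  have e : (fun t => Real.log (H.conformalFactor (chartAt ℂ (H.incl p)) t)) =ᶠ[𝓝 p.1.1]
      (fun t : ℂ => Real.log (sigma g (‖t‖ ^ 2))) - fun t => Real.log ‖H.f.eval t‖ := by
    filter_upwards [H.conformalFactor_chartAt p hp, H.f.continuous.continuousAt.eventually_ne hf]
      with t h1 h2
    rw [h1, Real.log_div (by linarith [one_le_sigma hg (sq_nonneg ‖t‖)]) (norm_ne_zero_iff.2 h2)]
    rfl
  rw [laplacian_congr e, (contDiff_log_sigma hg).contDiffAt.laplacian_sub hh.1,
    hh.2.self_of_nhds]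
  simp

end HyperellipticEquation

/-! ### The Laplacian of a smooth function is bounded -/

namespace HyperellipticEquation

variable {g : ℕ} (H : HyperellipticEquation g)

theorem exists_eventually_lt {X : Type*} [TopologicalSpace X] {h : X → ℝ} {Q : X}
    (hc : ContinuousAt h Q) : ∃ C, ∀ᶠ R in 𝓝 Q, h R < C :=
  ⟨h Q + 1, hc.eventually (gt_mem_nhds (lt_add_one _))⟩

/-- If `Y² = h` then `2 Y Y' = h'`, in absolute values. -/
theorem norm_deriv_of_sq_eq {Y h : ℂ → ℂ} {h' t : ℂ} (hY : AnalyticAt ℂ Y t)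
    (hh : HasDerivAt h h' t) (he : ∀ᶠ s in 𝓝 t, Y s ^ 2 = h s) :
    ‖Y t‖ ^ 2 * ‖deriv Y t‖ ^ 2 = ‖h'‖ ^ 2 / 4 := by
  have h1 := (hY.differentiableAt.hasDerivAt.pow 2)
  have h2 : HasDerivAt h (↑2 * Y t ^ (2 - 1) * deriv Y t) t :=
    h1.congr_of_eventuallyEq (he.mono fun s hs => hs.symm)
  have h3 := hh.unique h2
  rw [h3, ← mul_pow, ← norm_mul]
  simp only [Nat.add_one_sub_one, pow_one, norm_mul, mul_pow]
  norm_num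
  ring

theorem sigma_ge_pow (hg : 1 ≤ g) {s : ℝ} (hs : 0 ≤ s) : s ^ (g - 1) ≤ sigma g s :=
  Finset.single_le_sum (f := fun i => s ^ i) (fun i _ => pow_nonneg hs i)
    (Finset.mem_range.2 (by omega))

/-- Compared with the chart at a fixed point `Q`, the coordinate `x` at nearby regular points is
distorted by at most the conformal factor: `|dζ/dx|² |f(x)| / σ_g(|x|²)` stays bounded. -/
theorem exists_bound_deriv_transition (hg : 1 ≤ g) (Q : H.Curve) : ∃ C : ℝ, ∀ᶠ R in 𝓝 Q,
    ∀ p : H.AffineZero, H.incl p = R → p.1.2 ≠ 0 →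
      AnalyticAt ℂ (fun t => chartAt ℂ Q ((chartAt ℂ R).symm t)) p.1.1 ∧
      ‖H.f.eval p.1.1‖ * ‖deriv (fun t => chartAt ℂ Q ((chartAt ℂ R).symm t)) p.1.1‖ ^ 2 ≤
        C * sigma g (‖p.1.1‖ ^ 2) := by
  rcases H.mem_range_or Q with ⟨q, rfl⟩ | ⟨q, hz, rfl⟩
  · obtain ⟨hne, heq, -, -⟩ := H.chartAt_incl_spec q
    by_cases hq : q.1.2 = 0
    · have hc : ContinuousAt (fun R => ‖H.f.derivative.eval (H.x R)‖ ^ 2 / 4) (H.incl q) :=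
        ((H.f.derivative.continuous.continuousAt.comp (H.continuousAt_x q)).norm.pow 2).div_const _
      obtain ⟨C, hC⟩ := exists_eventually_lt hc
      refine ⟨C, hC.mono ?_⟩
      rintro R hR p rfl hp
      obtain ⟨Y, hY, hYp, -, h⟩ := H.exists_branch p hp
      have e1 : (fun t => chartAt ℂ (H.incl q) ((chartAt ℂ (H.incl p)).symm t)) =ᶠ[𝓝 p.1.1] Y := by
        filter_upwards [h] with t ⟨_, r, hr1, hr2⟩
        rw [hr1, heq hq, hr2]
      refine ⟨hY.congr e1.symm, ?_⟩
      have e2 := norm_deriv_of_sq_eq hY (H.f.hasDerivAt p.1.1) (h.mono fun t ⟨_, r, _, hr2⟩ => by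
        have := r.2; rw [hr2] at this; exact this)
      rw [e1.deriv_eq, ← p.2, norm_pow, ← hYp, e2]
      have h1 := one_le_sigma hg (sq_nonneg ‖p.1.1‖)
      rw [x_incl] at hR
      have h2 : 0 ≤ ‖H.f.derivative.eval p.1.1‖ ^ 2 / 4 := by positivity
      nlinarith
    · have hc : ContinuousAt (fun R => ‖H.f.eval (H.x R)‖) (H.incl q) :=
        (H.f.continuous.continuousAt.comp (H.continuousAt_x q)).norm
      obtain ⟨C, hC⟩ := exists_eventually_lt hc
      refine ⟨C, hC.mono ?_⟩
      rintro R hR p rfl hp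
      obtain ⟨Y, hY, hYp, -, h⟩ := H.exists_branch p hp
      have e1 : (fun t => chartAt ℂ (H.incl q) ((chartAt ℂ (H.incl p)).symm t)) =ᶠ[𝓝 p.1.1] id := by
        filter_upwards [h] with t ⟨_, r, hr1, hr2⟩
        rw [hr1, hne hq, hr2]; rfl
      refine ⟨analyticAt_id.congr e1.symm, ?_⟩
      rw [e1.deriv_eq, deriv_id]
      have h1 := one_le_sigma hg (sq_nonneg ‖p.1.1‖)
      rw [x_incl] at hR
      have h2 := norm_nonneg (H.f.eval p.1.1)
      simp only [norm_one, one_pow, mul_one]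
      nlinarith
  · obtain ⟨hne, heq, -, -⟩ := H.chartAt_inclInf_spec q hz
    have hU : ∀ᶠ R in 𝓝 (H.inclInf q), R ∈ Set.range H.inclInf :=
      H.isOpenEmbedding_inclInf.isOpen_range.mem_nhds ⟨q, rfl⟩
    -- Near `p` the transition is computed on the glued points of `C₀'`.
    have hglue : ∀ p : H.AffineZero, H.incl p ∈ Set.range H.inclInf → p.1.2 ≠ 0 → p.1.1 ≠ 0 ∧
        ∃ Y : ℂ → ℂ, AnalyticAt ℂ Y p.1.1 ∧ Y p.1.1 = p.1.2 ∧
        ∀ᶠ t in 𝓝 p.1.1, t ≠ 0 ∧ Y t ^ 2 = H.f.eval t ∧ ∃ r : H.AffineInf,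
          (chartAt ℂ (H.incl p)).symm t = H.inclInf r ∧ r.1 = (t⁻¹, Y t * t⁻¹ ^ (g + 1)) := by
      intro p hpr hp
      have h0 : p.1.1 ≠ 0 := H.mem_range_inclInf_iff.1 hpr
      obtain ⟨Y, hY, hYp, -, h⟩ := H.exists_branch p hp
      refine ⟨h0, Y, hY, hYp, ?_⟩
      filter_upwards [h, isOpen_ne.mem_nhds h0] with t ⟨_, r, hr1, hr2⟩ ht
      have hr0 : r.1.1 ≠ 0 := by rw [hr2]; exact ht
      refine ⟨ht, ?_, H.toInf r hr0, ?_, ?_⟩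
      · have := r.2; rw [hr2] at this; exact this
      · rw [hr1, H.incl_eq_inclInf.2 (H.glue_toInf r hr0)]
      · change (r.1.1⁻¹, r.1.2 * r.1.1⁻¹ ^ (g + 1)) = _
        rw [hr2]
    have hfInf : ∀ t : ℂ, t ≠ 0 → H.f.eval t = H.fInf.eval t⁻¹ * t ^ (2 * g + 2) := by
      intro t ht
      rw [H.eval_fInf_mul (inv_mul_cancel₀ ht), mul_assoc, ← mul_pow, inv_mul_cancel₀ ht, one_pow,
        mul_one]
    have hpow : ∀ t : ℂ, t ≠ 0 → ‖t‖ ^ (2 * g + 2) * (‖t‖ ^ 2)⁻¹ ^ 2 ≤ sigma g (‖t‖ ^ 2) := by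
      intro t ht
      have hn : 0 < ‖t‖ := norm_pos_iff.2 ht
      refine le_trans (le_of_eq ?_) (sigma_ge_pow hg (sq_nonneg ‖t‖))
      obtain ⟨k, rfl⟩ := Nat.exists_eq_add_of_le' hg
      rw [Nat.add_sub_cancel]
      field_simp
      ring
    by_cases hq : q.1.2 = 0
    · have hc : ContinuousAt (fun R => ‖H.fInf.derivative.eval (H.z R)‖ ^ 2 / 4) (H.inclInf q) :=
        ((H.fInf.derivative.continuous.continuousAt.comp
          (H.continuousAt_z q)).norm.pow 2).div_const _
      obtain ⟨C, hC⟩ := exists_eventually_lt hc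
      refine ⟨C, (hU.and hC).mono ?_⟩
      rintro R ⟨hRm, hR⟩ p rfl hp
      obtain ⟨h0, Y, hY, hYp, h⟩ := hglue p hRm hp
      have hn : 0 < ‖p.1.1‖ := norm_pos_iff.2 h0
      have hW : AnalyticAt ℂ (fun t => Y t * t⁻¹ ^ (g + 1)) p.1.1 :=
        hY.mul ((analyticAt_inv h0).pow _)
      have e1 : (fun t => chartAt ℂ (H.inclInf q) ((chartAt ℂ (H.incl p)).symm t)) =ᶠ[𝓝 p.1.1]
          fun t => Y t * t⁻¹ ^ (g + 1) := by
        filter_upwards [h] with t ⟨_, _, r, hr1, hr2⟩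
        rw [hr1, heq hq, hr2]
      refine ⟨hW.congr e1.symm, ?_⟩
      have hd : HasDerivAt (fun t => H.fInf.eval t⁻¹)
          (H.fInf.derivative.eval p.1.1⁻¹ * -(p.1.1 ^ 2)⁻¹) p.1.1 :=
        (H.fInf.hasDerivAt p.1.1⁻¹).comp p.1.1 (hasDerivAt_inv h0)
      have e2 := norm_deriv_of_sq_eq hW hd (h.mono fun t ⟨_, _, r, _, hr2⟩ => by
        have := r.2; rw [hr2] at this; exact this)
      rw [hYp] at e2
      rw [e1.deriv_eq]
      have e3 : ‖H.f.eval p.1.1‖ = ‖p.1.2 * p.1.1⁻¹ ^ (g + 1)‖ ^ 2 * ‖p.1.1‖ ^ (2 * g + 2) := by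
        have e4 : (‖p.1.1‖⁻¹ ^ (g + 1)) ^ 2 * ‖p.1.1‖ ^ (2 * g + 2) = 1 := by
          rw [← pow_mul, show (g + 1) * 2 = 2 * g + 2 by ring, ← mul_pow, inv_mul_cancel₀ hn.ne',
            one_pow]
        rw [← p.2, norm_mul, norm_pow, norm_pow, norm_inv, mul_pow, mul_assoc, e4, mul_one]
      rw [e3, mul_right_comm, e2, norm_mul, norm_neg, norm_inv, norm_pow]
      have h3 := hpow _ h0
      rw [z_incl] at hR
      calc _ = ‖H.fInf.derivative.eval p.1.1⁻¹‖ ^ 2 / 4 *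
            (‖p.1.1‖ ^ (2 * g + 2) * (‖p.1.1‖ ^ 2)⁻¹ ^ 2) := by ring
        _ ≤ _ := mul_le_mul hR.le h3 (by positivity) (le_trans (by positivity) hR.le)
    · have hc : ContinuousAt (fun R => ‖H.fInf.eval (H.z R)‖) (H.inclInf q) :=
        (H.fInf.continuous.continuousAt.comp (H.continuousAt_z q)).norm
      obtain ⟨C, hC⟩ := exists_eventually_lt hc
      refine ⟨C, (hU.and hC).mono ?_⟩
      rintro R ⟨hRm, hR⟩ p rfl hp
      obtain ⟨h0, Y, hY, hYp, h⟩ := hglue p hRm hp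
      have e1 : (fun t => chartAt ℂ (H.inclInf q) ((chartAt ℂ (H.incl p)).symm t)) =ᶠ[𝓝 p.1.1]
          fun t => t⁻¹ := by
        filter_upwards [h] with t ⟨_, _, r, hr1, hr2⟩
        rw [hr1, hne hq, hr2]
      refine ⟨(analyticAt_inv h0).congr e1.symm, ?_⟩
      rw [e1.deriv_eq, deriv_inv, norm_neg, norm_inv, norm_pow, hfInf _ h0, norm_mul, norm_pow]
      have h3 := hpow _ h0
      rw [z_incl] at hR
      calc _ = ‖H.fInf.eval p.1.1⁻¹‖ * (‖p.1.1‖ ^ (2 * g + 2) * (‖p.1.1‖ ^ 2)⁻¹ ^ 2) := by ring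
        _ ≤ _ := mul_le_mul hR.le h3 (by positivity) (le_trans (by positivity) hR.le)

theorem contDiffAt_chart {φ : H.Curve → ℂ} (hφ : ContMDiff 𝓘(ℝ, ℂ) 𝓘(ℝ, ℂ) ∞ φ) (Q : H.Curve) :
    ContDiffAt ℝ 2 (fun ζ => φ ((chartAt ℂ Q).symm ζ)) (chartAt ℂ Q Q) := by
  have h := (contMDiffAt_iff.1 (hφ Q)).2
  simp only [mfld_simps] at h
  exact (contDiffWithinAt_univ.1 h).of_le (WithTop.coe_le_coe.2 (le_top : (2 : ℕ∞) ≤ ⊤))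

/-- Near a point `R` in the domain of the chart at `Q`, the function `φ` in the coordinate
at `R` factors through the coordinate at `Q`. -/
theorem chart_eventuallyEq {φ : H.Curve → ℂ} {Q R : H.Curve} (hR : R ∈ (chartAt ℂ Q).source) :
    (fun t => φ ((chartAt ℂ R).symm t)) =ᶠ[𝓝 (chartAt ℂ R R)]
      fun t => φ ((chartAt ℂ Q).symm (chartAt ℂ Q ((chartAt ℂ R).symm t))) := by
  have h1 : ContinuousAt (chartAt ℂ R).symm (chartAt ℂ R R) :=
    (chartAt ℂ R).continuousAt_symm ((chartAt ℂ R).map_source (mem_chart_source ℂ R))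
  have h2 : (chartAt ℂ R).symm (chartAt ℂ R R) = R :=
    (chartAt ℂ R).left_inv (mem_chart_source ℂ R)
  have h3 := h1.eventually ((chartAt ℂ Q).open_source.mem_nhds (by rwa [h2]))
  filter_upwards [h3] with t ht
  rw [(chartAt ℂ Q).left_inv ht]

/-- In the coordinate at `Q` a smooth function has a locally bounded Laplacian, and by
`exists_bound_deriv_transition` the conformal factor absorbs the change to the coordinate `x`.
Compactness makes the bound uniform. -/
theorem exists_bound_laplaceBeltrami (hg : 1 ≤ g) {φ : H.Curve → ℂ}
    (hφ : ContMDiff 𝓘(ℝ, ℂ) 𝓘(ℝ, ℂ) ∞ φ) :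
    ∃ C : ℝ, ∀ Q ∈ H.regularPoints, ‖H.laplaceBeltrami φ Q‖ ≤ C := by
  have hloc : ∀ Q : H.Curve, ∃ C : ℝ, ∀ᶠ R in 𝓝 Q, R ∈ H.regularPoints →
      ‖H.laplaceBeltrami φ R‖ ≤ C := by
    intro Q
    obtain ⟨C, hC⟩ := H.exists_bound_deriv_transition hg Q
    have hsrc := mem_chart_source ℂ Q
    have hcQ : ContinuousAt (chartAt ℂ Q) Q := (chartAt ℂ Q).continuousAt hsrc
    have hd := contDiffAt_chart H hφ Q
    set ψ := fun ζ => φ ((chartAt ℂ Q).symm ζ)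
    have h1 : ∀ᶠ R in 𝓝 Q, ContDiffAt ℝ 2 ψ (chartAt ℂ Q R) :=
      hcQ.eventually (hd.eventually (by simp))
    have h2 : ContinuousAt (fun R => ‖Laplacian.laplacian ψ (chartAt ℂ Q R)‖) Q :=
      (ContinuousAt.comp (f := chartAt ℂ Q) hd.continuousAt_laplacian hcQ).norm
    obtain ⟨D, hD⟩ := exists_eventually_lt h2
    refine ⟨C * D, ?_⟩
    filter_upwards [hC, h1, hD,
      (chartAt ℂ Q).open_source.mem_nhds hsrc] with R hCR hdR hbR hRs
    rintro ⟨p, rfl, hp⟩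
    obtain ⟨hτ, hb⟩ := hCR p rfl hp
    obtain ⟨Y, -, -, he, -⟩ := H.exists_branch p hp
    have e1 := H.chart_eventuallyEq (φ := φ) hRs
    rw [he] at e1
    have hleft := (chartAt ℂ (H.incl p)).left_inv (mem_chart_source ℂ (H.incl p))
    rw [he] at hleft
    rw [laplaceBeltrami_incl _ _ _ hp, laplacian_congr e1,
      laplacian_comp_holomorphic (f := ψ)
        (τ := fun t => chartAt ℂ Q ((chartAt ℂ (H.incl p)).symm t)) hτ (by rwa [hleft]), hleft]
    have hσ := one_le_sigma hg (sq_nonneg ‖p.1.1‖)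
    rw [norm_mul, norm_smul, Complex.norm_real, Real.norm_of_nonneg (by positivity), norm_pow,
      norm_norm, ← mul_assoc, div_mul_eq_mul_div]
    have hb' := (div_le_iff₀ (by linarith : 0 < sigma g (‖p.1.1‖ ^ 2))).2 hb
    exact mul_le_mul hb' hbR.le (norm_nonneg _) (le_trans (by positivity) hb')
  choose C hC using hloc
  obtain ⟨T, hT⟩ := isCompact_univ.elim_nhds_subcover (fun Q => {R | R ∈ H.regularPoints →
      ‖H.laplaceBeltrami φ R‖ ≤ C Q}) fun Q _ => hC Q
  refine ⟨∑ Q ∈ T, |C Q|, fun R hR => ?_⟩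
  obtain ⟨Q, hQT, hQ⟩ := Set.mem_iUnion₂.1 (hT.2 (Set.mem_univ R))
  exact (hQ hR).trans ((le_abs_self _).trans
    (Finset.single_le_sum (f := fun Q => |C Q|) (fun _ _ => abs_nonneg _) hQT))

theorem continuousOn_laplaceBeltrami {φ : H.Curve → ℂ}
    (hg : 1 ≤ g) (hφ : ContMDiff 𝓘(ℝ, ℂ) 𝓘(ℝ, ℂ) ∞ φ) :
    ContinuousOn (H.laplaceBeltrami φ) H.regularPoints := by
  rintro _ ⟨q, rfl, hq⟩
  refine ContinuousAt.continuousWithinAt ?_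
  obtain ⟨hne, -, -, -⟩ := H.chartAt_incl_spec q
  have hd := contDiffAt_chart H hφ (H.incl q)
  rw [hne hq] at hd
  have hσ := one_le_sigma hg (sq_nonneg ‖q.1.1‖)
  have hc : ContinuousAt (fun R => ((‖H.f.eval (H.x R)‖ / sigma g (‖H.x R‖ ^ 2) : ℝ) : ℂ) *
      Laplacian.laplacian (fun t => φ ((chartAt ℂ (H.incl q)).symm t)) (H.x R)) (H.incl q) := by
    have hx := H.continuousAt_x q
    refine (Complex.continuous_ofReal.continuousAt.comp (ContinuousAt.div ?_ ?_ ?_)).mul ?_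
    · exact (H.f.continuous.continuousAt.comp hx).norm
    · exact ContinuousAt.comp (f := H.x) (g := fun t : ℂ => sigma g (‖t‖ ^ 2))
        (contDiff_sigma_norm_sq (n := 0) g).continuous.continuousAt hx
    · rw [x_incl]; linarith
    · exact ContinuousAt.comp (f := H.x) hd.continuousAt_laplacian hx
  refine hc.congr ?_
  have hsrc := mem_chart_source ℂ (H.incl q)
  filter_upwards [(chartAt ℂ (H.incl q)).open_source.mem_nhds hsrc,
    H.isOpen_regularPoints.mem_nhds ⟨q, rfl, hq⟩] with R hRs hR
  obtain ⟨p, rfl, hp⟩ := hR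
  obtain ⟨Y, -, -, he, h⟩ := H.exists_branch p hp
  have e1 := H.chart_eventuallyEq (φ := φ) hRs
  rw [he] at e1
  rw [laplaceBeltrami_incl _ _ _ hp, laplacian_congr e1, x_incl]
  congr 1
  refine (laplacian_congr ?_).symm
  filter_upwards [h] with t ⟨_, r, hr1, hr2⟩
  rw [hr1, hne hq, hr2]

end HyperellipticEquation

/-! ### Integration over the curve in the coordinate `x` -/

namespace HyperellipticEquation

variable {g : ℕ} (H : HyperellipticEquation g)

/-- The point of `C₀` whose image in `X` is `H.sheet s t`. -/
theorem exists_incl_eq_sheet (s : ℤˣ) (t : ℂ) : ∃ p : H.AffineZero, H.incl p = H.sheet s t ∧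
    p.1 = (t, ((s : ℤ) : ℂ) * H.f.eval t ^ (1 / 2 : ℂ)) := ⟨_, rfl, rfl⟩

theorem x_sheet (s : ℤˣ) (t : ℂ) : H.x (H.sheet s t) = t := rfl

theorem exists_regular_sheet (s : ℤˣ) {t : ℂ} (ht : H.f.eval t ≠ 0) :
    ∃ p : H.AffineZero, H.incl p = H.sheet s t ∧ p.1.1 = t ∧ p.1.2 ≠ 0 := by
  obtain ⟨p, h1, h2⟩ := H.exists_incl_eq_sheet s t
  have h3 : p.1.1 = t := congrArg Prod.fst h2
  refine ⟨p, h1, h3, fun h0 => ht ?_⟩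
  rw [← h3, ← p.2, h0]; ring

theorem measurable_x : Measurable H.x := by
  classical
  have h : (Set.range H.incl).piecewise H.x (fun _ => 0) = H.x := by
    ext Q
    by_cases hQ : Q ∈ Set.range H.incl
    · rw [Set.piecewise_eq_of_mem _ _ _ hQ]
    · rw [Set.piecewise_eq_of_notMem _ _ _ hQ]
      obtain ⟨q, hq, rfl⟩ := H.exists_inclInf_of_notMem hQ
      change 0 = q.1.1⁻¹
      rw [hq, inv_zero]
  rw [← h]
  refine ContinuousOn.measurable_piecewise ?_ continuousOn_const
    H.isOpenEmbedding_incl.isOpen_range.measurableSet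
  rintro _ ⟨p, rfl⟩
  exact (H.continuousAt_x p).continuousWithinAt

theorem measurable_y : Measurable H.y := by
  classical
  have h : (Set.range H.incl).piecewise H.y (fun _ => 0) = H.y := by
    ext Q
    by_cases hQ : Q ∈ Set.range H.incl
    · rw [Set.piecewise_eq_of_mem _ _ _ hQ]
    · rw [Set.piecewise_eq_of_notMem _ _ _ hQ]
      obtain ⟨q, hq, rfl⟩ := H.exists_inclInf_of_notMem hQ
      change 0 = q.1.2 * q.1.1⁻¹ ^ (g + 1)
      rw [hq, inv_zero, zero_pow (by omega), mul_zero]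
  rw [← h]
  refine ContinuousOn.measurable_piecewise ?_ continuousOn_const
    H.isOpenEmbedding_incl.isOpen_range.measurableSet
  rintro _ ⟨p, rfl⟩
  exact (H.continuousAt_y p).continuousWithinAt

/-- The section `sheet s` has the measurable left inverse `x`, so integrals against the area
measure need no measurability of the integrand to be computed in the plane. -/
theorem measurableEmbedding_sheet (s : ℤˣ) : MeasurableEmbedding (H.sheet s) := by
  refine .of_measurable_inverse (H.measurable_sheet s) ?_ H.measurable_x (H.x_sheet s)
  have : Set.range (H.sheet s) = Set.range H.incl ∩
      {Q | H.y Q = ((s : ℤ) : ℂ) * H.f.eval (H.x Q) ^ (1 / 2 : ℂ)} := by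
    ext Q
    constructor
    · rintro ⟨t, rfl⟩; exact ⟨⟨_, rfl⟩, rfl⟩
    · rintro ⟨⟨p, rfl⟩, hp⟩
      exact ⟨p.1.1, congrArg H.incl (Subtype.ext (Prod.ext rfl hp.symm))⟩
  rw [this]
  refine H.isOpenEmbedding_incl.isOpen_range.measurableSet.inter
    (measurableSet_eq_fun H.measurable_y (measurable_const.mul ?_))
  exact (H.f.continuous.measurable.comp H.measurable_x).pow_const _

/-- The density `ρ` of the area measure in the coordinate `x`. -/
def density (t : ℂ) : ℝ := sigma g (‖t‖ ^ 2) / ‖H.f.eval t‖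

theorem density_nonneg (t : ℂ) : 0 ≤ H.density t :=
  div_nonneg (Finset.sum_nonneg fun _ _ => by positivity) (norm_nonneg _)

theorem measurable_density : Measurable H.density := by
  have h : Measurable fun t => H.f.eval t := H.f.continuous.measurable
  have h2 : Measurable fun t : ℂ => sigma g (‖t‖ ^ 2) :=
    (contDiff_sigma_norm_sq (n := 0) g).continuous.measurable
  exact h2.div h.norm

theorem area_eq : H.area = ∑ s : ℤˣ, Measure.map (H.sheet s)
    (volume.withDensity fun t => ENNReal.ofReal (H.density t)) := rfl

theorem integrable_area_iff {h : H.Curve → ℂ} :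
    Integrable h H.area ↔ ∀ s, Integrable fun t => H.density t • h (H.sheet s t) := by
  rw [area_eq, integrable_finsetSum_measure]
  refine forall_congr' fun s => ?_
  rw [(H.measurableEmbedding_sheet s).integrable_map_iff,
    integrable_withDensity_iff_integrable_smul' H.measurable_density.ennreal_ofReal
      (.of_forall fun _ => ENNReal.ofReal_lt_top)]
  simp only [Finset.mem_univ, forall_const, ENNReal.toReal_ofReal (H.density_nonneg _),
    Function.comp_def]

theorem integral_area {h : H.Curve → ℂ} (hh : Integrable h H.area) :
    ∫ Q, h Q ∂H.area = ∫ t, ∑ s, H.density t • h (H.sheet s t) := by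
  rw [integral_finsetSum _ fun s _ => H.integrable_area_iff.1 hh s]
  rw [area_eq, integrable_finsetSum_measure] at hh
  rw [area_eq, integral_finsetSum_measure hh]
  refine Finset.sum_congr rfl fun s _ => ?_
  rw [(H.measurableEmbedding_sheet s).integral_map,
    integral_withDensity_eq_integral_toReal_smul H.measurable_density.ennreal_ofReal
      (.of_forall fun _ => ENNReal.ofReal_lt_top)]
  simp only [ENNReal.toReal_ofReal (H.density_nonneg _)]

theorem area_singleton (Q : H.Curve) : H.area {Q} = 0 := by
  rw [area, Measure.finsetSum_apply]
  refine Finset.sum_eq_zero fun s _ => ?_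
  rw [(H.measurableEmbedding_sheet s).map_apply]
  refine withDensity_absolutelyContinuous _ _ (measure_mono_null (t := {H.x Q}) ?_ (by simp))
  intro t ht
  rw [Set.mem_singleton_iff, ← show H.sheet s t = Q from ht, x_sheet]

/-! ### The density is dominated by the weight of simple poles at the roots -/

/-- The roots of `f`. -/
def rootSet : Finset ℂ := H.f.roots.toFinset

theorem mem_rootSet {t : ℂ} : t ∈ H.rootSet ↔ H.f.eval t = 0 := by
  rw [rootSet, Multiset.mem_toFinset, Polynomial.mem_roots H.monic.ne_zero, Polynomial.IsRoot.def]

theorem nodup_roots : H.f.roots.Nodup :=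
  Polynomial.nodup_roots (PerfectField.separable_iff_squarefree.2 H.squarefree)

theorem card_rootSet : H.rootSet.card = H.f.natDegree := by
  rw [rootSet, Multiset.toFinset_card_of_nodup H.nodup_roots]
  exact (IsAlgClosed.splits H.f).natDegree_eq_card_roots.symm

theorem rootSet_nonempty : H.rootSet.Nonempty := by
  rw [← Finset.card_pos, H.card_rootSet]
  have := H.natDegree_eq; omega

theorem eval_f_eq_prod (t : ℂ) : H.f.eval t = ∏ b ∈ H.rootSet, (t - b) := by
  have h := (IsAlgClosed.splits H.f).eq_prod_roots_of_monic H.monic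
  conv_lhs => rw [h]
  rw [Polynomial.eval_multiset_prod, Multiset.map_map, rootSet, Finset.prod,
    Multiset.toFinset_val, H.nodup_roots.dedup]
  simp

/-- Of two distinct points of `S`, the one farther from `t` has a distance comparable to `1 + |t|`. -/
theorem exists_one_add_norm_le (S : Finset ℂ) : ∃ K : ℝ, 0 ≤ K ∧ ∀ b ∈ S, ∀ b' ∈ S, b ≠ b' →
    ∀ t : ℂ, ‖t - b'‖ ≤ ‖t - b‖ → 1 + ‖t‖ ≤ K * ‖t - b‖ := by
  refine ⟨∑ q ∈ S.offDiag, (2 * (1 + ‖q.1‖) / ‖q.1 - q.2‖ + 1),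
    Finset.sum_nonneg fun _ _ => by positivity, fun b hb b' hb' hne t ht => ?_⟩
  have h1 : 2 * (1 + ‖b‖) / ‖b - b'‖ + 1 ≤
      ∑ q ∈ S.offDiag, (2 * (1 + ‖q.1‖) / ‖q.1 - q.2‖ + 1) :=
    Finset.single_le_sum (f := fun q : ℂ × ℂ => 2 * (1 + ‖q.1‖) / ‖q.1 - q.2‖ + 1) (a := (b, b'))
      (fun _ _ => by positivity) (Finset.mem_offDiag.2 ⟨hb, hb', hne⟩)
  refine le_trans ?_ (mul_le_mul_of_nonneg_right h1 (norm_nonneg _))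
  have h2 : 0 < ‖b - b'‖ := norm_pos_iff.2 (sub_ne_zero.2 hne)
  have h3 : ‖b - b'‖ ≤ 2 * ‖t - b‖ := by
    have := norm_sub_le (t - b') (t - b)
    rw [sub_sub_sub_cancel_left] at this
    linarith
  have h4 : ‖t‖ ≤ ‖b‖ + ‖t - b‖ := by
    have := norm_add_le b (t - b)
    rwa [add_sub_cancel] at this
  have h5 : (1 + ‖b‖) * ‖b - b'‖ ≤ (1 + ‖b‖) * (2 * ‖t - b‖) :=
    mul_le_mul_of_nonneg_left h3 (by positivity)
  have h6 : 1 + ‖b‖ ≤ 2 * (1 + ‖b‖) / ‖b - b'‖ * ‖t - b‖ := by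
    rw [div_mul_eq_mul_div, le_div_iff₀ h2]; linarith
  linarith

theorem sigma_le_pow (g : ℕ) (t : ℂ) :
    sigma g (‖t‖ ^ 2) * (1 + ‖t‖) ^ 2 ≤ g * (1 + ‖t‖) ^ (2 * g) := by
  have h1 : 1 ≤ 1 + ‖t‖ := by linarith [norm_nonneg t]
  rw [sigma, Finset.sum_mul]
  refine (Finset.sum_le_card_nsmul _ _ ((1 + ‖t‖) ^ (2 * g)) fun i hi => ?_).trans_eq (by simp)
  have hi := Finset.mem_range.1 hi
  calc (‖t‖ ^ 2) ^ i * (1 + ‖t‖) ^ 2 ≤ ((1 + ‖t‖) ^ 2) ^ i * (1 + ‖t‖) ^ 2 := by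
        gcongr; linarith [norm_nonneg t]
    _ = (1 + ‖t‖) ^ (2 * i + 2) := by rw [← pow_mul, ← pow_add]
    _ ≤ _ := pow_le_pow_right₀ h1 (by omega)

/-- The root nearest to `t` produces the simple pole; the other at least `2g` factors of `f` are
comparable to `1 + |t|`, while `σ_g(|t|²)` is of order `2g - 2`. -/
theorem exists_density_le : ∃ C : ℝ, 0 ≤ C ∧ ∀ t, H.density t ≤ C * poleWeight H.rootSet t := by
  obtain ⟨K, hK0, hK⟩ := exists_one_add_norm_le H.rootSet
  set d := H.rootSet.card - 1
  have hd : 2 * g ≤ d := by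
    have h1 := H.natDegree_eq
    have h2 := H.card_rootSet
    omega
  refine ⟨g * K ^ d, by positivity, fun t => ?_⟩
  have hw := poleWeight_nonneg H.rootSet t
  by_cases ht : H.f.eval t = 0
  · rw [density, ht, norm_zero, div_zero]; positivity
  obtain ⟨b, hb, hmin⟩ := Finset.exists_min_image H.rootSet (fun b => ‖t - b‖) H.rootSet_nonempty
  have hbt : 0 < ‖t - b‖ := by
    rw [norm_pos_iff, sub_ne_zero]
    rintro rfl
    exact ht (H.mem_rootSet.1 hb)
  -- All roots but the nearest one have distance at least `(1 + |t|) / K`.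
  have h1 : (1 + ‖t‖) ^ d ≤ K ^ d * ∏ b' ∈ H.rootSet.erase b, ‖t - b'‖ := by
    have hc : (H.rootSet.erase b).card = d := Finset.card_erase_of_mem hb
    rw [← hc, ← Finset.prod_const, ← Finset.prod_const, ← Finset.prod_mul_distrib]
    refine Finset.prod_le_prod (fun _ _ => by positivity) fun b' hb' => ?_
    obtain ⟨hne, hb'S⟩ := Finset.mem_erase.1 hb'
    exact hK b' hb'S b hb hne t (hmin b' hb'S)
  have h2 : ‖H.f.eval t‖ = ‖t - b‖ * ∏ b' ∈ H.rootSet.erase b, ‖t - b'‖ := by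
    rw [eval_f_eq_prod, norm_prod, Finset.mul_prod_erase _ (fun b' => ‖t - b'‖) hb]
  have h3 : ‖t - b‖⁻¹ * ((1 + ‖t‖) ^ 2)⁻¹ ≤ poleWeight H.rootSet t :=
    Finset.single_le_sum (f := fun b => ‖t - b‖⁻¹ * ((1 + ‖t‖) ^ 2)⁻¹)
      (fun _ _ => by positivity) hb
  refine le_trans ?_ (mul_le_mul_of_nonneg_left h3 (by positivity))
  have h0 : 0 < ‖H.f.eval t‖ := norm_pos_iff.2 ht
  have ht1 : 1 ≤ 1 + ‖t‖ := by linarith [norm_nonneg t]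
  rw [density, div_le_iff₀ h0, h2]
  have h4 := sigma_le_pow g t
  have h5 : (1 + ‖t‖) ^ (2 * g) ≤ (1 + ‖t‖) ^ d := pow_le_pow_right₀ ht1 hd
  have h6 : sigma g (‖t‖ ^ 2) * (1 + ‖t‖) ^ 2 ≤
      g * (K ^ d * ∏ b' ∈ H.rootSet.erase b, ‖t - b'‖) :=
    h4.trans (mul_le_mul_of_nonneg_left (h5.trans h1) (by positivity))
  rw [← le_div_iff₀ (by positivity)] at h6
  refine h6.trans_eq ?_
  field_simp

end HyperellipticEquation

/-! ### The sum of a function over the fibres of `x` -/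

namespace HyperellipticEquation

variable {g : ℕ} (H : HyperellipticEquation g)

/-- The sum of `φ` over the two points of the fibre of `x` over `t`, a point with `y = 0` being
counted twice. -/
def trace (φ : H.Curve → ℂ) (t : ℂ) : ℂ := ∑ s, φ (H.sheet s t)

theorem sum_units_int {M : Type*} [AddCommMonoid M] (h : ℤˣ → M) : ∑ s, h s = h 1 + h (-1) := by
  rw [UnitsInt.univ, Finset.sum_pair (by decide)]

theorem invol_incl (p : H.AffineZero) :
    H.invol (H.incl p) = H.incl ⟨(p.1.1, -p.1.2), by rw [neg_sq]; exact p.2⟩ := rfl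

theorem invol_inclInf (q : H.AffineInf) :
    H.invol (H.inclInf q) = H.inclInf ⟨(q.1.1, -q.1.2), by rw [neg_sq]; exact q.2⟩ := rfl

theorem invol_invol (Q : H.Curve) : H.invol (H.invol Q) = Q := by
  rcases H.mem_range_or Q with ⟨p, rfl⟩ | ⟨q, -, rfl⟩
  · rw [invol_incl, invol_incl]
    exact congrArg H.incl (Subtype.ext (Prod.ext rfl (neg_neg _)))
  · rw [invol_inclInf, invol_inclInf]
    exact congrArg H.inclInf (Subtype.ext (Prod.ext rfl (neg_neg _)))

theorem cpow_half_sq (c : ℂ) : (c ^ (1 / 2 : ℂ)) ^ 2 = c := by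
  rw [one_div]; exact Complex.cpow_ofNat_inv_pow _ 2

theorem exists_unit_eq_of_sq_eq {Y c : ℂ} (h : Y ^ 2 = c) :
    ∃ s : ℤˣ, Y = ((s : ℤ) : ℂ) * c ^ (1 / 2 : ℂ) := by
  rw [← cpow_half_sq c, sq_eq_sq_iff_eq_or_eq_neg] at h
  rcases h with h | h
  · exact ⟨1, by simpa using h⟩
  · exact ⟨-1, by simpa using h⟩

theorem exists_sheet_eq_incl (p : H.AffineZero) : ∃ s, H.sheet s p.1.1 = H.incl p := by
  obtain ⟨s, hs⟩ := exists_unit_eq_of_sq_eq p.2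
  exact ⟨s, congrArg H.incl (Subtype.ext (Prod.ext rfl hs.symm))⟩

theorem invol_sheet (s : ℤˣ) (t : ℂ) : H.invol (H.sheet s t) = H.sheet (-s) t := by
  refine congrArg H.incl (Subtype.ext (Prod.ext rfl ?_))
  change -(_ * _) = _ * _
  simp

theorem trace_eq_sheet (φ : H.Curve → ℂ) (s : ℤˣ) (t : ℂ) :
    H.trace φ t = φ (H.sheet s t) + φ (H.sheet (-s) t) := by
  rw [trace, sum_units_int]
  rcases Int.units_eq_one_or s with rfl | rfl
  · rfl
  · rw [neg_neg, add_comm]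

theorem trace_eq (φ : H.Curve → ℂ) (p : H.AffineZero) :
    H.trace φ p.1.1 = φ (H.incl p) + φ (H.invol (H.incl p)) := by
  obtain ⟨s, hs⟩ := H.exists_sheet_eq_incl p
  rw [← hs, invol_sheet, trace_eq_sheet _ _ s]

theorem measurable_trace {φ : H.Curve → ℂ} (hφ : Continuous φ) : Measurable (H.trace φ) := by
  unfold trace
  exact Finset.measurable_sum _ fun s _ => hφ.measurable.comp (H.measurable_sheet s)

/-- Over a neighbourhood of a point that is not a root, the two points of the fibre are the values
of the inverses of the charts at the two points over that point. -/
theorem trace_eventuallyEq (φ : H.Curve → ℂ) {t : ℂ} (ht : H.f.eval t ≠ 0) :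
    H.trace φ =ᶠ[𝓝 t] fun r => ∑ s, φ ((chartAt ℂ (H.sheet s t)).symm r) := by
  obtain ⟨p, hp, hpt, hp0⟩ := H.exists_regular_sheet 1 ht
  obtain ⟨q, hq, hqt, hq0⟩ := H.exists_regular_sheet (-1) ht
  obtain ⟨Y, hY, hYp, -, h⟩ := H.exists_branch p hp0
  obtain ⟨V, hV, hVq, -, h'⟩ := H.exists_branch q hq0
  rw [hpt] at h hY hYp
  rw [hqt] at h' hV hVq
  have hVY : V t = -Y t := by
    have e : H.incl q = H.invol (H.incl p) := by rw [hp, hq, invol_sheet]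
    rw [hVq, hYp]
    exact congrArg H.y e
  -- The two holomorphic square roots of `f` remain opposite to each other near `t`.
  have hne : ∀ᶠ r in 𝓝 t, V r - Y r ≠ 0 := by
    refine (hV.continuousAt.sub hY.continuousAt).eventually_ne ?_
    have h2 : (V - Y) t = -(2 * p.1.2) := by rw [Pi.sub_apply, hVY, hYp]; ring
    rw [h2]
    exact neg_ne_zero.2 (mul_ne_zero two_ne_zero hp0)
  filter_upwards [h, h', hne] with r ⟨_, a, ha, ha2⟩ ⟨_, b, hb, hb2⟩ hr
  rw [sum_units_int, ← hp, ← hq, ha, hb]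
  have har : a.1.1 = r := congrArg Prod.fst ha2
  have hab : H.incl b = H.invol (H.incl a) := by
    rw [invol_incl]
    refine congrArg H.incl (Subtype.ext ?_)
    have h1 := a.2
    have h2 := b.2
    rw [ha2] at h1
    rw [hb2] at h2
    have h3 : (V r - Y r) * (V r + Y r) = 0 := by linear_combination h2 - h1
    have h4 := (mul_eq_zero.1 h3).resolve_left hr
    have h5 : V r = -Y r := eq_neg_of_add_eq_zero_left h4
    rw [hb2]
    change (r, V r) = (a.1.1, -a.1.2)
    rw [ha2, h5]
  rw [hab, ← trace_eq, har]

theorem chartAt_sheet_apply (s : ℤˣ) {t : ℂ} (ht : H.f.eval t ≠ 0) :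
    chartAt ℂ (H.sheet s t) (H.sheet s t) = t := by
  obtain ⟨p, hp, hpt, hp0⟩ := H.exists_regular_sheet s ht
  obtain ⟨Y, -, -, h, -⟩ := H.exists_branch p hp0
  rw [← hp, h, hpt]

theorem contDiffAt_chart_sheet {φ : H.Curve → ℂ} (hφ : ContMDiff 𝓘(ℝ, ℂ) 𝓘(ℝ, ℂ) ∞ φ)
    (s : ℤˣ) {t : ℂ} (ht : H.f.eval t ≠ 0) :
    ContDiffAt ℝ 2 (fun r => φ ((chartAt ℂ (H.sheet s t)).symm r)) t := by
  have h := H.contDiffAt_chart hφ (H.sheet s t)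
  rwa [chartAt_sheet_apply _ _ ht] at h

theorem contDiffAt_trace {φ : H.Curve → ℂ} (hφ : ContMDiff 𝓘(ℝ, ℂ) 𝓘(ℝ, ℂ) ∞ φ)
    {t : ℂ} (ht : H.f.eval t ≠ 0) : ContDiffAt ℝ 2 (H.trace φ) t := by
  refine ContDiffAt.congr_of_eventuallyEq ?_ (H.trace_eventuallyEq φ ht)
  exact ContDiffAt.sum fun s _ => H.contDiffAt_chart_sheet hφ s ht

/-- The Laplacian of the fibre sum is the fibre sum of the Laplace-Beltrami operator, up to the
conformal factor. -/
theorem laplacian_trace (hg : 1 ≤ g) {φ : H.Curve → ℂ} (hφ : ContMDiff 𝓘(ℝ, ℂ) 𝓘(ℝ, ℂ) ∞ φ)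
    {t : ℂ} (ht : H.f.eval t ≠ 0) :
    Laplacian.laplacian (H.trace φ) t =
      ∑ s, H.density t • H.laplaceBeltrami φ (H.sheet s t) := by
  have e : ∀ s, H.density t • H.laplaceBeltrami φ (H.sheet s t) =
      Laplacian.laplacian (fun r => φ ((chartAt ℂ (H.sheet s t)).symm r)) t := by
    intro s
    obtain ⟨p, hp, hpt, hp0⟩ := H.exists_regular_sheet s ht
    rw [← hp, laplaceBeltrami_incl _ _ _ hp0, hpt, Complex.real_smul, ← mul_assoc,
      ← Complex.ofReal_mul, density]
    have h1 := one_le_sigma hg (sq_nonneg ‖t‖)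
    have h2 : 0 < ‖H.f.eval t‖ := norm_pos_iff.2 ht
    rw [div_mul_div_cancel₀ h2.ne', div_self (by linarith), Complex.ofReal_one, one_mul]
  have e2 : H.trace φ =ᶠ[𝓝 t] (fun r => φ ((chartAt ℂ (H.sheet 1 t)).symm r)) +
      fun r => φ ((chartAt ℂ (H.sheet (-1) t)).symm r) := by
    filter_upwards [H.trace_eventuallyEq φ ht] with r hr
    rw [hr, sum_units_int]
    rfl
  rw [laplacian_congr e2, (H.contDiffAt_chart_sheet hφ 1 ht).laplacian_add
    (H.contDiffAt_chart_sheet hφ (-1) ht), sum_units_int, e, e]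

theorem isTame_trace (hg : 1 ≤ g) {φ : H.Curve → ℂ} (hφ : ContMDiff 𝓘(ℝ, ℂ) 𝓘(ℝ, ℂ) ∞ φ) :
    IsTame H.rootSet (H.trace φ) where
  nonempty := H.rootSet_nonempty
  measurable := H.measurable_trace hφ.continuous
  bounded := by
    obtain ⟨M, hM⟩ := isCompact_univ.exists_bound_of_continuousOn hφ.continuous.continuousOn
    refine ⟨M + M, fun t => ?_⟩
    rw [trace, sum_units_int]
    exact (norm_add_le _ _).trans (add_le_add (hM _ trivial) (hM _ trivial))
  contDiffAt t ht := H.contDiffAt_trace hφ (mt H.mem_rootSet.2 ht)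
  laplacian_le := by
    obtain ⟨N, hN⟩ := H.exists_bound_laplaceBeltrami hg hφ
    obtain ⟨C, hC0, hC⟩ := H.exists_density_le
    refine ⟨(N + N) * C, fun t ht => ?_⟩
    have ht0 : H.f.eval t ≠ 0 := mt H.mem_rootSet.2 ht
    have hb : ∀ s, ‖H.density t • H.laplaceBeltrami φ (H.sheet s t)‖ ≤
        C * poleWeight H.rootSet t * N := by
      intro s
      obtain ⟨p, hp, -, hp0⟩ := H.exists_regular_sheet s ht0
      rw [norm_smul, Real.norm_of_nonneg (H.density_nonneg t)]
      exact mul_le_mul (hC t) (hN _ ⟨p, hp, hp0⟩) (norm_nonneg _)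
        (mul_nonneg hC0 (poleWeight_nonneg _ _))
    rw [H.laplacian_trace hg hφ ht0, sum_units_int]
    refine (norm_add_le _ _).trans ((add_le_add (hb 1) (hb (-1))).trans_eq ?_)
    ring

/-- At a root the square root `√f` is continuous, whatever its branch. -/
theorem continuousAt_sheet (s : ℤˣ) {a : ℂ} (ha : H.f.eval a = 0) :
    ContinuousAt (H.sheet s) a := by
  refine H.continuous_incl.continuousAt.comp
    (Topology.IsInducing.subtypeVal.continuousAt_iff.2 ?_)
  refine continuousAt_id.prodMk (continuousAt_const.mul ?_)
  refine ContinuousAt.comp (f := fun t => H.f.eval t) (g := fun c : ℂ => c ^ (1 / 2 : ℂ))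
    (Complex.continuousAt_cpow_const_of_re_pos ?_ ?_) H.f.continuous.continuousAt
  · rw [ha]; simp
  · norm_num

theorem continuousAt_trace {φ : H.Curve → ℂ} (hφ : ContMDiff 𝓘(ℝ, ℂ) 𝓘(ℝ, ℂ) ∞ φ) (a : ℂ) :
    ContinuousAt (H.trace φ) a := by
  by_cases ha : H.f.eval a = 0
  · have h : ∀ s, ContinuousAt (fun t => φ (H.sheet s t)) a := fun s =>
      hφ.continuous.continuousAt.comp (H.continuousAt_sheet s ha)
    exact tendsto_finsetSum _ fun s _ => h s
  · exact (H.contDiffAt_trace hφ ha).continuousAt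

/-- The sections `z ↦ (z, ±√fInf(z))` of the coordinate `z`. -/
def sheetInf (s : ℤˣ) (z : ℂ) : H.Curve :=
  H.inclInf ⟨(z, ((s : ℤ) : ℂ) * H.fInf.eval z ^ (1 / 2 : ℂ)), by
    have hs : (((s : ℤ) : ℂ)) ^ 2 = 1 := by
      rw [← Int.cast_pow, ← Units.val_pow_eq_pow_val, Int.units_sq]; simp
    change (((s : ℤ) : ℂ) * H.fInf.eval z ^ (1 / 2 : ℂ)) ^ 2 = H.fInf.eval z
    rw [mul_pow, cpow_half_sq, hs, one_mul]⟩

theorem invol_sheetInf (s : ℤˣ) (t : ℂ) : H.invol (H.sheetInf s t) = H.sheetInf (-s) t := by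
  refine congrArg H.inclInf (Subtype.ext (Prod.ext rfl ?_))
  change -(_ * _) = _ * _
  simp

theorem exists_sheetInf_eq_inclInf (q : H.AffineInf) :
    ∃ s, H.sheetInf s q.1.1 = H.inclInf q := by
  obtain ⟨s, hs⟩ := exists_unit_eq_of_sq_eq q.2
  exact ⟨s, congrArg H.inclInf (Subtype.ext (Prod.ext rfl hs.symm))⟩

theorem eval_fInf_zero :
    (H.f.natDegree = 2 * g + 1 ∧ H.fInf.eval 0 = 0) ∨
      (H.f.natDegree = 2 * g + 2 ∧ H.fInf.eval 0 = 1) := by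
  have h0 : H.fInf.eval 0 = H.f.coeff (2 * g + 2) := by
    rw [← Polynomial.coeff_zero_eq_eval_zero, fInf, Polynomial.coeff_reflect]
    simp [Polynomial.revAt_le]
  rcases H.natDegree_eq with h | h
  · exact Or.inl ⟨h, by rw [h0, Polynomial.coeff_eq_zero_of_natDegree_lt (by omega)]⟩
  · exact Or.inr ⟨h, by rw [h0, ← h]; exact H.monic⟩

theorem continuousAt_sheetInf (s : ℤˣ) : ContinuousAt (H.sheetInf s) 0 := by
  refine H.continuous_inclInf.continuousAt.comp
    (Topology.IsInducing.subtypeVal.continuousAt_iff.2 ?_)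
  refine continuousAt_id.prodMk (continuousAt_const.mul ?_)
  refine ContinuousAt.comp (f := fun t => H.fInf.eval t) (g := fun c : ℂ => c ^ (1 / 2 : ℂ))
    (Complex.continuousAt_cpow_const_of_re_pos ?_ ?_) H.fInf.continuous.continuousAt
  -- The value `fInf(0)` is `0` or `1`, off the branch cut of the square root.
  · rcases H.eval_fInf_zero with ⟨-, h⟩ | ⟨-, h⟩ <;> rw [h] <;> simp
  · norm_num

theorem trace_eq_sheetInf (φ : H.Curve → ℂ) {t : ℂ} (ht : t ≠ 0) :
    H.trace φ t = φ (H.sheetInf 1 t⁻¹) + φ (H.sheetInf (-1) t⁻¹) := by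
  obtain ⟨p, hp⟩ : ∃ p : H.AffineZero, H.incl p = H.sheetInf 1 t⁻¹ :=
    ⟨_, H.incl_eq_inclInf.2 (H.glue_toZero _ (inv_ne_zero ht))⟩
  have hpt : p.1.1 = t := by
    rw [← x_incl, hp]
    exact inv_inv t
  rw [← invol_sheetInf, ← hp, ← hpt, trace_eq]

theorem tendsto_trace_cocompact {φ : H.Curve → ℂ} (hφ : Continuous φ) {q : H.AffineInf}
    (hq : q.1.1 = 0) : Filter.Tendsto (H.trace φ) (Filter.cocompact ℂ)
      (𝓝 (φ (H.inclInf q) + φ (H.invol (H.inclInf q)))) := by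
  have h0 : φ (H.inclInf q) + φ (H.invol (H.inclInf q)) =
      φ (H.sheetInf 1 0) + φ (H.sheetInf (-1) 0) := by
    obtain ⟨s, hs⟩ := H.exists_sheetInf_eq_inclInf q
    rw [← hs, invol_sheetInf, hq]
    rcases Int.units_eq_one_or s with rfl | rfl
    · rfl
    · rw [neg_neg, add_comm]
  have hs : ∀ s, Filter.Tendsto (fun t : ℂ => φ (H.sheetInf s t⁻¹)) (Filter.cocompact ℂ)
      (𝓝 (φ (H.sheetInf s 0))) := fun s =>
    (hφ.tendsto _).comp ((H.continuousAt_sheetInf s).tendsto.comp (by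
      rw [← Metric.cobounded_eq_cocompact]; exact Filter.tendsto_inv₀_cobounded))
  rw [h0]
  refine ((hs 1).add (hs (-1))).congr' ?_
  have hne : ∀ᶠ t : ℂ in Filter.cocompact ℂ, t ≠ 0 := by
    have := (Set.finite_singleton (0 : ℂ)).isCompact.compl_mem_cocompact
    filter_upwards [this] with t ht using ht
  filter_upwards [hne] with t ht
  rw [H.trace_eq_sheetInf φ ht]

end HyperellipticEquation

/-! ### The functions `F_P` and `u_P` -/

namespace HyperellipticEquation

variable {g : ℕ} (H : HyperellipticEquation g)

theorem den_pos (hg : 1 ≤ g) (t : ℂ) : 0 < den g t :=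
  Real.rpow_pos_of_pos (mul_pos (by linarith [one_le_sigma hg (sq_nonneg ‖t‖)]) (by positivity)) _

theorem den_pow (hg : 1 ≤ g) (t : ℂ) :
    den g t ^ (2 * g + 2) = sigma g (‖t‖ ^ 2) * (1 + ‖t‖ ^ 2) ^ 2 := by
  have h := one_le_sigma hg (sq_nonneg ‖t‖)
  rw [den, ← Real.rpow_natCast, ← Real.rpow_mul (by positivity)]
  push_cast
  rw [one_div_mul_cancel (by positivity), Real.rpow_one]

/-- This is what makes the formulas for `F_P` in `x` and in `z` agree. -/
theorem den_inv (hg : 1 ≤ g) {t : ℂ} (ht : t ≠ 0) : den g t⁻¹ = den g t / ‖t‖ := by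
  have hn : 0 < ‖t‖ := norm_pos_iff.2 ht
  refine (pow_left_inj₀ (den_pos hg _).le (div_pos (den_pos hg t) hn).le
    (by omega : 2 * g + 2 ≠ 0)).1 ?_
  rw [div_pow, den_pow hg, den_pow hg, norm_inv, inv_pow, sigma_inv hg (by positivity)]
  obtain ⟨k, rfl⟩ := Nat.exists_eq_add_of_le' hg
  rw [Nat.add_sub_cancel]
  field_simp
  ring

theorem F_incl_incl (p q : H.AffineZero) :
    H.F (H.incl p) (H.incl q) = ‖q.1.1 - p.1.1‖ / den g q.1.1 := by
  rw [F, if_pos ⟨p, rfl⟩, if_pos ⟨q, rfl⟩]; rfl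

theorem F_inclInf_incl {p : H.AffineInf} (hp : p.1.1 = 0) (q : H.AffineZero) :
    H.F (H.inclInf p) (H.incl q) = 1 / den g q.1.1 := by
  rw [F, if_neg (H.inclInf_notMem_range hp), if_pos ⟨q, rfl⟩]; rfl

theorem F_incl_inclInf (hg : 1 ≤ g) (p : H.AffineZero) (q : H.AffineInf) :
    H.F (H.incl p) (H.inclInf q) = ‖1 - q.1.1 * p.1.1‖ / den g q.1.1 := by
  by_cases hq : q.1.1 = 0
  · rw [F, if_pos ⟨p, rfl⟩, if_neg (H.inclInf_notMem_range hq)]; rfl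
  · rw [← H.incl_eq_inclInf.2 (H.glue_toZero q hq), F_incl_incl]
    change ‖q.1.1⁻¹ - p.1.1‖ / den g q.1.1⁻¹ = _
    have hn : 0 < ‖q.1.1‖ := norm_pos_iff.2 hq
    rw [den_inv hg hq, div_div_eq_mul_div, ← norm_mul, sub_mul, inv_mul_cancel₀ hq, mul_comm p.1.1]

theorem x_invol (Q : H.Curve) : H.x (H.invol Q) = H.x Q := by
  rcases H.mem_range_or Q with ⟨p, rfl⟩ | ⟨q, -, rfl⟩ <;> rfl

theorem z_invol (Q : H.Curve) : H.z (H.invol Q) = H.z Q := by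
  rcases H.mem_range_or Q with ⟨p, rfl⟩ | ⟨q, -, rfl⟩ <;> rfl

theorem invol_mem_range (Q : H.Curve) :
    H.invol Q ∈ Set.range H.incl ↔ Q ∈ Set.range H.incl := by
  have h : ∀ Q, Q ∈ Set.range H.incl → H.invol Q ∈ Set.range H.incl := by
    rintro _ ⟨p, rfl⟩; exact ⟨_, rfl⟩
  exact ⟨fun hQ => by simpa only [invol_invol] using h _ hQ, h Q⟩

theorem F_invol_right (P Q : H.Curve) : H.F P (H.invol Q) = H.F P Q := by
  have h := H.invol_mem_range Q
  by_cases hQ : Q ∈ Set.range H.incl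
  · simp only [F, hQ, h.2 hQ, if_true, x_invol]
  · simp only [F, hQ, mt h.1 hQ, if_false, z_invol]

theorem F_invol_left (P Q : H.Curve) : H.F (H.invol P) Q = H.F P Q := by
  have h := H.invol_mem_range P
  by_cases hP : P ∈ Set.range H.incl
  · simp only [F, hP, h.2 hP, if_true, x_invol]
  · simp only [F, hP, mt h.1 hP, if_false]

theorem eq_or_eq_invol_of_x {p q : H.AffineZero} (h : q.1.1 = p.1.1) :
    H.incl q = H.incl p ∨ H.incl q = H.invol (H.incl p) := by
  have h2 : q.1.2 ^ 2 = p.1.2 ^ 2 := by rw [q.2, p.2, h]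
  rcases sq_eq_sq_iff_eq_or_eq_neg.1 h2 with h2 | h2
  · exact Or.inl (congrArg H.incl (Subtype.ext (Prod.ext h h2)))
  · exact Or.inr (congrArg H.incl (Subtype.ext (Prod.ext h h2)))

theorem eq_or_eq_invol_of_z {p q : H.AffineInf} (h : q.1.1 = p.1.1) :
    H.inclInf q = H.inclInf p ∨ H.inclInf q = H.invol (H.inclInf p) := by
  have h2 : q.1.2 ^ 2 = p.1.2 ^ 2 := by rw [q.2, p.2, h]
  rcases sq_eq_sq_iff_eq_or_eq_neg.1 h2 with h2 | h2
  · exact Or.inl (congrArg H.inclInf (Subtype.ext (Prod.ext h h2)))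
  · exact Or.inr (congrArg H.inclInf (Subtype.ext (Prod.ext h h2)))

theorem F_pos (hg : 1 ≤ g) {P Q : H.Curve} (h1 : Q ≠ P) (h2 : Q ≠ H.invol P) : 0 < H.F P Q := by
  rcases H.mem_range_or P with ⟨p, rfl⟩ | ⟨p, hp, rfl⟩ <;>
    rcases H.mem_range_or Q with ⟨q, rfl⟩ | ⟨q, hq, rfl⟩
  · rw [F_incl_incl]
    refine div_pos (norm_pos_iff.2 (sub_ne_zero.2 fun h => ?_)) (den_pos hg _)
    rcases H.eq_or_eq_invol_of_x h with h | h
    · exact h1 h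
    · exact h2 h
  · rw [F_incl_inclInf _ hg, hq, zero_mul, sub_zero, norm_one]
    exact div_pos one_pos (den_pos hg _)
  · rw [F_inclInf_incl _ hp]
    exact div_pos one_pos (den_pos hg _)
  · rcases H.eq_or_eq_invol_of_z (hq.trans hp.symm) with h | h
    · exact absurd h h1
    · exact absurd h h2

theorem contDiff_log_den (hg : 1 ≤ g) {n : WithTop ℕ∞} :
    ContDiff ℝ n fun t => Real.log (den g t) := by
  simp only [log_den hg]
  exact (contDiff_const.mul ((contDiff_log_sigma hg).sub
    (contDiff_const.mul (contDiff_half_log 0 one_pos)))).add (contDiff_half_log 0 one_pos)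

theorem contDiffAt_log_norm_comp {h : ℂ → ℂ} (hh : ContDiff ℝ ∞ h) {t : ℂ} (ht : h t ≠ 0) :
    ContDiffAt ℝ ∞ (fun t => Real.log ‖h t‖) t :=
  (hh.contDiffAt.norm ℝ ht).log (norm_ne_zero_iff.2 ht)

theorem contMDiffAt_x (p : H.AffineZero) :
    ContMDiffAt 𝓘(ℝ, ℂ) 𝓘(ℝ, ℂ) ∞ H.x (H.incl p) := by
  obtain ⟨-, -, -, X, Y, h⟩ := H.chartAt_incl_spec p
  rw [contMDiffAt_iff]
  refine ⟨H.continuousAt_x p, ?_⟩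
  simp only [mfld_simps]
  have ht := (chartAt ℂ (H.incl p)).map_source (mem_chart_source ℂ (H.incl p))
  refine ContDiffAt.contDiffWithinAt
    (((h _ ht).1.contDiffAt.restrict_scalars ℝ).congr_of_eventuallyEq ?_)
  filter_upwards [(chartAt ℂ (H.incl p)).open_target.mem_nhds ht] with t ht
  obtain ⟨-, -, q, h1, h2⟩ := h t ht
  change H.x ((chartAt ℂ (H.incl p)).symm t) = X t
  rw [h1, x_incl, h2]

theorem contMDiffAt_z {p : H.AffineInf} (hp : p.1.1 = 0) :
    ContMDiffAt 𝓘(ℝ, ℂ) 𝓘(ℝ, ℂ) ∞ H.z (H.inclInf p) := by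
  obtain ⟨-, -, -, Z, W, h⟩ := H.chartAt_inclInf_spec p hp
  rw [contMDiffAt_iff]
  refine ⟨H.continuousAt_z p, ?_⟩
  simp only [mfld_simps]
  have ht := (chartAt ℂ (H.inclInf p)).map_source (mem_chart_source ℂ (H.inclInf p))
  refine ContDiffAt.contDiffWithinAt
    (((h _ ht).1.contDiffAt.restrict_scalars ℝ).congr_of_eventuallyEq ?_)
  filter_upwards [(chartAt ℂ (H.inclInf p)).open_target.mem_nhds ht] with t ht
  obtain ⟨-, -, q, h1, h2⟩ := h t ht
  change H.z ((chartAt ℂ (H.inclInf p)).symm t) = Z t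
  rw [h1, z_inclInf, h2]

/-- A function that is smooth in the coordinate `x` is smooth on `C₀`, also where `x` is not a local
coordinate. -/
theorem contMDiffAt_of_comp_x {v : H.Curve → ℝ} {p : H.AffineZero} {h : ℂ → ℝ}
    (hh : ContDiffAt ℝ ∞ h p.1.1) (hv : ∀ᶠ t in 𝓝 p.1.1, ∀ q : H.AffineZero, q.1.1 = t →
      v (H.incl q) = h t) :
    ContMDiffAt 𝓘(ℝ, ℂ) 𝓘(ℝ, ℝ) ∞ v (H.incl p) := by
  have h1 : ContMDiffAt 𝓘(ℝ, ℂ) 𝓘(ℝ, ℝ) ∞ (h ∘ H.x) (H.incl p) :=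
    ContMDiffAt.comp (I' := 𝓘(ℝ, ℂ)) _ hh.contMDiffAt (H.contMDiffAt_x p)
  refine h1.congr_of_eventuallyEq ?_
  filter_upwards [H.isOpenEmbedding_incl.isOpen_range.mem_nhds ⟨p, rfl⟩,
    (H.continuousAt_x p).tendsto.eventually hv] with Q hQ hQv
  obtain ⟨q, rfl⟩ := hQ
  exact hQv q rfl

/-- A function that is smooth in the coordinate `z` is smooth at the points at infinity, also where
`z` is not a local coordinate. -/
theorem contMDiffAt_of_comp_z {v : H.Curve → ℝ} {p : H.AffineInf} (hp : p.1.1 = 0)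
    {h : ℂ → ℝ} (hh : ContDiffAt ℝ ∞ h 0) (hv : ∀ᶠ t in 𝓝 0, ∀ q : H.AffineInf, q.1.1 = t →
      v (H.inclInf q) = h t) :
    ContMDiffAt 𝓘(ℝ, ℂ) 𝓘(ℝ, ℝ) ∞ v (H.inclInf p) := by
  have h0 : H.z (H.inclInf p) = 0 := hp
  have h1 : ContMDiffAt 𝓘(ℝ, ℂ) 𝓘(ℝ, ℝ) ∞ (h ∘ H.z) (H.inclInf p) :=
    ContMDiffAt.comp (I' := 𝓘(ℝ, ℂ)) _ (by rw [h0]; exact hh.contMDiffAt) (H.contMDiffAt_z hp)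
  refine h1.congr_of_eventuallyEq ?_
  have hc := (H.continuousAt_z p).tendsto
  rw [h0] at hc
  filter_upwards [H.isOpenEmbedding_inclInf.isOpen_range.mem_nhds ⟨p, rfl⟩, hc.eventually hv]
    with Q hQ hQv
  obtain ⟨q, rfl⟩ := hQ
  exact hQv q rfl

theorem contMDiffAt_u (hg : 1 ≤ g) {P Q : H.Curve} (h1 : Q ≠ P) (h2 : Q ≠ H.invol P) :
    ContMDiffAt 𝓘(ℝ, ℂ) 𝓘(ℝ, ℝ) ∞ (H.u P) Q := by
  rcases H.mem_range_or P with ⟨p, rfl⟩ | ⟨p, hp, rfl⟩ <;>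
    rcases H.mem_range_or Q with ⟨q, rfl⟩ | ⟨q, hq, rfl⟩
  · have hne : q.1.1 - p.1.1 ≠ 0 := fun h => by
      rcases H.eq_or_eq_invol_of_x (sub_eq_zero.1 h) with h | h
      · exact h1 h
      · exact h2 h
    refine H.contMDiffAt_of_comp_x
      (h := fun t => Real.log ‖t - p.1.1‖ - Real.log (den g t))
      ((contDiffAt_log_norm_comp (contDiff_id.sub contDiff_const) hne).sub
        (contDiff_log_den hg).contDiffAt) ?_
    have hc : ContinuousAt (fun t => t - p.1.1) q.1.1 := by fun_prop
    filter_upwards [hc.eventually_ne hne] with t ht r hr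
    rw [u, F_incl_incl, hr, Real.log_div (norm_ne_zero_iff.2 ht) (den_pos hg t).ne']
  · have hne : (1 : ℂ) - 0 * p.1.1 ≠ 0 := by simp
    refine H.contMDiffAt_of_comp_z hq
      (h := fun t => Real.log ‖1 - t * p.1.1‖ - Real.log (den g t))
      ((contDiffAt_log_norm_comp (contDiff_const.sub (contDiff_id.mul contDiff_const)) hne).sub
        (contDiff_log_den hg).contDiffAt) ?_
    have hc : ContinuousAt (fun t => 1 - t * p.1.1) 0 := by fun_prop
    filter_upwards [hc.eventually_ne hne] with t ht r hr
    rw [u, F_incl_inclInf _ hg, hr, Real.log_div (norm_ne_zero_iff.2 ht) (den_pos hg t).ne']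
  · refine H.contMDiffAt_of_comp_x (h := fun t => -Real.log (den g t))
      (contDiff_log_den hg).neg.contDiffAt (.of_forall fun t r hr => ?_)
    rw [u, F_inclInf_incl _ hp, one_div, Real.log_inv, hr]
  · rcases H.eq_or_eq_invol_of_z (hq.trans hp.symm) with h | h
    · exact absurd h h1
    · exact absurd h h2

/-! ### The product `F_W` over the Weierstrass points -/

theorem invol_sheet_of_root (s : ℤˣ) {b : ℂ} (hb : H.f.eval b = 0) :
    H.invol (H.sheet s b) = H.sheet s b := by
  refine congrArg H.incl (Subtype.ext (Prod.ext rfl ?_))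
  change -(_ * _) = _ * _
  rw [hb, Complex.zero_cpow (by norm_num)]; simp

theorem weierstrassPoints_eq : H.weierstrassPoints = H.sheet 1 '' (H.rootSet : Set ℂ) ∪
    {Q | Q ∉ Set.range H.incl ∧ H.invol Q = Q} := by
  ext Q
  constructor
  · intro hQ
    by_cases h : Q ∈ Set.range H.incl
    · obtain ⟨p, rfl⟩ := h
      have h2 : -p.1.2 = p.1.2 := congrArg H.y hQ
      have h3 : p.1.2 = 0 := neg_eq_self.1 h2
      have h4 : H.f.eval p.1.1 = 0 := by rw [← p.2, h3]; ring
      refine Or.inl ⟨p.1.1, H.mem_rootSet.2 h4, congrArg H.incl (Subtype.ext (Prod.ext rfl ?_))⟩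
      change _ * _ = p.1.2
      rw [h4, h3, Complex.zero_cpow (by norm_num), mul_zero]
    · exact Or.inr ⟨h, hQ⟩
  · rintro (⟨b, hb, rfl⟩ | h)
    · exact H.invol_sheet_of_root 1 (H.mem_rootSet.1 hb)
    · exact h.2

/-- The contribution of the Weierstrass points at infinity: there is one if `deg f = 2g + 1` and
none if `deg f = 2g + 2`. -/
theorem finprod_F_inf (p : H.AffineZero) :
    ∏ᶠ P ∈ {Q | Q ∉ Set.range H.incl ∧ H.invol Q = Q}, H.F P (H.incl p) =
      (1 / den g p.1.1) ^ (2 * g + 2 - H.f.natDegree) ∧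
    {Q | Q ∉ Set.range H.incl ∧ H.invol Q = Q}.Finite := by
  have hw : ∀ q : H.AffineInf, H.invol (H.inclInf q) = H.inclInf q ↔ q.1.2 = 0 := by
    intro q
    constructor
    · intro h
      exact neg_eq_self.1 (congrArg H.w h)
    · intro h
      refine congrArg H.inclInf (Subtype.ext (Prod.ext rfl ?_))
      change -q.1.2 = q.1.2
      rw [h, neg_zero]
  rcases H.eval_fInf_zero with ⟨hd, h0⟩ | ⟨hd, h0⟩
  · have : {Q | Q ∉ Set.range H.incl ∧ H.invol Q = Q} = {H.sheetInf 1 0} := by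
      ext Q
      constructor
      · rintro ⟨h1, h2⟩
        obtain ⟨q, hq, rfl⟩ := H.exists_inclInf_of_notMem h1
        refine congrArg H.inclInf (Subtype.ext (Prod.ext hq ?_))
        change q.1.2 = _ * _
        rw [(hw q).1 h2, h0, Complex.zero_cpow (by norm_num), mul_zero]
      · rintro rfl
        refine ⟨H.inclInf_notMem_range rfl, (hw _).2 ?_⟩
        change _ * _ = _
        rw [h0, Complex.zero_cpow (by norm_num), mul_zero]
    rw [this, finprod_mem_singleton, hd, show 2 * g + 2 - (2 * g + 1) = 1 by omega, pow_one]
    exact ⟨H.F_inclInf_incl rfl p, Set.finite_singleton _⟩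
  · have : {Q | Q ∉ Set.range H.incl ∧ H.invol Q = Q} = ∅ := by
      refine Set.eq_empty_of_forall_notMem ?_
      rintro Q ⟨h1, h2⟩
      obtain ⟨q, hq, rfl⟩ := H.exists_inclInf_of_notMem h1
      have := q.2
      rw [(hw q).1 h2, hq, h0] at this
      norm_num at this
    rw [this, finprod_mem_empty, hd, Nat.sub_self, pow_zero]
    exact ⟨rfl, Set.finite_empty⟩

theorem FW_incl (hg : 1 ≤ g) (p : H.AffineZero) : H.FW (H.incl p) =
    ‖H.f.eval p.1.1‖ / (sigma g (‖p.1.1‖ ^ 2) * (1 + ‖p.1.1‖ ^ 2) ^ 2) := by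
  obtain ⟨h1, hfin⟩ := H.finprod_F_inf p
  have hdisj : Disjoint (H.sheet 1 '' (H.rootSet : Set ℂ))
      {Q | Q ∉ Set.range H.incl ∧ H.invol Q = Q} := by
    rw [Set.disjoint_left]
    rintro _ ⟨b, -, rfl⟩ ⟨h, -⟩
    exact h ⟨_, rfl⟩
  have hinj : Function.Injective (H.sheet 1) := (H.measurableEmbedding_sheet 1).injective
  rw [FW, weierstrassPoints_eq, finprod_mem_union hdisj (H.rootSet.finite_toSet.image _) hfin, h1,
    finprod_mem_image hinj.injOn, finprod_mem_coe_finset]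
  have h2 : ∀ b, H.F (H.sheet 1 b) (H.incl p) = ‖p.1.1 - b‖ / den g p.1.1 := fun b =>
    H.F_incl_incl _ p
  simp only [h2]
  have hle : H.f.natDegree ≤ 2 * g + 2 := by have := H.natDegree_eq; omega
  rw [Finset.prod_div_distrib, ← norm_prod, ← eval_f_eq_prod, Finset.prod_const, card_rootSet,
    div_pow, one_pow, div_mul_div_comm, mul_one, ← pow_add, Nat.add_sub_cancel' hle, den_pow hg]

/-- The curvature and `F_W` combine to the Laplacian of `-log d`, the part of `u_P` that is not
harmonic. -/
theorem density_mul_curvature (hg : 1 ≤ g) (s : ℤˣ) {t : ℂ} (ht : H.f.eval t ≠ 0) :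
    H.density t * (H.gaussCurvature (H.sheet s t) / (g + 1) - 4 / (g + 1) * H.FW (H.sheet s t)) =
      -Laplacian.laplacian (fun t => Real.log (den g t)) t := by
  obtain ⟨p, hp, hpt, hp0⟩ := H.exists_regular_sheet s ht
  rw [← hp, FW_incl _ hg, gaussCurvature_incl _ hg _ hp0, laplacian_log_den hg, hpt, density]
  have h1 := one_le_sigma hg (sq_nonneg ‖t‖)
  have h2 : 0 < ‖H.f.eval t‖ := norm_pos_iff.2 ht
  field_simp
  ring

end HyperellipticEquation

/-! ### The distributional Laplacian of `u_P` -/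

namespace HyperellipticEquation

variable {g : ℕ} (H : HyperellipticEquation g)

/-- On both sheets `u_P` is the potential `log |t - a| - log d(t)`, or `-log d(t)` for `P` at
infinity. -/
theorem exists_potential (hg : 1 ≤ g) (P : H.Curve) : ∃ v : ℂ → ℝ, Measurable v ∧
    (∃ (a : ℂ) (K : ℝ), ∀ t, |v t| ≤ K * logWeight a t) ∧
    (∀ s, ∀ᵐ t, H.u P (H.sheet s t) = v t) ∧
    ∀ φ : H.Curve → ℂ, ContMDiff 𝓘(ℝ, ℂ) 𝓘(ℝ, ℂ) ∞ φ →
      ∫ t, v t • Laplacian.laplacian (H.trace φ) t = 2 * Real.pi * (φ P + φ (H.invol P)) -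
        ∫ t, Laplacian.laplacian (fun t => Real.log (den g t)) t • H.trace φ t := by
  obtain ⟨K, hK0, hK⟩ := exists_abs_log_den_le hg
  have m3 : Measurable fun t : ℂ => Real.log (den g t) := (measurable_den g).log
  rcases H.mem_range_or P with ⟨p, rfl⟩ | ⟨p, hp, rfl⟩
  · refine ⟨fun t => Real.log ‖t - p.1.1‖ - Real.log (den g t), by fun_prop,
      ⟨p.1.1, 1 + K, fun t => ?_⟩, fun s => ?_, fun φ hφ => ?_⟩
    · have h1 : |Real.log ‖t - p.1.1‖| ≤ logWeight p.1.1 t := by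
        unfold logWeight; linarith [log_one_add_sq_nonneg t]
      have h2 := abs_sub (Real.log ‖t - p.1.1‖) (Real.log (den g t))
      linarith [hK p.1.1 t]
    · filter_upwards [ae_notMem_finset {p.1.1}] with t ht
      have ht : t - p.1.1 ≠ 0 := sub_ne_zero.2 (by simpa using ht)
      obtain ⟨q, hq, hq2⟩ := H.exists_incl_eq_sheet s t
      rw [u, ← hq, F_incl_incl, hq2, Real.log_div (norm_ne_zero_iff.2 ht) (den_pos hg t).ne']
    · rw [(H.isTame_trace hg hφ).integral_log_sub_log_den hg (H.continuousAt_trace hφ _), trace_eq]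
  · refine ⟨fun t => -Real.log (den g t), m3.neg, ⟨0, K, fun t => ?_⟩, fun s => ?_,
      fun φ hφ => ?_⟩
    · rw [abs_neg]; exact hK 0 t
    · filter_upwards with t
      obtain ⟨q, hq, hq2⟩ := H.exists_incl_eq_sheet s t
      rw [u, ← hq, F_inclInf_incl _ hp, hq2, one_div, Real.log_inv]
    · exact (H.isTame_trace hg hφ).integral_neg_log_den hg
        (H.tendsto_trace_cocompact hφ.continuous hp)

theorem ae_eval_f_ne_zero : ∀ᵐ t : ℂ, H.f.eval t ≠ 0 := by
  filter_upwards [ae_notMem_finset H.rootSet] with t ht using mt H.mem_rootSet.2 ht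

theorem sheet_mem_regularPoints (s : ℤˣ) {t : ℂ} (ht : H.f.eval t ≠ 0) :
    H.sheet s t ∈ H.regularPoints := by
  obtain ⟨p, hp, -, hp0⟩ := H.exists_regular_sheet s ht
  exact ⟨p, hp, hp0⟩

theorem aestronglyMeasurable_laplaceBeltrami_sheet (hg : 1 ≤ g) {φ : H.Curve → ℂ}
    (hφ : ContMDiff 𝓘(ℝ, ℂ) 𝓘(ℝ, ℂ) ∞ φ) (s : ℤˣ) :
    AEStronglyMeasurable (fun t => H.laplaceBeltrami φ (H.sheet s t)) volume := by
  classical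
  have hm : Measurable (H.regularPoints.piecewise (H.laplaceBeltrami φ) fun _ => 0) :=
    (H.continuousOn_laplaceBeltrami hg hφ).measurable_piecewise continuousOn_const
      H.isOpen_regularPoints.measurableSet
  refine ((hm.comp (H.measurable_sheet s)).aestronglyMeasurable (μ := volume)).congr ?_
  filter_upwards [H.ae_eval_f_ne_zero] with t ht
  exact Set.piecewise_eq_of_mem _ _ _ (H.sheet_mem_regularPoints s ht)

/-- The density of the absolutely continuous part of `Δ u_P`. -/
def curvatureTerm (Q : H.Curve) : ℝ :=
  H.gaussCurvature Q / (g + 1) - 4 / (g + 1) * H.FW Q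

theorem integrable_laplacian_log_den (hg : 1 ≤ g) :
    Integrable (Laplacian.laplacian fun t => Real.log (den g t)) := by
  have h1 : IsTame {0} fun _ => 1 := ⟨Finset.singleton_nonempty 0, measurable_const, ⟨1, by simp⟩,
    fun _ _ => contDiffAt_const, ⟨0, fun t _ => by
      rw [InnerProductSpace.laplacian_const]; simp⟩⟩
  refine (h1.integral_log_den_sub hg).1.re.congr (.of_forall fun t => ?_)
  simp

theorem density_smul_curvatureTerm (hg : 1 ≤ g) (φ : H.Curve → ℂ) (s : ℤˣ) :
    ∀ᵐ t, H.density t • ((H.curvatureTerm (H.sheet s t) : ℂ) * φ (H.sheet s t)) =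
      -(Laplacian.laplacian (fun t => Real.log (den g t)) t • φ (H.sheet s t)) := by
  filter_upwards [H.ae_eval_f_ne_zero] with t ht
  rw [← neg_smul, ← H.density_mul_curvature hg s ht, curvatureTerm, Complex.real_smul,
    Complex.real_smul, Complex.ofReal_mul, mul_assoc]

theorem integrable_curvatureTerm_mul (hg : 1 ≤ g) {φ : H.Curve → ℂ} (hφ : Continuous φ) :
    Integrable (fun Q => (H.curvatureTerm Q : ℂ) * φ Q) H.area := by
  obtain ⟨M, hM⟩ := isCompact_univ.exists_bound_of_continuousOn hφ.continuousOn
  refine H.integrable_area_iff.2 fun s => ?_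
  refine Integrable.congr ?_ ((H.density_smul_curvatureTerm hg φ s).mono fun t ht => ht.symm)
  exact ((integrable_laplacian_log_den hg).smul_bdd M
    (hφ.measurable.comp (H.measurable_sheet s)).aestronglyMeasurable
    (.of_forall fun t => hM _ trivial)).neg

theorem integral_curvatureTerm_mul (hg : 1 ≤ g) {φ : H.Curve → ℂ} (hφ : Continuous φ) :
    ∫ Q, (H.curvatureTerm Q : ℂ) * φ Q ∂H.area =
      -∫ t, Laplacian.laplacian (fun t => Real.log (den g t)) t • H.trace φ t := by
  rw [H.integral_area (H.integrable_curvatureTerm_mul hg hφ), ← integral_neg]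
  refine integral_congr_ae ?_
  filter_upwards [H.density_smul_curvatureTerm hg φ 1, H.density_smul_curvatureTerm hg φ (-1)]
    with t h1 h2
  rw [sum_units_int, h1, h2, H.trace_eq_sheet φ 1, smul_add, neg_add]

theorem integrable_u_mul_laplaceBeltrami (hg : 1 ≤ g) (P : H.Curve) {φ : H.Curve → ℂ}
    (hφ : ContMDiff 𝓘(ℝ, ℂ) 𝓘(ℝ, ℂ) ∞ φ) :
    Integrable (fun Q => (H.u P Q : ℂ) * H.laplaceBeltrami φ Q) H.area := by
  obtain ⟨v, hv, ⟨a, K, hK⟩, hu, -⟩ := H.exists_potential hg P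
  obtain ⟨N, hN⟩ := H.exists_bound_laplaceBeltrami hg hφ
  obtain ⟨C, hC0, hC⟩ := H.exists_density_le
  refine H.integrable_area_iff.2 fun s => ?_
  have hi : Integrable fun t => H.density t • ((v t : ℂ) * H.laplaceBeltrami φ (H.sheet s t)) := by
    refine ((integrable_poleWeight_mul_logWeight H.rootSet a).const_mul (C * K * N)).mono'
      (H.measurable_density.aestronglyMeasurable.smul
        ((Complex.measurable_ofReal.comp hv).aestronglyMeasurable.mul
          (H.aestronglyMeasurable_laplaceBeltrami_sheet hg hφ s))) ?_
    filter_upwards [H.ae_eval_f_ne_zero] with t ht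
    rw [norm_smul, norm_mul, Complex.norm_real, Real.norm_of_nonneg (H.density_nonneg t),
      Real.norm_eq_abs]
    have h1 := hK t
    have h2 := hN _ (H.sheet_mem_regularPoints s ht)
    have h3 := poleWeight_nonneg H.rootSet t
    calc H.density t * (|v t| * ‖H.laplaceBeltrami φ (H.sheet s t)‖)
        ≤ (C * poleWeight H.rootSet t) * ((K * logWeight a t) * N) := by
          refine mul_le_mul (hC t) (mul_le_mul h1 h2 (norm_nonneg _) ?_) (by positivity)
            (by positivity)
          exact (abs_nonneg _).trans h1
      _ = _ := by ring
  refine hi.congr ?_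
  filter_upwards [hu s] with t ht
  rw [ht]

/-- The distributional Laplacian of `u_P`, as an absolutely convergent integral. -/
theorem integral_u_mul_laplaceBeltrami (hg : 1 ≤ g) (P : H.Curve) {φ : H.Curve → ℂ}
    (hφ : ContMDiff 𝓘(ℝ, ℂ) 𝓘(ℝ, ℂ) ∞ φ) :
    ∫ Q, (H.u P Q : ℂ) * H.laplaceBeltrami φ Q ∂H.area =
      (∫ Q, (H.curvatureTerm Q : ℂ) * φ Q ∂H.area) +
        2 * Real.pi * (φ P + φ (H.invol P)) := by
  obtain ⟨v, -, -, hu, he⟩ := H.exists_potential hg P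
  rw [H.integral_curvatureTerm_mul hg hφ.continuous, add_comm, ← sub_eq_add_neg, ← he φ hφ,
    H.integral_area (H.integrable_u_mul_laplaceBeltrami hg P hφ)]
  refine integral_congr_ae ?_
  filter_upwards [hu 1, hu (-1), H.ae_eval_f_ne_zero] with t h1 h2 ht
  rw [H.laplacian_trace hg hφ ht, sum_units_int, sum_units_int, h1, h2]
  simp only [Complex.real_smul]
  ring

/-! ### Removing coordinate discs -/

theorem measurableSet_coordDisc (e : OpenPartialHomeomorph H.Curve ℂ) (Q : H.Curve) (ε : ℝ) :
    MeasurableSet (H.coordDisc e Q ε) := by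
  have h : H.coordDisc e Q ε = e.source \ (e.source ∩ e ⁻¹' {t | ε < ‖t - e Q‖}) := by
    ext R
    simp only [coordDisc, Set.mem_ofPred_eq, Set.mem_sdiff, Set.mem_inter_iff, Set.mem_preimage,
      not_and, not_lt]
    tauto
  rw [h]
  refine e.open_source.measurableSet.diff
    (e.continuousOn.isOpen_inter_preimage e.open_source ?_).measurableSet
  exact isOpen_lt continuous_const (by fun_prop)

theorem eventually_notMem_coordDisc (e : OpenPartialHomeomorph H.Curve ℂ) {P Q : H.Curve}
    (hP : P ∈ e.source) (hQ : Q ≠ P) : ∀ᶠ ε : ℝ in 𝓝[>] 0, Q ∉ H.coordDisc e P ε := by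
  by_cases hs : Q ∈ e.source
  · have h : 0 < ‖e Q - e P‖ := norm_pos_iff.2 (sub_ne_zero.2 fun h => hQ (e.injOn hs hP h))
    filter_upwards [mem_nhdsWithin_of_mem_nhds (gt_mem_nhds h)] with ε hε hd
    exact absurd hd.2 (not_le.2 hε)
  · exact .of_forall fun ε h => hs h.1

theorem tendsto_setIntegral_compl_coordDisc {h : H.Curve → ℂ} (hh : Integrable h H.area)
    {e e' : OpenPartialHomeomorph H.Curve ℂ} {P P' : H.Curve} (hP : P ∈ e.source)
    (hP' : P' ∈ e'.source) :
    Filter.Tendsto (fun ε : ℝ => ∫ Q in (H.coordDisc e P ε ∪ H.coordDisc e' P' ε)ᶜ, h Q ∂H.area)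
      (𝓝[>] 0) (𝓝 (∫ Q, h Q ∂H.area)) := by
  have hm : ∀ ε, MeasurableSet (H.coordDisc e P ε ∪ H.coordDisc e' P' ε)ᶜ := fun ε =>
    ((H.measurableSet_coordDisc e P ε).union (H.measurableSet_coordDisc e' P' ε)).compl
  simp only [← integral_indicator (hm _)]
  refine tendsto_integral_filter_of_dominated_convergence (fun Q => ‖h Q‖)
    (.of_forall fun ε => hh.aestronglyMeasurable.indicator (hm ε))
    (.of_forall fun ε => .of_forall fun Q => norm_indicator_le_norm_self _ _) hh.norm ?_
  filter_upwards [measure_eq_zero_iff_ae_notMem.1 (H.area_singleton P),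
    measure_eq_zero_iff_ae_notMem.1 (H.area_singleton P')] with Q h1 h2
  refine tendsto_const_nhds.congr' ?_
  filter_upwards [H.eventually_notMem_coordDisc e hP h1,
    H.eventually_notMem_coordDisc e' hP' h2] with ε h3 h4
  rw [Set.indicator_of_mem]
  simp [h3, h4]

/-! ### Continuity for the Fréchet topology -/

theorem SmoothFunction.contMDiff (φ : H.SmoothFunction) :
    ContMDiff 𝓘(ℝ, ℂ) 𝓘(ℝ, ℂ) ∞ φ := φ.2

/-- Convergence in `C^∞(X, ℂ)` implies uniform convergence. -/
theorem tendstoUniformly_coe (φ : H.SmoothFunction) :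
    TendstoUniformly (fun (ψ : H.SmoothFunction) (Q : H.Curve) => ψ Q) φ (𝓝 φ) := by
  rw [← tendstoLocallyUniformly_iff_tendstoUniformly_of_compactSpace]
  rw [Metric.tendstoLocallyUniformly_iff]
  intro ε hε Q
  have hc : Continuous (fun ψ : H.SmoothFunction =>
      UniformOnFun.ofFun {S : Set ℂ | IsCompact S ∧ S ⊆ (chartAt ℂ Q).target}
        (iteratedFDeriv ℝ 0 fun ζ => ψ ((chartAt ℂ Q).symm ζ))) :=
    continuous_iInf_dom (i := Q) (continuous_iInf_dom (i := 0) continuous_induced_dom)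
  have hs := mem_chart_source ℂ Q
  have ht := (chartAt ℂ Q).map_source hs
  obtain ⟨S, hS, hST, hSc⟩ := local_compact_nhds
    ((chartAt ℂ Q).open_target.mem_nhds ht)
  have h1 := UniformOnFun.tendsto_iff_tendstoUniformlyOn.1 (hc.tendsto φ) S ⟨hSc, hST⟩
  rw [Metric.tendstoUniformlyOn_iff] at h1
  refine ⟨(chartAt ℂ Q).source ∩ chartAt ℂ Q ⁻¹' S, Filter.inter_mem
    ((chartAt ℂ Q).open_source.mem_nhds hs) ((chartAt ℂ Q).continuousAt hs hS), ?_⟩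
  filter_upwards [h1 ε hε] with ψ hψ R hR
  have h2 := hψ _ hR.2
  have h3 : ∀ χ : H.SmoothFunction, iteratedFDeriv ℝ 0 (fun ζ => χ ((chartAt ℂ Q).symm ζ))
      (chartAt ℂ Q R) 0 = χ R := fun χ => by
    rw [iteratedFDeriv_zero_apply, (chartAt ℂ Q).left_inv hR.1]
  rw [← h3 φ, ← h3 ψ, dist_eq_norm, ← sub_apply]
  rw [dist_eq_norm] at h2
  refine (ContinuousMultilinearMap.le_opNorm _ _).trans_lt ?_
  simpa using h2

/-- The functional `Δ u_P`. -/
def laplacianU (hg : 1 ≤ g) (P : H.Curve) : H.SmoothFunction →L[ℂ] ℂ where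
  toFun φ := (∫ Q, (H.curvatureTerm Q : ℂ) * φ Q ∂H.area) +
    2 * Real.pi * (φ P + φ (H.invol P))
  map_add' φ ψ := by
    have e : ∀ Q, (φ + ψ : H.SmoothFunction) Q = φ Q + ψ Q := fun Q => rfl
    simp only [e, mul_add]
    rw [integral_add (H.integrable_curvatureTerm_mul hg φ.contMDiff.continuous)
      (H.integrable_curvatureTerm_mul hg ψ.contMDiff.continuous)]
    ring
  map_smul' c φ := by
    have e : ∀ Q, (c • φ : H.SmoothFunction) Q = c * φ Q := fun Q => rfl
    simp only [e, mul_left_comm _ c, integral_const_mul, RingHom.id_apply, smul_eq_mul]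
    ring
  cont := by
    refine continuous_iff_continuousAt.2 fun φ => ?_
    have hu := H.tendstoUniformly_coe φ
    have hint : Integrable (fun Q => (H.curvatureTerm Q : ℂ)) H.area := by
      simpa using H.integrable_curvatureTerm_mul hg (φ := fun _ => 1) continuous_const
    refine ContinuousAt.add ?_ (continuousAt_const.mul
      ((hu.tendsto_at P).add (hu.tendsto_at (H.invol P))))
    rw [ContinuousAt, Metric.tendsto_nhds]
    intro ε hε
    set A := ∫ Q, ‖(H.curvatureTerm Q : ℂ)‖ ∂H.area
    have hA : 0 ≤ A := integral_nonneg fun _ => norm_nonneg _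
    filter_upwards [Metric.tendstoUniformly_iff.1 hu (ε / (A + 1)) (by positivity)] with ψ hψ
    rw [dist_eq_norm, ← integral_sub (H.integrable_curvatureTerm_mul hg ψ.contMDiff.continuous)
      (H.integrable_curvatureTerm_mul hg φ.contMDiff.continuous)]
    have hb : ∀ Q, ‖(H.curvatureTerm Q : ℂ) * ψ Q - H.curvatureTerm Q * φ Q‖ ≤
        ‖(H.curvatureTerm Q : ℂ)‖ * (ε / (A + 1)) := fun Q => by
      rw [← mul_sub, norm_mul, ← dist_eq_norm, dist_comm]
      exact mul_le_mul_of_nonneg_left (hψ Q).le (norm_nonneg _)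
    refine (norm_integral_le_of_norm_le (hint.norm.mul_const _) (.of_forall hb)).trans_lt ?_
    rw [integral_mul_const, mul_div_assoc', div_lt_iff₀ (by positivity)]
    nlinarith

end HyperellipticEquation

end

theorem theoremp1 (g : ℕ) (hg : 2 ≤ g) (H : HyperellipticEquation g) (P : H.Curve) :
    (∀ Q : H.Curve, Q ≠ P → Q ≠ H.invol P → 0 < H.F P Q) ∧
    ContMDiffOn 𝓘(ℝ, ℂ) 𝓘(ℝ, ℝ) ∞ (H.u P) {P, H.invol P}ᶜ ∧
    (∀ Q ∈ ({P, H.invol P}ᶜ : Set H.Curve),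
      H.u P (H.invol Q) = H.u P Q ∧ H.u (H.invol P) Q = H.u P Q) ∧
    ∃ L : H.SmoothFunction →L[ℂ] ℂ,
      (∀ e ∈ IsManifold.maximalAtlas 𝓘(ℂ) ω H.Curve, P ∈ e.source →
        ∀ e' ∈ IsManifold.maximalAtlas 𝓘(ℂ) ω H.Curve, H.invol P ∈ e'.source →
        ∀ φ : H.SmoothFunction,
          (∀ ε : ℝ, 0 < ε → IntegrableOn (fun Q => (H.u P Q : ℂ) * H.laplaceBeltrami φ Q)
            (H.coordDisc e P ε ∪ H.coordDisc e' (H.invol P) ε)ᶜ H.area) ∧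
          Filter.Tendsto
            (fun ε : ℝ => ∫ Q in (H.coordDisc e P ε ∪ H.coordDisc e' (H.invol P) ε)ᶜ,
              (H.u P Q : ℂ) * H.laplaceBeltrami φ Q ∂H.area)
            (𝓝[>] 0) (𝓝 (L φ))) ∧
      ∀ φ : H.SmoothFunction,
        Integrable (fun Q => ((H.gaussCurvature Q / (g + 1) - 4 / (g + 1) * H.FW Q : ℝ) : ℂ) * φ Q)
          H.area ∧
        L φ = (∫ Q, ((H.gaussCurvature Q / (g + 1) - 4 / (g + 1) * H.FW Q : ℝ) : ℂ) * φ Q ∂H.area) +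
          2 * Real.pi * (φ P + φ (H.invol P)) := by
  have hg1 : 1 ≤ g := by omega
  refine ⟨fun Q => H.F_pos hg1, fun Q hQ => ?_, fun Q _ => ⟨?_, ?_⟩, H.laplacianU hg1 P,
    fun e _ hP e' _ hP' φ => ?_, fun φ => ⟨?_, rfl⟩⟩
  · simp only [Set.mem_compl_iff, Set.mem_insert_iff, Set.mem_singleton_iff, not_or] at hQ
    exact (H.contMDiffAt_u hg1 hQ.1 hQ.2).contMDiffWithinAt
  · rw [HyperellipticEquation.u, H.F_invol_right]; rfl
  · rw [HyperellipticEquation.u, H.F_invol_left]; rfl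
  · have hi := H.integrable_u_mul_laplaceBeltrami hg1 P φ.contMDiff
    refine ⟨fun ε _ => hi.integrableOn, ?_⟩
    have h := H.tendsto_setIntegral_compl_coordDisc hi hP hP'
    rwa [H.integral_u_mul_laplaceBeltrami hg1 P φ.contMDiff] at h
  · exact H.integrable_curvatureTerm_mul hg1 φ.contMDiff.continuous
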